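/- Let $(M,g)$ be a (geodesically) complete semi-Riemannian manifold (smooth, Hausdorff, second countable, not necessarily connected, $g$ of constant index), let $\epsilon\in\{1,-1\}$, and let $\widehat M=\mathbb{R}_{>0}\times M$ with $\widehat g=\epsilon\,\mathrm{d}r^2+r^2g$ be the cone over $(M,g)$. Suppose that $V$ is a smooth vector field on $\widehat M$ which is parallel for the Levi-Civita connection of $\widehat g$ and light-like, i.e. nowhere zero with $\widehat g(V,V)=0$. Then $\widehat g(V,\partial_r)$ does not depend on $r$, i.e. $\widehat g(V,\partial_r)_{(r,p)}=u(p)$ for a function $u\in C^\infty(M)$, and $\widehat M$ is the disjoint union $\widehat M=\widehat M_-\cup\widehat M_0\cup\widehat M_+$, where \[\widehat M_\pm=\{\pm\widehat g(V,\partial_r)>0\},\qquad \widehat M_0=\{\widehat g(V,\partial_r)=0\}=\mathbb{R}_{>0}\times M_0,\quad M_0=\{p\in M\mid u(p)=0\}.\] Moreover, for each of the two signs there is a complete semi-Riemannian manifold $(N_\pm,g_{N_\pm})$ of dimension $\dim M-1$ (possibly disconnected, and empty if $\widehat M_\pm$ is empty) such that, with $\mathbb{R}_\pm=\{x\in\mathbb{R}\mid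 \pm x>0\}$ and $\mathbb{R}_\epsilon=\{x\in\mathbb{R}\mid\epsilon x>0\}$, the following holds. (i) The open subset $M_\pm=\{p\in M\mid \pm u(p)>0\}$ with the metric $g$ is globally isometric to $(\mathbb{R}\times N_\pm,\ -\epsilon\,\mathrm{d}s^2+\mathrm{e}^{2s}g_{N_\pm})$ by a diffeomorphism $\Phi_\pm:\mathbb{R}\times N_\pm\to M_\pm$. (ii) The open subset $\widehat M_\pm$ with the metric $\widehat g$ is globally isometric to \[(\mathbb{R}_+\times\mathbb{R}_\epsilon\times N_\pm,\ 2\,\mathrm{d}u\,\mathrm{d}v+u^2g_{N_\pm}),\] where $u$ and $v$ now denote the coordinates on $\mathbb{R}_+$ and $\mathbb{R}_\epsilon$. Writing the points of $\widehat M_\pm=\mathbb{R}_{>0}\times M_\pm$ as $(r,s,p)$ with $r>0$ and $(s,p)\in\mathbb{R}\times N_\pm$ by means of $\Phi_\pm$, the isometry is given by \[\Psi_\pm:(r,s,p)\longmapsto\Bigl(u=r\mathrm{e}^{s},\ v=\tfrac{\epsilon}{2}r\mathrm{e}^{-s},\ p\Bigr).\] -/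

import Mathlib

open Set TopologicalSpace Bundle
open scoped Manifold ContDiff

universe uE uM

noncomputable section

section General

variable {E : Type*} [NormedAddCommGroup E] [NormedSpace ℝ E]
  {H : Type*} [TopologicalSpace H] (I : ModelWithCorners ℝ E H)
  {M : Type*} [TopologicalSpace M] [ChartedSpace H M]
  {E' : Type*} [NormedAddCommGroup E'] [NormedSpace ℝ E']
  {H' : Type*} [TopologicalSpace H'] (J : ModelWithCorners ℝ E' H')
  {N : Type*} [TopologicalSpace N] [ChartedSpace H' N]

variable (M) in
/-- A (not necessarily smooth, symmetric or nondegenerate) field of bilinear forms on the tangent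
spaces of `M`. -/
abbrev FormField := ∀ x : M, TangentSpace I x →L[ℝ] TangentSpace I x →L[ℝ] ℝ

/-- The product `α ⊗ β` of two linear forms on a tangent space. -/
def tensorForm {x : M} (α β : TangentSpace I x →L[ℝ] ℝ) :
    TangentSpace I x →L[ℝ] TangentSpace I x →L[ℝ] ℝ :=
  α.smulRight β

/-- The pull-back of a bilinear form under a linear map between tangent spaces. -/
def pullForm {x : M} {y : N} (L : TangentSpace I x →L[ℝ] TangentSpace J y)
    (B : TangentSpace J y →L[ℝ] TangentSpace J y →L[ℝ] ℝ) :
    TangentSpace I x →L[ℝ] TangentSpace I x →L[ℝ] ℝ :=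
  (ContinuousLinearMap.precomp ℝ L).comp (B.comp L)

/-- A semi-Riemannian metric: a smooth field of symmetric nondegenerate bilinear forms of
constant index. -/
structure IsSemiRiemannian [IsManifold I ∞ M] (g : FormField I M) : Prop where
  symm : ∀ (x : M) (v w : TangentSpace I x), g x v w = g x w v
  nondegenerate : ∀ (x : M) (v : TangentSpace I x), (∀ w, g x v w = 0) → v = 0
  contMDiff : ContMDiff I (I.prod 𝓘(ℝ, E →L[ℝ] E →L[ℝ] ℝ)) ∞
    (fun x ↦ TotalSpace.mk' (E →L[ℝ] E →L[ℝ] ℝ)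
      (E := fun x : M ↦ TangentSpace I x →L[ℝ] TangentSpace I x →L[ℝ] ℝ) x (g x))
  constant_index : ∃ q : ℕ, ∀ x : M,
    IsGreatest {d : ℕ | ∃ W : Submodule ℝ (TangentSpace I x),
      Module.finrank ℝ W = d ∧ ∀ w ∈ W, w ≠ 0 → g x w w < 0} q

/-- The coordinate expression `G` of `g` in the preferred chart `φ` at `x₀`: the pull-back of `g`
under `φ⁻¹`. -/
def chartForm (g : FormField I M) (x₀ : M) (y : E) : E →L[ℝ] E →L[ℝ] ℝ :=
  pullForm 𝓘(ℝ, E) I (mfderiv 𝓘(ℝ, E) I (extChartAt I x₀).symm y) (g ((extChartAt I x₀).symm y))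

/-- Christoffel symbols of the first kind at the coordinate point `y`, contracted with three
vectors: `½ (∂_v G(w, z) + ∂_w G(v, z) - ∂_z G(v, w))`, i.e. `G(∇_v w, z)` for constant
coordinate fields `v, w, z`, where `∇` is the Levi-Civita connection. -/
def christoffel (g : FormField I M) (x₀ : M) (y v w z : E) : ℝ :=
  (fderiv ℝ (chartForm I g x₀) y v w z + fderiv ℝ (chartForm I g x₀) y w v z
    - fderiv ℝ (chartForm I g x₀) y z v w) / 2

/-- The coordinate expression of a vector field in the preferred chart at `x₀`. -/
def chartField (V : ∀ x : M, TangentSpace I x) (x₀ : M) (y : E) : E :=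
  mfderiv I 𝓘(ℝ, E) (extChartAt I x₀) ((extChartAt I x₀).symm y) (V ((extChartAt I x₀).symm y))

/-- `V` is a smooth vector field which is parallel for the Levi-Civita connection of `g`. In the
chart at each point `x` the condition reads `g(∇_v V, z) = 0` for all `v, z`. -/
structure IsParallelField [IsManifold I ∞ M] (g : FormField I M)
    (V : ∀ x : M, TangentSpace I x) : Prop where
  contMDiff : ContMDiff I I.tangent ∞ (fun x ↦ (⟨x, V x⟩ : TangentBundle I M))
  parallel : ∀ (x : M) (v z : E),
    chartForm I g x (extChartAt I x x)
        (fderiv ℝ (chartField I V x) (extChartAt I x x) v) z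
      + christoffel I g x (extChartAt I x x) v (chartField I V x (extChartAt I x x)) z = 0

/-- `γ : ℝ → M` is a geodesic of `g`, defined on all of `ℝ`: it is smooth and, in the chart at
each of its points, satisfies `g(c'' + Γ(c', c'), z) = 0` for all `z`. -/
structure IsGeodesic (g : FormField I M) (γ : ℝ → M) : Prop where
  contMDiff : ContMDiff 𝓘(ℝ, ℝ) I ∞ γ
  geodesic : ∀ (t : ℝ) (z : E),
    let c : ℝ → E := fun τ ↦ extChartAt I (γ t) (γ τ)
    chartForm I g (γ t) (c t) (deriv (deriv c) t) z
      + christoffel I g (γ t) (c t) (deriv c t) (deriv c t) z = 0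

/-- Geodesic completeness: every tangent vector of `M` is the initial velocity of a geodesic
defined on all of `ℝ`. -/
def IsGeodesicallyComplete (g : FormField I M) : Prop :=
  ∀ ξ : TangentBundle I M, ∃ γ : ℝ → M, IsGeodesic I g γ ∧
    (⟨γ 0, mfderiv 𝓘(ℝ, ℝ) I γ 0 (1 : ℝ)⟩ : TangentBundle I M) = ξ

/-- The restriction of a field of bilinear forms to an open submanifold. -/
def restrictForm (g : FormField I M) (U : Opens M) : FormField I U := fun x ↦
  pullForm I I (mfderiv I I (Subtype.val : U → M) x) (g x)

/-- The diffeomorphism `Φ` is an isometry from `(M, g)` onto `(N, h)`. -/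
def IsIsometry (g : FormField I M) (h : FormField J N) (Φ : M ≃ₘ^∞⟮I, J⟯ N) : Prop :=
  ∀ (x : M) (v w : TangentSpace I x),
    h (Φ x) (mfderiv I J Φ x v) (mfderiv I J Φ x w) = g x v w

end General

/-- The open half-line `ℝ_ε = {x | ε x > 0}`. -/
def halfLine (ε : ℝ) : Opens ℝ := ⟨{x | 0 < ε * x}, isOpen_lt continuous_const (by fun_prop)⟩

section Cone

variable {E : Type*} [NormedAddCommGroup E] [NormedSpace ℝ E]
  {H : Type*} [TopologicalSpace H] (I : ModelWithCorners ℝ E H)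
  {M : Type*} [TopologicalSpace M] [ChartedSpace H M]

variable (M) in
/-- The manifold `ℝ_{>0} × M` underlying the cone over `M`. -/
abbrev Cone := halfLine 1 × M

/-- The model with corners of the cone. -/
abbrev coneModel := 𝓘(ℝ, ℝ).prod I

/-- The cone metric `ε dr² + r² g` on `ℝ_{>0} × M`. -/
def coneMetric (ε : ℝ) (g : FormField I M) : FormField (coneModel I) (Cone M) := fun x ↦
  let dr := mvfderiv (coneModel I) (fun y : Cone M ↦ (y.1 : ℝ)) x
  ε • tensorForm (coneModel I) dr dr
    + (x.1 : ℝ) ^ 2 • pullForm (coneModel I) I (mfderiv (coneModel I) I Prod.snd x) (g x.2)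

/-- The radial vector field `∂_r` on the cone. -/
def radialField (x : Cone M) : TangentSpace (coneModel I) x :=
  ((1, 0) : ℝ × E)

/-- The function `ĝ(V, ∂_r)` on the cone. -/
def radialComponent (ε : ℝ) (g : FormField I M) (V : ∀ x : Cone M, TangentSpace (coneModel I) x)
    (x : Cone M) : ℝ :=
  coneMetric I ε g x (V x) (radialField I x)

/-- The part `{σ ĝ(V, ∂_r) > 0}` of the cone, for a sign `σ = ±1`. -/
def conePiece (ε : ℝ) (g : FormField I M) (V : ∀ x : Cone M, TangentSpace (coneModel I) x)
    (σ : ℝ) : Set (Cone M) :=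
  {x | 0 < σ * radialComponent I ε g V x}

/-- The part `{ĝ(V, ∂_r) = 0}` of the cone. -/
def coneZero (ε : ℝ) (g : FormField I M) (V : ∀ x : Cone M, TangentSpace (coneModel I) x) :
    Set (Cone M) :=
  {x | radialComponent I ε g V x = 0}

/-- The warped product metric `-ε ds² + e^{2s} g` on `ℝ × M`. -/
def expWarpedMetric (ε : ℝ) (g : FormField I M) : FormField (𝓘(ℝ, ℝ).prod I) (ℝ × M) := fun x ↦
  let ds := mvfderiv (𝓘(ℝ, ℝ).prod I) (fun y : ℝ × M ↦ y.1) x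
  (-ε) • tensorForm (𝓘(ℝ, ℝ).prod I) ds ds
    + Real.exp (2 * x.1) • pullForm (𝓘(ℝ, ℝ).prod I) I
        (mfderiv (𝓘(ℝ, ℝ).prod I) I Prod.snd x) (g x.2)

/-- The manifold `ℝ_+ × ℝ_ε × M`. -/
abbrev WaveSpace (ε : ℝ) (M : Type*) := halfLine 1 × halfLine ε × M

/-- The model with corners of `ℝ_+ × ℝ_ε × M`. -/
abbrev waveModel := 𝓘(ℝ, ℝ).prod (𝓘(ℝ, ℝ).prod I)

/-- The metric `2 du dv + u² g` on `ℝ_+ × ℝ_ε × M`, where `2 du dv = du ⊗ dv + dv ⊗ du`. -/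
def waveMetric (ε : ℝ) (g : FormField I M) : FormField (waveModel I) (WaveSpace ε M) := fun x ↦
  let du := mvfderiv (waveModel I) (fun y : WaveSpace ε M ↦ (y.1 : ℝ)) x
  let dv := mvfderiv (waveModel I) (fun y : WaveSpace ε M ↦ (y.2.1 : ℝ)) x
  tensorForm (waveModel I) du dv + tensorForm (waveModel I) dv du
    + (x.1 : ℝ) ^ 2 • pullForm (waveModel I) I
        (mfderiv (waveModel I) I (fun y : WaveSpace ε M ↦ y.2.2) x) (g x.2.2)

end Cone

end

/-! Write `ĝ(V, ∂_r) = u`, and let `Z` be the tangential part of `V` on the slice `r = 1`. Testing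
`∇V = 0` against pairs of radial and tangential directions shows that `u` does not depend on `r`,
that `du = g(·, Z)` and that `∇_v Z = -ε u v`. Nullity of `V` gives `g(Z, Z) = -ε u²`. These facts
are collected in `IsConformalGradient`, and from then on everything happens on `M`.

Where `u ≠ 0`, put `T = -ε Z / u` (`unitField`). Then `g(T, T) = -ε`, `du(T) = u` and `∇_v T = v -
(du(v) / u) T`, so `∇_T T = 0` and integral curves of `T` are geodesics. Completeness supplies for
each `q` a geodesic `t ↦ θ t q` with initial velocity `T q` on all of `ℝ`. Along it `u'' = -ε g(γ',
γ') u = u` and `u'(0) = u(0)`, hence `u (θ t q) = u q · e^t`. The curve never reaches the zeros of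
`u`, so it stays an integral curve of `T`: the flow of `T` is complete on `{u ≠ 0}`. Its smoothness
rests on the smooth dependence of solutions of differential equations on initial values.

For a sign `σ`, the level set `N = {σ u = 1}` is regular, and `(s, p) ↦ θ s p` is a diffeomorphism
from `ℝ × N` onto `{σ u > 0}`, with inverse `q ↦ (log (σ u q), θ (-log (σ u q)) q)`. Fields `X`
tangent to the levels and transported by the flow satisfy `∇_T X = ∇_X T = X`, so their products
grow like `e^{2s}`. This is the warped product (`LevelSplitting.formAt_mder_splitMap`). On the cone,
`u = r e^s` and `v = (ε/2) r e^{-s}` give `2 du dv = ε (dr² - r² ds²)`, which is (ii).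

Completeness of `N` uses completeness of `M` once more. Given `ξ` tangent to `N` and a time `b`,
take the geodesic of `M` with initial velocity `a T + ξ`. Its projection to `N` is a geodesic up to
parameter, and its affine parameter `x` satisfies `dt/dx = w²` with `w = σ u`. Since `w'' = (a² - ε
g(ξ, ξ)) w`, one finds `w² = 1 / Q` with the quadratic polynomial `Q = 1 - 2 a x + ε g(ξ, ξ) x²`. A
suitable `a` keeps `Q` positive between `0` and `b`, so the projection covers that interval. The
geodesics obtained for all `b` fit together by uniqueness. -/

noncomputable section

/-! ### Smooth dependence of local flows on time and initial value. -/

section SmoothFlow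

open Metric

/-- A continuous local flow of a `C¹` vector field, staying in a prescribed ball. -/
theorem exists_continuousOn_localFlow {E : Type*} [NormedAddCommGroup E] [NormedSpace ℝ E]
    [CompleteSpace E] {F : E → E} {x₀ : E} (hF : ContDiffAt ℝ 1 F x₀) {a : ℝ} (ha : 0 < a) :
    ∃ δ > 0, ∃ r > 0, ∃ α : ℝ → E → E,
      ContinuousOn (fun q : ℝ × E ↦ α q.1 q.2) (Icc (-δ) δ ×ˢ ball x₀ r) ∧
      ∀ x ∈ ball x₀ r, α 0 x = x ∧ ∀ t ∈ Icc (-δ) δ,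
        α t x ∈ ball x₀ a ∧ HasDerivAt (fun t ↦ α t x) (F (α t x)) t := by
  obtain ⟨ε, hε, b, r, L, K, hr, hpl⟩ := IsPicardLindelof.of_contDiffAt_one hF
  obtain ⟨α, hα, hc⟩ := (hpl 0).exists_forall_mem_closedBall_eq_hasDerivWithinAt_continuousOn
  have hr' : (0 : ℝ) < r := hr
  have hc0 : ContinuousAt α (x₀, 0) := by
    refine hc.continuousAt (prod_mem_nhds (closedBall_mem_nhds _ hr') (Icc_mem_nhds ?_ ?_))
      <;> simpa using hε
  have h0 : α (x₀, 0) = x₀ := (hα x₀ (mem_closedBall_self hr'.le)).1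
  have hmem : α ⁻¹' ball x₀ a ∈ nhds (x₀, (0 : ℝ)) :=
    hc0.preimage_mem_nhds (by rw [h0]; exact ball_mem_nhds _ ha)
  obtain ⟨η, hη, hball⟩ := Metric.mem_nhds_iff.1 hmem
  -- Halving puts the closed time interval inside the open one of radius `min ε η`, on which both
  -- the Picard–Lindelöf solution and the continuity estimate are available.
  have hsub : ∀ x ∈ ball x₀ (min (r : ℝ) η), ∀ t ∈ Icc (-(min ε η / 2)) (min ε η / 2),
      x ∈ closedBall x₀ r ∧ t ∈ Ioo (0 - ε) (0 + ε) ∧ α (x, t) ∈ ball x₀ a := by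
    intro x hx t ht
    have h1 : 0 < min ε η := lt_min hε hη
    have h2 := min_le_left ε η
    have h3 := min_le_right ε η
    refine ⟨ball_subset_closedBall (ball_subset_ball (min_le_left _ _) hx),
      ⟨by linarith [ht.1], by linarith [ht.2]⟩, hball ?_⟩
    rw [mem_ball, Prod.dist_eq]
    refine max_lt (ball_subset_ball (min_le_right _ _) hx) ?_
    simp only [dist_zero_right, Real.norm_eq_abs]
    exact lt_of_le_of_lt (abs_le.2 ht) (by linarith)
  refine ⟨min ε η / 2, by positivity, min r η, by positivity, fun t x ↦ α (x, t), ?_, ?_⟩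
  · refine hc.comp (by fun_prop) fun q hq ↦ ?_
    have := hsub q.2 hq.2 q.1 hq.1
    exact ⟨this.1, Ioo_subset_Icc_self this.2.1⟩
  · intro x hx
    refine ⟨(hα x (ball_subset_closedBall (ball_subset_ball (min_le_left _ _) hx))).1,
      fun t ht ↦ ?_⟩
    obtain ⟨h1, h2, h3⟩ := hsub x hx t ht
    exact ⟨h3, ((hα x h1).2 t (Ioo_subset_Icc_self h2)).hasDerivAt (Icc_mem_nhds h2.1 h2.2)⟩

/-- With equal initial values the Grönwall bound is linear in the defect, so a defect of order
`‖h‖²` gives an error of order `‖h‖²`. -/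
theorem gronwallBound_zero_mul (K ε x : ℝ) :
    gronwallBound 0 K ε x = ε * gronwallBound 0 K 1 x := by
  by_cases hK : K = 0
  · simp [hK, gronwallBound_K0]
  · simp only [gronwallBound_of_K_ne_0 hK]; ring

/-- If `R` solves the variational equation along the flow `Ψ`, then `R t` is the derivative of the
time `t` map. -/
theorem hasFDerivAt_localFlow {E : Type*} [NormedAddCommGroup E] [NormedSpace ℝ E]
    {F : E → E} {x₀ : E} {b δ r : ℝ} {K₁ K₂ : NNReal} (hδ : 0 < δ)
    (hdiff : ∀ y ∈ ball x₀ b, DifferentiableAt ℝ F y)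
    (hK₁ : LipschitzOnWith K₁ F (ball x₀ b)) (hK₂ : LipschitzOnWith K₂ (fderiv ℝ F) (ball x₀ b))
    {Ψ : ℝ → E → E} {R : ℝ → E →L[ℝ] E} {x : E} (hx : x ∈ ball x₀ r)
    (hΨ : ∀ x ∈ ball x₀ r, Ψ 0 x = x ∧ ∀ t ∈ Icc (-δ) δ,
      Ψ t x ∈ ball x₀ (b / 2) ∧ HasDerivAt (fun t ↦ Ψ t x) (F (Ψ t x)) t)
    (hR0 : R 0 = ContinuousLinearMap.id ℝ E)
    (hR : ∀ t ∈ Icc (-δ) δ, ‖R t‖ ≤ 2 ∧ HasDerivAt R (fderiv ℝ F (Ψ t x) ∘L R t) t)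
    {t : ℝ} (ht : t ∈ Icc 0 δ) : HasFDerivAt (Ψ t) (R t) x := by
  have hIcc : Icc 0 δ ⊆ Icc (-δ) δ := Icc_subset_Icc_left (by linarith)
  have hb : 0 < b := by
    have := (hΨ x hx).2 t (hIcc ht)
    have := dist_nonneg.trans_lt (mem_ball.1 this.1)
    linarith
  set C := gronwallBound 0 K₁ 1 t with hC
  -- The linear prediction `Ψ s x + R s h` starts at `x + h` and solves the equation up to a defect
  -- of order `‖h‖²`, because `fderiv ℝ F` is Lipschitz. Grönwall compares it with the true
  -- trajectory from `x + h`.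
  have key : ∀ᶠ h in nhds (0 : E), ‖Ψ t (x + h) - Ψ t x - R t h‖ ≤ (K₂ * 4 * C) * ‖h‖ ^ 2 := by
    have h1 : ∀ᶠ h in nhds (0 : E), x + h ∈ ball x₀ r := by
      have : ContinuousAt (fun h : E ↦ x + h) 0 := by fun_prop
      exact this.eventually_mem (by simpa using isOpen_ball.mem_nhds hx)
    -- Then `‖R s h‖ ≤ 2 ‖h‖ < b / 2`, and the prediction stays in `ball x₀ b` because `Ψ s x` stays
    -- in `ball x₀ (b / 2)`.
    have h2 : ∀ᶠ h in nhds (0 : E), ‖h‖ < b / 4 := by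
      have : ContinuousAt (fun h : E ↦ ‖h‖) 0 := by fun_prop
      exact this.eventually_lt_const (by simpa using by positivity)
    filter_upwards [h1, h2] with h hh1 hh2
    have hRh : ∀ s ∈ Icc 0 δ, ‖R s h‖ ≤ 2 * ‖h‖ := fun s hs ↦
      (R s).le_of_opNorm_le (hR s (hIcc hs)).1 h
    have hfd : ∀ s ∈ Icc 0 δ, HasDerivAt (fun s ↦ Ψ s x + R s h)
        (F (Ψ s x) + fderiv ℝ F (Ψ s x) (R s h)) s := by
      intro s hs
      refine ((hΨ x hx).2 s (hIcc hs)).2.add ?_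
      simpa using (hR s (hIcc hs)).2.clm_apply (hasDerivAt_const s h)
    have hmem : ∀ s ∈ Icc 0 δ, Ψ s x + R s h ∈ ball x₀ b := by
      intro s hs
      have h3 := mem_ball.1 ((hΨ x hx).2 s (hIcc hs)).1
      have h4 := hRh s hs
      rw [dist_eq_norm] at h3
      rw [mem_ball, dist_eq_norm]
      calc ‖Ψ s x + R s h - x₀‖ = ‖(Ψ s x - x₀) + R s h‖ := by congr 1; abel
        _ ≤ ‖Ψ s x - x₀‖ + ‖R s h‖ := norm_add_le _ _
        _ < b := by linarith
    have hhalf : ball x₀ (b / 2) ⊆ ball x₀ b := ball_subset_ball (by linarith)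
    have hrem : ∀ s ∈ Icc 0 δ, dist (F (Ψ s x) + fderiv ℝ F (Ψ s x) (R s h))
        (F (Ψ s x + R s h)) ≤ K₂ * 4 * ‖h‖ ^ 2 := by
      intro s hs
      have hy := hhalf ((hΨ x hx).2 s (hIcc hs)).1
      have hseg : segment ℝ (Ψ s x) (Ψ s x + R s h) ⊆ ball x₀ b :=
        (convex_ball x₀ b).segment_subset hy (hmem s hs)
      have := (convex_segment (𝕜 := ℝ) (Ψ s x)
        (Ψ s x + R s h)).norm_image_sub_le_of_norm_hasFDerivWithin_le'
        (f := F) (f' := fderiv ℝ F) (φ := fderiv ℝ F (Ψ s x)) (C := K₂ * (2 * ‖h‖))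
        (fun z hz ↦ (hdiff z (hseg hz)).hasFDerivAt.hasFDerivWithinAt)
        (fun z hz ↦ by
          rw [← dist_eq_norm]
          refine (hK₂.dist_le_mul z (hseg hz) _ hy).trans ?_
          gcongr
          rw [dist_comm, dist_eq_norm]
          have := norm_sub_le_of_mem_segment hz
          rw [norm_sub_rev]
          refine this.trans ?_
          simpa using hRh s hs)
        (left_mem_segment ℝ _ _) (right_mem_segment ℝ _ _)
      rw [dist_comm, dist_eq_norm, ← sub_sub]
      refine (by simpa using this : _ ≤ K₂ * (2 * ‖h‖) * ‖R s h‖).trans ?_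
      calc (K₂ : ℝ) * (2 * ‖h‖) * ‖R s h‖ ≤ K₂ * (2 * ‖h‖) * (2 * ‖h‖) := by
            gcongr; exact hRh s hs
        _ = _ := by ring
    have hIco : ∀ s ∈ Ico 0 δ, s ∈ Icc 0 δ := fun s hs ↦ Ico_subset_Icc_self hs
    have := dist_le_of_approx_trajectories_ODE_of_mem (v := fun _ ↦ F) (s := fun _ ↦ ball x₀ b)
      (K := K₁) (a := 0) (b := δ) (δ := 0) (εf := K₂ * 4 * ‖h‖ ^ 2) (εg := 0)
      (f := fun s ↦ Ψ s x + R s h) (g := fun s ↦ Ψ s (x + h)) (g' := fun s ↦ F (Ψ s (x + h)))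
      (fun _ _ ↦ hK₁) (fun s hs ↦ (hfd s hs).continuousAt.continuousWithinAt)
      (fun s hs ↦ (hfd s (hIco s hs)).hasDerivWithinAt)
      (fun s hs ↦ hrem s (hIco s hs)) (fun s hs ↦ hmem s (hIco s hs))
      (fun s hs ↦ ((hΨ _ hh1).2 s (hIcc hs)).2.continuousAt.continuousWithinAt)
      (fun s hs ↦ ((hΨ _ hh1).2 s (hIcc (hIco s hs))).2.hasDerivWithinAt)
      (fun s _ ↦ by simp) (fun s hs ↦ hhalf ((hΨ _ hh1).2 s (hIcc (hIco s hs))).1)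
      (by simp [(hΨ _ hh1).1, (hΨ _ hx).1, hR0]) t ht
    rw [sub_zero, add_zero, gronwallBound_zero_mul, dist_comm, dist_eq_norm, ← sub_sub] at this
    refine this.trans (le_of_eq ?_)
    rw [hC]; ring
  rw [hasFDerivAt_iff_isLittleO_nhds_zero]
  refine (Asymptotics.IsBigO.of_bound (K₂ * 4 * C) ?_).trans_isLittleO
    (Asymptotics.isLittleO_norm_pow_id (E' := E) one_lt_two)
  filter_upwards [key] with h hh
  simpa using hh

/-- The time `t` maps of a local flow of a smooth vector field are of class `Cⁿ`. -/
theorem exists_contDiffOn_timeMap (n : ℕ) : ∀ {E : Type uE} [NormedAddCommGroup E]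
    [NormedSpace ℝ E] [CompleteSpace E] {F : E → E} {x₀ : E} (_ : ContDiffAt ℝ ∞ F x₀)
    {a : ℝ} (_ : 0 < a), ∃ δ > 0, ∃ r > 0, ∃ Ψ : ℝ → E → E,
      (∀ x ∈ ball x₀ r, Ψ 0 x = x ∧ ∀ t ∈ Icc (-δ) δ,
        Ψ t x ∈ ball x₀ a ∧ HasDerivAt (fun t ↦ Ψ t x) (F (Ψ t x)) t) ∧
      ∀ t ∈ Icc 0 δ, ContDiffOn ℝ n (Ψ t) (ball x₀ r) := by
  induction n with
  | zero =>
    intro E _ _ _ F x₀ hF a ha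
    obtain ⟨δ, hδ, r, hr, α, hc, hα⟩ :=
      exists_continuousOn_localFlow (hF.of_le (by exact_mod_cast le_top)) ha
    refine ⟨δ, hδ, r, hr, α, hα, fun t ht ↦ ?_⟩
    simp only [Nat.cast_zero, contDiffOn_zero]
    exact hc.comp (f := fun x ↦ (t, x)) (by fun_prop)
      fun x hx ↦ ⟨⟨by linarith [ht.1], ht.2⟩, hx⟩
  -- The variational equation is again an autonomous equation, given by `(y, R) ↦ (F y, DF(y) ∘ R)`
  -- on `E × (E →L[ℝ] E)`. Started at `(x, id)`, its second component is the derivative of the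
  -- first, so class `Cⁿ` for the enlarged flow gives class `Cⁿ⁺¹` for the original one. The space
  -- changes in the induction, hence `E` is quantified inside it.
  | succ n ih =>
    intro E _ _ _ F x₀ hF a ha
    have hF' : ContDiffAt ℝ ∞ (fderiv ℝ F) x₀ := hF.fderiv_right (by simp)
    obtain ⟨K₁, s₁, hs₁, hK₁⟩ := (hF.of_le (m := 1) (by exact_mod_cast le_top)).exists_lipschitzOnWith
    obtain ⟨K₂, s₂, hs₂, hK₂⟩ := (hF'.of_le (m := 1) (by exact_mod_cast le_top)).exists_lipschitzOnWith
    have hdiff : ∀ᶠ y in nhds x₀, DifferentiableAt ℝ F y := by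
      filter_upwards [(hF.of_le (m := 1) (by exact_mod_cast le_top)).eventually (by simp)] with y hy
      exact hy.differentiableAt (by simp)
    obtain ⟨b, hb, hbs⟩ := Metric.mem_nhds_iff.1 (Filter.inter_mem (Filter.inter_mem hs₁ hs₂) hdiff)
    have hG : ContDiffAt ℝ ∞ (fun q : E × (E →L[ℝ] E) ↦ (F q.1, fderiv ℝ F q.1 ∘L q.2))
        (x₀, ContinuousLinearMap.id ℝ E) := by
      refine ContDiffAt.prodMk ?_ (ContDiffAt.clm_comp ?_ contDiffAt_snd)
      · exact ContDiffAt.comp (x₀, ContinuousLinearMap.id ℝ E) (g := F) (by exact hF) contDiffAt_fst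
      · exact ContDiffAt.comp (x₀, ContinuousLinearMap.id ℝ E) (g := fderiv ℝ F) (by exact hF')
          contDiffAt_fst
    -- `a` is the ball asked for, `b / 2` leaves the room needed by `hasFDerivAt_localFlow`, and `1`
    -- ensures `‖R‖ ≤ ‖id‖ + 1 ≤ 2`.
    obtain ⟨δ, hδ, r, hr, Ψ, hΨ, hsm⟩ := ih hG (a := min a (min (b / 2) 1)) (by positivity)
    have hin : ∀ x ∈ ball x₀ r, (x, ContinuousLinearMap.id ℝ E) ∈
        ball (x₀, ContinuousLinearMap.id ℝ E) r := by
      intro x hx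
      simpa [mem_ball, Prod.dist_eq] using hx
    have hflow : ∀ x ∈ ball x₀ r, (Ψ 0 (x, ContinuousLinearMap.id ℝ E)).1 = x ∧
        ∀ t ∈ Icc (-δ) δ, (Ψ t (x, ContinuousLinearMap.id ℝ E)).1 ∈
          ball x₀ (min a (min (b / 2) 1)) ∧
          HasDerivAt (fun t ↦ (Ψ t (x, ContinuousLinearMap.id ℝ E)).1)
            (F (Ψ t (x, ContinuousLinearMap.id ℝ E)).1) t := by
      intro x hx
      obtain ⟨h0, ht⟩ := hΨ _ (hin x hx)
      refine ⟨by rw [h0], fun t htt ↦ ⟨?_, ?_⟩⟩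
      · have := (ht t htt).1
        rw [mem_ball, Prod.dist_eq] at this
        exact (le_max_left _ _).trans_lt this
      · exact ((ContinuousLinearMap.fst ℝ E (E →L[ℝ] E)).hasFDerivAt.comp_hasDerivAt t (ht t htt).2)
    refine ⟨δ, hδ, r, hr, fun t x ↦ (Ψ t (x, ContinuousLinearMap.id ℝ E)).1, ?_, ?_⟩
    · intro x hx
      exact ⟨(hflow x hx).1, fun t ht ↦ ⟨ball_subset_ball (min_le_left _ _)
        ((hflow x hx).2 t ht).1, ((hflow x hx).2 t ht).2⟩⟩
    · intro t ht
      have hcd : ContDiffOn ℝ n (fun x ↦ Ψ t (x, ContinuousLinearMap.id ℝ E)) (ball x₀ r) :=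
        (hsm t ht).comp (by fun_prop) fun x hx ↦ hin x hx
      have hder : ∀ x ∈ ball x₀ r, HasFDerivAt (fun x ↦ (Ψ t (x, ContinuousLinearMap.id ℝ E)).1)
          (Ψ t (x, ContinuousLinearMap.id ℝ E)).2 x := by
        intro x hx
        refine hasFDerivAt_localFlow (F := F) (x₀ := x₀) (b := b) (r := r) (K₁ := K₁) (K₂ := K₂)
          (Ψ := fun t x ↦ (Ψ t (x, ContinuousLinearMap.id ℝ E)).1)
          (R := fun t ↦ (Ψ t (x, ContinuousLinearMap.id ℝ E)).2) hδ (fun y hy ↦ (hbs hy).2)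
          (hK₁.mono fun y hy ↦ (hbs hy).1.1) (hK₂.mono fun y hy ↦ (hbs hy).1.2) hx ?_ ?_ ?_ ht
        · intro x hx
          exact ⟨(hflow x hx).1, fun t ht ↦ ⟨ball_subset_ball
            ((min_le_right _ _).trans (min_le_left _ _)) ((hflow x hx).2 t ht).1,
            ((hflow x hx).2 t ht).2⟩⟩
        · simp [(hΨ _ (hin x hx)).1]
        · intro s hs
          obtain ⟨h1, h2⟩ := (hΨ _ (hin x hx)).2 s hs
          refine ⟨?_, (ContinuousLinearMap.snd ℝ E (E →L[ℝ] E)).hasFDerivAt.comp_hasDerivAt s h2⟩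
          rw [mem_ball, Prod.dist_eq] at h1
          have h3 := (le_max_right _ _).trans_lt h1
          rw [dist_eq_norm] at h3
          have h4 := h3.trans_le ((min_le_right _ _).trans (min_le_right _ _))
          have h5 := ContinuousLinearMap.norm_id_le (𝕜 := ℝ) (E := E)
          have h6 := norm_le_norm_sub_add (Ψ s (x, ContinuousLinearMap.id ℝ E)).2
            (ContinuousLinearMap.id ℝ E)
          simp only at h4
          linarith
      push_cast
      rw [contDiffOn_succ_iff_fderiv_of_isOpen isOpen_ball]
      refine ⟨fun x hx ↦ (hder x hx).differentiableAt.differentiableWithinAt, by simp, ?_⟩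
      exact hcd.snd.congr fun x hx ↦ (hder x hx).fderiv

/-- Local flows of a smooth vector field are of class `Cⁿ` in time and initial value. -/
theorem exists_contDiffOn_localFlow (n : ℕ) {E : Type uE} [NormedAddCommGroup E]
    [NormedSpace ℝ E] [CompleteSpace E] {F : E → E} {x₀ : E} (hF : ContDiffAt ℝ ∞ F x₀)
    {a : ℝ} (ha : 0 < a) : ∃ δ > 0, ∃ r > 0, ∃ α : ℝ → E → E,
      ContDiffOn ℝ n (fun q : ℝ × E ↦ α q.1 q.2) (Ioo (-δ) δ ×ˢ ball x₀ r) ∧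
      ∀ x ∈ ball x₀ r, α 0 x = x ∧ ∀ t ∈ Ioo (-δ) δ,
        α t x ∈ ball x₀ a ∧ HasDerivAt (fun t ↦ α t x) (F (α t x)) t := by
  obtain ⟨K, s, hs, hK⟩ := (hF.of_le (m := 1) (by exact_mod_cast le_top)).exists_lipschitzOnWith
  obtain ⟨b, hb, hbs⟩ := Metric.mem_nhds_iff.1 hs
  obtain ⟨δ, hδ, r, hr, α, hc, hα⟩ :=
    exists_continuousOn_localFlow (hF.of_le (by exact_mod_cast le_top)) (lt_min ha hb)
  -- Time becomes part of the initial value: for the field `(y, τ) ↦ (τ F y, 0)` the time `η` map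
  -- sends `(x, t / η)` to `(α t x, t / η)`. Negative `t` is covered although the time maps are
  -- controlled only for nonnegative times.
  have hG : ContDiffAt ℝ ∞ (fun q : E × ℝ ↦ (q.2 • F q.1, (0 : ℝ))) (x₀, 0) := by
    refine ContDiffAt.prodMk (contDiffAt_snd.smul ?_) contDiffAt_const
    exact ContDiffAt.comp (x₀, (0 : ℝ)) (g := F) (by exact hF) contDiffAt_fst
  obtain ⟨η, hη, ρ, hρ, Ψ, hΨ, hsm⟩ := exists_contDiffOn_timeMap n hG hb
  set δ' := min δ (η * ρ) with hδ'
  have hpos : 0 < δ' := by positivity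
  have hin : ∀ t ∈ Ioo (-δ') δ', ∀ x ∈ ball x₀ (min r ρ), (x, t / η) ∈ ball (x₀, (0 : ℝ)) ρ := by
    intro t ht x hx
    rw [mem_ball, Prod.dist_eq]
    refine max_lt (ball_subset_ball (min_le_right _ _) hx) ?_
    simp only [dist_zero_right, Real.norm_eq_abs, abs_div, abs_of_pos hη]
    rw [div_lt_iff₀ hη, mul_comm]
    exact (abs_lt.2 ht).trans_le (min_le_right _ _)
  refine ⟨δ', hpos, min r ρ, by positivity, α, ?_, ?_⟩
  · have h1 : ContDiffOn ℝ n (fun q : ℝ × E ↦ (Ψ η (q.2, q.1 / η)).1)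
        (Ioo (-δ') δ' ×ˢ ball x₀ (min r ρ)) := by
      refine ContDiffOn.fst ((hsm η ⟨hη.le, le_rfl⟩).comp ?_ fun q hq ↦ hin q.1 hq.1 q.2 hq.2)
      exact (contDiff_snd.prodMk (contDiff_fst.div_const η)).contDiffOn
    refine h1.congr fun q hq ↦ ?_
    obtain ⟨t, x⟩ := q
    obtain ⟨ht, hx⟩ := hq
    simp only at ht hx ⊢
    have hIcc : Icc 0 η ⊆ Icc (-η) η := Icc_subset_Icc_left (by linarith)
    have hxr : x ∈ ball x₀ r := ball_subset_ball (min_le_left _ _) hx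
    have htd : |t| ≤ δ := (abs_lt.2 ht).le.trans (min_le_left _ _)
    have hts : ∀ s ∈ Icc 0 η, s * (t / η) ∈ Icc (-δ) δ := by
      intro s hs
      rw [mem_Icc, ← abs_le, abs_mul, abs_div, abs_of_pos hη, abs_of_nonneg hs.1]
      calc s * (|t| / η) ≤ η * (|t| / η) := by gcongr; exact hs.2
        _ = |t| := by field_simp
        _ ≤ δ := htd
    have hP := hΨ _ (hin t ht x hx)
    have h2 : ∀ s ∈ Icc 0 η, (Ψ s (x, t / η)).2 = t / η := by
      intro s hs
      have hder : ∀ s ∈ Icc 0 η, HasDerivAt (fun s ↦ (Ψ s (x, t / η)).2) 0 s := fun s hs ↦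
        (ContinuousLinearMap.snd ℝ E ℝ).hasFDerivAt.comp_hasDerivAt s (hP.2 s (hIcc hs)).2
      have := constant_of_has_deriv_right_zero (f := fun s ↦ (Ψ s (x, t / η)).2) (a := 0) (b := η)
        (fun s hs ↦ (hder s hs).continuousAt.continuousWithinAt)
        (fun s hs ↦ (hder s (Ico_subset_Icc_self hs)).hasDerivWithinAt) s hs
      rw [this, hP.1]
    have hd1 : ∀ s ∈ Icc 0 η, HasDerivAt (fun s ↦ (Ψ s (x, t / η)).1)
        ((t / η) • F (Ψ s (x, t / η)).1) s := by
      intro s hs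
      have := (ContinuousLinearMap.fst ℝ E ℝ).hasFDerivAt.comp_hasDerivAt s (hP.2 s (hIcc hs)).2
      simpa [h2 s hs, Function.comp_def] using this
    have hd2 : ∀ s ∈ Icc 0 η, HasDerivAt (fun s ↦ α (s * (t / η)) x)
        ((t / η) • F (α (s * (t / η)) x)) s := by
      intro s hs
      exact ((hα x hxr).2 _ (hts s hs)).2.scomp s (hasDerivAt_mul_const (t / η))
    have hlip : LipschitzOnWith (‖t / η‖₊ * K) (fun y ↦ (t / η) • F y) (ball x₀ b) :=
      (lipschitzWith_smul (t / η)).comp_lipschitzOnWith (hK.mono hbs)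
    -- `s ↦ α (s t / η) x` and the first component of `Ψ s (x, t / η)` solve the same equation with
    -- the same initial value; compare them at `s = η`.
    have := ODE_solution_unique_of_mem_Icc_right (v := fun _ y ↦ (t / η) • F y)
      (s := fun _ ↦ ball x₀ b) (a := 0) (b := η) (fun _ _ ↦ hlip)
      (fun s hs ↦ (hd2 s hs).continuousAt.continuousWithinAt)
      (fun s hs ↦ (hd2 s (Ico_subset_Icc_self hs)).hasDerivWithinAt)
      (fun s hs ↦ ball_subset_ball (min_le_right _ _)
        ((hα x hxr).2 _ (hts s (Ico_subset_Icc_self hs))).1)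
      (fun s hs ↦ (hd1 s hs).continuousAt.continuousWithinAt)
      (fun s hs ↦ (hd1 s (Ico_subset_Icc_self hs)).hasDerivWithinAt)
      (fun s hs ↦ by
        have := (hP.2 s (hIcc (Ico_subset_Icc_self hs))).1
        rw [mem_ball, Prod.dist_eq] at this
        exact (le_max_left _ _).trans_lt this)
      (by simp [(hα x hxr).1, hP.1]) (right_mem_Icc.2 hη.le)
    simpa [mul_div_cancel₀, hη.ne'] using this
  · intro x hx
    have hxr : x ∈ ball x₀ r := ball_subset_ball (min_le_left _ _) hx
    refine ⟨(hα x hxr).1, fun t ht ↦ ?_⟩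
    have := (hα x hxr).2 t (abs_le.1 ((abs_lt.2 ht).le.trans (min_le_left _ _)))
    exact ⟨ball_subset_ball (min_le_left _ _) this.1, this.2⟩

end SmoothFlow

/-! ### Christoffel symbols and the geodesic equation under a change of coordinates. -/

section CoordinateCalculus

variable {E : Type*} [NormedAddCommGroup E] [NormedSpace ℝ E]
  {E' : Type*} [NormedAddCommGroup E'] [NormedSpace ℝ E']

/-- Christoffel symbols of the first kind of a field `G` of bilinear forms on a vector space. -/
def coordChristoffel (G : E → E →L[ℝ] E →L[ℝ] ℝ) (y v w z : E) : ℝ :=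
  (fderiv ℝ G y v w z + fderiv ℝ G y w v z - fderiv ℝ G y z v w) / 2

/-- The geodesic equation of `G` for the curve `c` at time `t`, tested against `z`. -/
def geodesicDefect (G : E → E →L[ℝ] E →L[ℝ] ℝ) (c : ℝ → E) (t : ℝ) (z : E) : ℝ :=
  G (c t) (deriv (deriv c) t) z + coordChristoffel G (c t) (deriv c t) (deriv c t) z

/-- The pull-back of a field of bilinear forms under a map of vector spaces. -/
def pullCoord (ψ : E' → E) (G : E → E →L[ℝ] E →L[ℝ] ℝ) (y : E') : E' →L[ℝ] E' →L[ℝ] ℝ :=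
  ((ContinuousLinearMap.compL ℝ E' E ℝ).flip (fderiv ℝ ψ y)).comp ((G (ψ y)).comp (fderiv ℝ ψ y))

@[simp]
theorem pullCoord_apply (ψ : E' → E) (G : E → E →L[ℝ] E →L[ℝ] ℝ) (y v w : E') :
    pullCoord ψ G y v w = G (ψ y) (fderiv ℝ ψ y v) (fderiv ℝ ψ y w) := rfl

theorem contDiffAt_pullCoord {ψ : E' → E} {G : E → E →L[ℝ] E →L[ℝ] ℝ} {y : E'} {m n : WithTop ℕ∞}
    (hψ : ContDiffAt ℝ n ψ y) (hmn : m + 1 ≤ n) (hG : ContDiffAt ℝ m G (ψ y)) :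
    ContDiffAt ℝ m (pullCoord ψ G) y := by
  have h1 : ContDiffAt ℝ m (fderiv ℝ ψ) y := hψ.fderiv_right hmn
  have h2 : ContDiffAt ℝ m ψ y := hψ.of_le (le_self_add.trans hmn)
  exact ((ContinuousLinearMap.contDiff _).contDiffAt.comp y h1).clm_comp
    ((hG.comp y h2).clm_comp h1)

theorem fderiv_bilin_apply {G : E → E →L[ℝ] E →L[ℝ] ℝ} {y : E} (hG : DifferentiableAt ℝ G y)
    (a v w : E) : fderiv ℝ G y a v w = fderiv ℝ (fun y ↦ G y v w) y a := by
  have h : HasFDerivAt (fun y ↦ G y v w) _ y :=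
    (hG.hasFDerivAt.clm_apply (hasFDerivAt_const v y)).clm_apply (hasFDerivAt_const w y)
  rw [h.fderiv]
  simp

theorem fderiv_bilin_symm {G : E → E →L[ℝ] E →L[ℝ] ℝ} {y : E} (hG : DifferentiableAt ℝ G y)
    (hs : ∀ᶠ x in nhds y, ∀ v w, G x v w = G x w v) (a v w : E) :
    fderiv ℝ G y a v w = fderiv ℝ G y a w v := by
  rw [fderiv_bilin_apply hG, fderiv_bilin_apply hG]
  have : (fun y ↦ G y v w) =ᶠ[nhds y] fun y ↦ G y w v := by
    filter_upwards [hs] with x hx using hx v w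
  rw [this.fderiv_eq]

-- Leibniz rule. The two terms with second derivatives of `ψ` are what makes Christoffel symbols
-- non-tensorial.
set_option synthInstance.maxHeartbeats 200000 in
theorem fderiv_pullCoord {ψ : E' → E} {G : E → E →L[ℝ] E →L[ℝ] ℝ} {y : E'}
    (hψ : ContDiffAt ℝ 2 ψ y) (hG : ContDiffAt ℝ 1 G (ψ y)) (a v w : E') :
    fderiv ℝ (pullCoord ψ G) y a v w =
      fderiv ℝ G (ψ y) (fderiv ℝ ψ y a) (fderiv ℝ ψ y v) (fderiv ℝ ψ y w)
      + G (ψ y) (fderiv ℝ (fderiv ℝ ψ) y a v) (fderiv ℝ ψ y w)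
      + G (ψ y) (fderiv ℝ ψ y v) (fderiv ℝ (fderiv ℝ ψ) y a w) := by
  have hd := (contDiffAt_pullCoord (m := 1) hψ (by norm_num) hG).differentiableAt (by simp)
  rw [fderiv_bilin_apply hd]
  simp only [pullCoord_apply]
  have h1 : HasFDerivAt (fderiv ℝ ψ) (fderiv ℝ (fderiv ℝ ψ) y) y :=
    ((hψ.fderiv_right (m := 1) (by norm_num)).differentiableAt (by simp)).hasFDerivAt
  have h2 : HasFDerivAt ψ (fderiv ℝ ψ y) y := (hψ.differentiableAt (by simp)).hasFDerivAt
  have h3 := HasFDerivAt.comp y (hG.differentiableAt one_ne_zero).hasFDerivAt h2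
  have h4 : HasFDerivAt (fun y ↦ (G ∘ ψ) y (fderiv ℝ ψ y v) (fderiv ℝ ψ y w)) _ y :=
    (h3.clm_apply (h1.clm_apply (hasFDerivAt_const v y))).clm_apply
      (h1.clm_apply (hasFDerivAt_const w y))
  refine (congrArg (· a) h4.fderiv).trans ?_
  simp
  ring

/-- The three derivatives contribute six terms with second derivatives of `ψ`. By symmetry of that
derivative and of `G`, four cancel and the other two are equal. -/
theorem coordChristoffel_pullCoord {ψ : E' → E} {G : E → E →L[ℝ] E →L[ℝ] ℝ} {y : E'}
    (hψ : ContDiffAt ℝ 2 ψ y) (hG : ContDiffAt ℝ 1 G (ψ y))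
    (hs : ∀ v w, G (ψ y) v w = G (ψ y) w v) (v w z : E') :
    coordChristoffel (pullCoord ψ G) y v w z =
      coordChristoffel G (ψ y) (fderiv ℝ ψ y v) (fderiv ℝ ψ y w) (fderiv ℝ ψ y z)
      + G (ψ y) (fderiv ℝ (fderiv ℝ ψ) y v w) (fderiv ℝ ψ y z) := by
  have hsymm : ∀ a b, fderiv ℝ (fderiv ℝ ψ) y a b = fderiv ℝ (fderiv ℝ ψ) y b a :=
    fun a b ↦ (hψ.isSymmSndFDerivAt (by simp)).eq a b
  unfold coordChristoffel
  simp only [fderiv_pullCoord hψ hG]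
  rw [hsymm w v, hsymm z v, hsymm z w, hs (fderiv ℝ (fderiv ℝ ψ) y v z),
    hs (fderiv ℝ ψ y w)]
  ring

theorem deriv_deriv_comp {ψ : E' → E} {c : ℝ → E'} {t : ℝ} (hψ : ContDiffAt ℝ 2 ψ (c t))
    (hc : ContDiffAt ℝ 2 c t) :
    deriv (ψ ∘ c) t = fderiv ℝ ψ (c t) (deriv c t) ∧
    deriv (deriv (ψ ∘ c)) t =
      fderiv ℝ (fderiv ℝ ψ) (c t) (deriv c t) (deriv c t)
        + fderiv ℝ ψ (c t) (deriv (deriv c) t) := by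
  have e1 : ∀ᶠ s in nhds t, deriv (ψ ∘ c) s = fderiv ℝ ψ (c s) (deriv c s) := by
    have h1 := hc.continuousAt.eventually (hψ.eventually (by simp))
    filter_upwards [h1, hc.eventually (by simp)] with s hs1 hs2
    exact ((hs1.differentiableAt (by simp)).hasFDerivAt.comp_hasDerivAt s
      (hs2.differentiableAt (by simp)).hasDerivAt).deriv
  refine ⟨e1.self_of_nhds, ?_⟩
  rw [Filter.EventuallyEq.deriv_eq e1]
  have h1 : HasFDerivAt (fderiv ℝ ψ) (fderiv ℝ (fderiv ℝ ψ) (c t)) (c t) :=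
    ((hψ.fderiv_right (m := 1) (by norm_num)).differentiableAt (by simp)).hasFDerivAt
  have h2 : HasDerivAt c (deriv c t) t := (hc.differentiableAt (by simp)).hasDerivAt
  have h3 : HasDerivAt (deriv c) (deriv (deriv c) t) t := by
    have : ContDiffAt ℝ 1 (deriv c) t := hc.derivWithin (by norm_num)
    exact (this.differentiableAt (by simp)).hasDerivAt
  exact ((h1.comp_hasDerivAt t h2).clm_apply h3).deriv

/-- The second derivative of `ψ` in the acceleration of `ψ ∘ c` is exactly the term that the
transformation law adds to the Christoffel symbol. -/
theorem geodesicDefect_comp {ψ : E' → E} {G : E → E →L[ℝ] E →L[ℝ] ℝ} {c : ℝ → E'} {t : ℝ}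
    (hψ : ContDiffAt ℝ 2 ψ (c t)) (hc : ContDiffAt ℝ 2 c t) (hG : ContDiffAt ℝ 1 G (ψ (c t)))
    (hs : ∀ v w, G (ψ (c t)) v w = G (ψ (c t)) w v) (z : E') :
    geodesicDefect G (ψ ∘ c) t (fderiv ℝ ψ (c t) z) = geodesicDefect (pullCoord ψ G) c t z := by
  obtain ⟨h1, h2⟩ := deriv_deriv_comp hψ hc
  unfold geodesicDefect
  rw [coordChristoffel_pullCoord hψ hG hs, h1, h2]
  simp only [Function.comp_apply, map_add, add_apply, pullCoord_apply]
  ring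

end CoordinateCalculus

/-! ### Derivatives of maps between manifolds, typed on the model spaces. -/

section ManifoldDerivative

variable {E : Type*} [NormedAddCommGroup E] [NormedSpace ℝ E]
  {H : Type*} [TopologicalSpace H] (I : ModelWithCorners ℝ E H)
  {M : Type*} [TopologicalSpace M] [ChartedSpace H M]
  {E' : Type*} [NormedAddCommGroup E'] [NormedSpace ℝ E']
  {H' : Type*} [TopologicalSpace H'] (I' : ModelWithCorners ℝ E' H')
  {M' : Type*} [TopologicalSpace M'] [ChartedSpace H' M']
  {E'' : Type*} [NormedAddCommGroup E''] [NormedSpace ℝ E'']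
  {H'' : Type*} [TopologicalSpace H''] (I'' : ModelWithCorners ℝ E'' H'')
  {M'' : Type*} [TopologicalSpace M''] [ChartedSpace H'' M'']

/-- The derivative of a map between manifolds, as a map between the model vector spaces. -/
def mder (f : M → M') (x : M) : E →L[ℝ] E' := mfderiv I I' f x

/-- A field of bilinear forms, with values in the bilinear forms on the model vector space. -/
def formAt (g : FormField I M) (x : M) : E →L[ℝ] E →L[ℝ] ℝ := g x

variable {I I' I''}

theorem mder_comp {f : M → M'} {h : M' → M''} {x : M} (hh : MDifferentiableAt I' I'' h (f x))
    (hf : MDifferentiableAt I I' f x) :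
    mder I I'' (fun x ↦ h (f x)) x = (mder I' I'' h (f x)).comp (mder I I' f x) :=
  mfderiv_comp x hh hf

theorem mder_comp_apply {f : M → M'} {h : M' → M''} {x : M}
    (hh : MDifferentiableAt I' I'' h (f x)) (hf : MDifferentiableAt I I' f x) (v : E) :
    mder I I'' (fun x ↦ h (f x)) x v = mder I' I'' h (f x) (mder I I' f x v) := by
  rw [mder_comp hh hf]; rfl

theorem mder_congr {f f' : M → M'} {x : M} (h : f =ᶠ[nhds x] f') :
    mder I I' f x = mder I I' f' x :=
  h.mfderiv_eq

theorem mder_id (x : M) : mder I I (fun x ↦ x) x = ContinuousLinearMap.id ℝ E :=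
  mfderiv_id

theorem mder_eq_fderiv (f : E → E') (x : E) :
    mder 𝓘(ℝ, E) 𝓘(ℝ, E') f x = fderiv ℝ f x :=
  mfderiv_eq_fderiv

theorem mder_const (x : M) (c : M') : mder I I' (fun _ ↦ c) x = 0 :=
  mfderiv_const

theorem mder_prodMk {f : M → M'} {h : M → M''} {x : M} (hf : MDifferentiableAt I I' f x)
    (hh : MDifferentiableAt I I'' h x) :
    mder I (I'.prod I'') (fun x ↦ (f x, h x)) x = (mder I I' f x).prod (mder I I'' h x) :=
  mfderiv_prodMk hf hh

theorem mder_fst (x : M × M') :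
    mder (I.prod I') I Prod.fst x = ContinuousLinearMap.fst ℝ E E' :=
  mfderiv_fst

theorem mder_snd (x : M × M') :
    mder (I.prod I') I' Prod.snd x = ContinuousLinearMap.snd ℝ E E' :=
  mfderiv_snd

theorem mder_extChartAt_self [IsManifold I 1 M] (x : M) :
    mder I 𝓘(ℝ, E) (extChartAt I x) x = ContinuousLinearMap.id ℝ E :=
  mfderiv_extChartAt_self

end ManifoldDerivative

/-! ### Forms and the geodesic equation in preferred charts. -/

section ManifoldCoordinates

variable {E : Type*} [NormedAddCommGroup E] [NormedSpace ℝ E]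
  {M : Type*} [TopologicalSpace M] [ChartedSpace E M]
  {E' : Type*} [NormedAddCommGroup E'] [NormedSpace ℝ E']

/-- The pull-back of a field of bilinear forms under a parametrization. -/
def paramForm (g : FormField 𝓘(ℝ, E) M) (ψ : E' → M) (y : E') : E' →L[ℝ] E' →L[ℝ] ℝ :=
  pullForm 𝓘(ℝ, E') 𝓘(ℝ, E) (mfderiv 𝓘(ℝ, E') 𝓘(ℝ, E) ψ y) (g (ψ y))

theorem paramForm_apply (g : FormField 𝓘(ℝ, E) M) (ψ : E' → M) (y v w : E') :
    paramForm g ψ y v w = formAt 𝓘(ℝ, E) g (ψ y) (mder 𝓘(ℝ, E') 𝓘(ℝ, E) ψ y v)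
      (mder 𝓘(ℝ, E') 𝓘(ℝ, E) ψ y w) := rfl

theorem chartForm_eq_paramForm (g : FormField 𝓘(ℝ, E) M) (x : M) :
    chartForm 𝓘(ℝ, E) g x = paramForm g (extChartAt 𝓘(ℝ, E) x).symm := rfl

/-- The geodesic equation at time `t`. -/
def IsGeodesicAt (g : FormField 𝓘(ℝ, E) M) (γ : ℝ → M) (t : ℝ) : Prop :=
  ∀ z, geodesicDefect (chartForm 𝓘(ℝ, E) g (γ t))
    (fun τ ↦ extChartAt 𝓘(ℝ, E) (γ t) (γ τ)) t z = 0

theorem isGeodesic_iff (g : FormField 𝓘(ℝ, E) M) (γ : ℝ → M) :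
    IsGeodesic 𝓘(ℝ, E) g γ ↔ ContMDiff 𝓘(ℝ, ℝ) 𝓘(ℝ, E) ∞ γ ∧ ∀ t, IsGeodesicAt g γ t :=
  ⟨fun h ↦ ⟨h.1, h.2⟩, fun h ↦ ⟨h.1, h.2⟩⟩

theorem isGeodesicAt_congr {g : FormField 𝓘(ℝ, E) M} {γ γ' : ℝ → M} {t : ℝ}
    (h : γ =ᶠ[nhds t] γ') (hγ : IsGeodesicAt g γ t) : IsGeodesicAt g γ' t := by
  unfold IsGeodesicAt at *
  rw [← h.self_of_nhds]
  have e : (fun τ ↦ extChartAt 𝓘(ℝ, E) (γ t) (γ τ)) =ᶠ[nhds t]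
      fun τ ↦ extChartAt 𝓘(ℝ, E) (γ t) (γ' τ) := by
    filter_upwards [h] with τ hτ; rw [hτ]
  intro z
  have := hγ z
  unfold geodesicDefect at *
  have h0 := h.self_of_nhds
  rw [e.deriv.deriv_eq, e.deriv_eq] at this
  simp only [← h0] at this ⊢
  exact this

variable [IsManifold 𝓘(ℝ, E) ∞ M]

theorem contMDiffAt_extChartAt_symm_of_mem {x : M} {y : E} {n : WithTop ℕ∞} (hn : n ≤ ∞)
    (hy : y ∈ (extChartAt 𝓘(ℝ, E) x).target) :
    ContMDiffAt 𝓘(ℝ, E) 𝓘(ℝ, E) n (extChartAt 𝓘(ℝ, E) x).symm y := by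
  have : IsManifold 𝓘(ℝ, E) n M := .of_le hn
  exact (contMDiffOn_extChartAt_symm x).contMDiffAt
    ((isOpen_extChartAt_target x).mem_nhds hy)

theorem contMDiffAt_extChartAt_of_mem {x x' : M} {n : WithTop ℕ∞} (hn : n ≤ ∞)
    (hy : x' ∈ (extChartAt 𝓘(ℝ, E) x).source) :
    ContMDiffAt 𝓘(ℝ, E) 𝓘(ℝ, E) n (extChartAt 𝓘(ℝ, E) x) x' := by
  have : IsManifold 𝓘(ℝ, E) n M := .of_le hn
  exact contMDiffAt_extChartAt' (by simpa using hy)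

theorem mdifferentiableAt_extChartAt_symm {x : M} {y : E}
    (hy : y ∈ (extChartAt 𝓘(ℝ, E) x).target) :
    MDifferentiableAt 𝓘(ℝ, E) 𝓘(ℝ, E) (extChartAt 𝓘(ℝ, E) x).symm y :=
  (contMDiffAt_extChartAt_symm_of_mem (n := 1) (by exact_mod_cast le_top) hy).mdifferentiableAt
    (by simp)

theorem mdifferentiableAt_extChartAt_of_mem {x x' : M}
    (hx : x' ∈ (extChartAt 𝓘(ℝ, E) x).source) :
    MDifferentiableAt 𝓘(ℝ, E) 𝓘(ℝ, E) (extChartAt 𝓘(ℝ, E) x) x' :=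
  (contMDiffAt_extChartAt_of_mem (n := 1) (by exact_mod_cast le_top) hx).mdifferentiableAt
    (by simp)

theorem mder_extChartAt_mder_symm {x : M} {y : E} (hy : y ∈ (extChartAt 𝓘(ℝ, E) x).target)
    (v : E) : mder 𝓘(ℝ, E) 𝓘(ℝ, E) (extChartAt 𝓘(ℝ, E) x) ((extChartAt 𝓘(ℝ, E) x).symm y)
      (mder 𝓘(ℝ, E) 𝓘(ℝ, E) (extChartAt 𝓘(ℝ, E) x).symm y v) = v := by
  rw [← mder_comp_apply (mdifferentiableAt_extChartAt_of_mem
    ((extChartAt 𝓘(ℝ, E) x).map_target hy)) (mdifferentiableAt_extChartAt_symm hy)]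
  have h4 : (fun y ↦ extChartAt 𝓘(ℝ, E) x ((extChartAt 𝓘(ℝ, E) x).symm y)) =ᶠ[nhds y]
      fun y ↦ y := by
    filter_upwards [(isOpen_extChartAt_target x).mem_nhds hy] with z hz
    exact (extChartAt 𝓘(ℝ, E) x).right_inv hz
  rw [mder_congr h4, mder_id]
  rfl

theorem mder_symm_mder_extChartAt {x x' : M} (hx : x' ∈ (extChartAt 𝓘(ℝ, E) x).source) (v : E) :
    mder 𝓘(ℝ, E) 𝓘(ℝ, E) (extChartAt 𝓘(ℝ, E) x).symm (extChartAt 𝓘(ℝ, E) x x')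
      (mder 𝓘(ℝ, E) 𝓘(ℝ, E) (extChartAt 𝓘(ℝ, E) x) x' v) = v := by
  rw [← mder_comp_apply (mdifferentiableAt_extChartAt_symm
    ((extChartAt 𝓘(ℝ, E) x).map_source hx)) (mdifferentiableAt_extChartAt_of_mem hx)]
  have h4 : (fun x' ↦ (extChartAt 𝓘(ℝ, E) x).symm (extChartAt 𝓘(ℝ, E) x x')) =ᶠ[nhds x']
      fun x' ↦ x' := by
    filter_upwards [(isOpen_extChartAt_source x).mem_nhds hx] with z hz
    exact (extChartAt 𝓘(ℝ, E) x).left_inv hz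
  rw [mder_congr h4, mder_id]
  rfl

theorem mder_extChartAt_symm_self (x : M) :
    mder 𝓘(ℝ, E) 𝓘(ℝ, E) (extChartAt 𝓘(ℝ, E) x).symm (extChartAt 𝓘(ℝ, E) x x) =
      ContinuousLinearMap.id ℝ E := by
  ext v
  have : IsManifold 𝓘(ℝ, E) 1 M := .of_le (n := ∞) (by exact_mod_cast le_top)
  have := mder_symm_mder_extChartAt (mem_extChartAt_source (I := 𝓘(ℝ, E)) x) v
  rwa [mder_extChartAt_self] at this

/-- The tangent space at `x` is identified with `E` through the preferred chart at `x`, so at its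
centre the chart has derivative `id`. -/
theorem chartForm_self (g : FormField 𝓘(ℝ, E) M) (x : M) (v w : E) :
    chartForm 𝓘(ℝ, E) g x (extChartAt 𝓘(ℝ, E) x x) v w = formAt 𝓘(ℝ, E) g x v w := by
  rw [chartForm_eq_paramForm, paramForm_apply, mder_extChartAt_symm_self, extChartAt_to_inv]
  rfl

/-- In the chart at `x`, smoothness of a field of bilinear forms near `x` is smoothness of its
coordinate expression. -/
theorem contMDiffAt_formField_iff (g : FormField 𝓘(ℝ, E) M) (x : M) :
    ContMDiffAt 𝓘(ℝ, E) (𝓘(ℝ, E).prod 𝓘(ℝ, E →L[ℝ] E →L[ℝ] ℝ)) ∞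
      (fun x ↦ TotalSpace.mk' (E →L[ℝ] E →L[ℝ] ℝ)
        (E := fun x : M ↦ TangentSpace 𝓘(ℝ, E) x →L[ℝ] TangentSpace 𝓘(ℝ, E) x →L[ℝ] ℝ) x (g x)) x ↔
    ContDiffAt ℝ ∞ (chartForm 𝓘(ℝ, E) g x) (extChartAt 𝓘(ℝ, E) x x) := by
  rw [contMDiffAt_hom_bundle]
  refine (and_iff_right contMDiffAt_id).trans ?_
  have hsrc := (isOpen_extChartAt_source (I := 𝓘(ℝ, E)) x).mem_nhds (mem_extChartAt_source x)
  -- The inverse of the tangent trivialization at `x` is the derivative of the inverse chart, so the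
  -- bundle coordinates of `g` are its pull-back under that inverse chart.
  have e1 : (fun x' : M ↦ ContinuousLinearMap.inCoordinates E (TangentSpace 𝓘(ℝ, E))
      (E →L[ℝ] ℝ) (fun x : M ↦ TangentSpace 𝓘(ℝ, E) x →L[ℝ] ℝ) x x' x x' (g x'))
      =ᶠ[nhds x] fun x' ↦ chartForm 𝓘(ℝ, E) g x (extChartAt 𝓘(ℝ, E) x x') := by
    filter_upwards [hsrc] with x' hx'
    have hx'' : x' ∈ (chartAt E x).source := by simpa using hx'
    ext v w
    have : x' ∈ (trivializationAt E (TangentSpace 𝓘(ℝ, E)) x).baseSet := by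
      simpa [TangentBundle.trivializationAt_baseSet] using hx''
    rw [inCoordinates_apply_eq₂ this this (by simp)]
    have h1 : ∀ v, (trivializationAt E (TangentSpace 𝓘(ℝ, E)) x).symm x' v =
        mder 𝓘(ℝ, E) 𝓘(ℝ, E) (extChartAt 𝓘(ℝ, E) x).symm (extChartAt 𝓘(ℝ, E) x x') v := by
      intro v
      have h2 := TangentBundle.symmL_trivializationAt (I := 𝓘(ℝ, E)) hx''
      simp only [modelWithCornersSelf_coe, range_id, mfderivWithin_univ] at h2
      exact (Trivialization.symmL_apply (hb := this) ..).symm.trans (congrArg (fun L ↦ L v) h2)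
    have h3 : chartForm 𝓘(ℝ, E) g x (extChartAt 𝓘(ℝ, E) x x') v w =
        formAt 𝓘(ℝ, E) g x' (mder 𝓘(ℝ, E) 𝓘(ℝ, E) (extChartAt 𝓘(ℝ, E) x).symm
          (extChartAt 𝓘(ℝ, E) x x') v) (mder 𝓘(ℝ, E) 𝓘(ℝ, E) (extChartAt 𝓘(ℝ, E) x).symm
          (extChartAt 𝓘(ℝ, E) x x') w) := by
      rw [chartForm_eq_paramForm, paramForm_apply, (extChartAt 𝓘(ℝ, E) x).left_inv hx']
    rw [h3, ← h1, ← h1]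
    simp [formAt]
    rfl
  rw [Filter.EventuallyEq.contMDiffAt_iff e1]
  constructor
  · intro h
    rw [← contMDiffAt_iff_contDiffAt]
    have h2 := contMDiffAt_extChartAt_symm_of_mem (n := ∞) le_rfl
      (mem_extChartAt_target (I := 𝓘(ℝ, E)) x)
    have h3 := ContMDiffAt.comp (extChartAt 𝓘(ℝ, E) x x)
      (g := fun x' ↦ chartForm 𝓘(ℝ, E) g x (extChartAt 𝓘(ℝ, E) x x')) (by simpa using h) h2
    refine h3.congr_of_eventuallyEq ?_
    filter_upwards [(isOpen_extChartAt_target x).mem_nhds (mem_extChartAt_target x)] with z hz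
    simp only [Function.comp_apply]
    rw [(extChartAt 𝓘(ℝ, E) x).right_inv hz]
  · intro h
    exact ContMDiffAt.comp x h.contMDiffAt
      (contMDiffAt_extChartAt_of_mem le_rfl (mem_extChartAt_source x))

end ManifoldCoordinates

/-! ### Metrics and geodesics in arbitrary parametrizations. -/

section Parametrizations

variable {E : Type*} [NormedAddCommGroup E] [NormedSpace ℝ E]
  {M : Type*} [TopologicalSpace M] [ChartedSpace E M] [IsManifold 𝓘(ℝ, E) ∞ M]
  {E' : Type*} [NormedAddCommGroup E'] [NormedSpace ℝ E']

theorem contDiffAt_extChartAt_comp {ψ : E' → M} {y : E'} {x : M} {n : WithTop ℕ∞} (hn : n ≤ ∞)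
    (hψ : ContMDiffAt 𝓘(ℝ, E') 𝓘(ℝ, E) n ψ y) (hx : ψ y ∈ (extChartAt 𝓘(ℝ, E) x).source) :
    ContDiffAt ℝ n (fun y ↦ extChartAt 𝓘(ℝ, E) x (ψ y)) y := by
  rw [← contMDiffAt_iff_contDiffAt]
  exact (contMDiffAt_extChartAt_of_mem hn hx).comp y hψ

omit [IsManifold 𝓘(ℝ, E) ∞ M] in
theorem eventually_mem_extChartAt_source {X : Type*} [TopologicalSpace X] {ψ : X → M} {y : X}
    {x : M} (hψ : ContinuousAt ψ y) (hx : ψ y ∈ (extChartAt 𝓘(ℝ, E) x).source) :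
    ∀ᶠ z in nhds y, ψ z ∈ (extChartAt 𝓘(ℝ, E) x).source :=
  hψ.eventually_mem ((isOpen_extChartAt_source x).mem_nhds hx)

theorem eventually_mdifferentiableAt {ψ : E' → M} {y : E'} {n : WithTop ℕ∞} (hn : 1 ≤ n)
    (hψ : ContMDiffAt 𝓘(ℝ, E') 𝓘(ℝ, E) n ψ y) :
    ∀ᶠ z in nhds y, MDifferentiableAt 𝓘(ℝ, E') 𝓘(ℝ, E) ψ z := by
  have : IsManifold 𝓘(ℝ, E) 1 M := .of_le (n := ∞) (by exact_mod_cast le_top)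
  filter_upwards [contMDiffAt_iff_contMDiffAt_nhds (by simp) |>.1 (hψ.of_le hn)] with z hz
  exact hz.mdifferentiableAt (by simp)

/-- The derivative of a parametrization, in terms of its expression in a chart. -/
theorem mder_param {ψ : E' → M} {y : E'} {x : M}
    (hψ : MDifferentiableAt 𝓘(ℝ, E') 𝓘(ℝ, E) ψ y) (hx : ψ y ∈ (extChartAt 𝓘(ℝ, E) x).source)
    (v : E') : mder 𝓘(ℝ, E) 𝓘(ℝ, E) (extChartAt 𝓘(ℝ, E) x).symm (extChartAt 𝓘(ℝ, E) x (ψ y))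
      (fderiv ℝ (fun y ↦ extChartAt 𝓘(ℝ, E) x (ψ y)) y v) = mder 𝓘(ℝ, E') 𝓘(ℝ, E) ψ y v := by
  rw [← mder_eq_fderiv, mder_comp_apply (mdifferentiableAt_extChartAt_of_mem hx) hψ,
    mder_symm_mder_extChartAt hx]

theorem fderiv_extChartAt_comp {ψ : E' → M} {y : E'} {x : M}
    (hψ : MDifferentiableAt 𝓘(ℝ, E') 𝓘(ℝ, E) ψ y) (hx : ψ y ∈ (extChartAt 𝓘(ℝ, E) x).source)
    (v : E') : fderiv ℝ (fun y ↦ extChartAt 𝓘(ℝ, E) x (ψ y)) y v =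
      mder 𝓘(ℝ, E) 𝓘(ℝ, E) (extChartAt 𝓘(ℝ, E) x) (ψ y) (mder 𝓘(ℝ, E') 𝓘(ℝ, E) ψ y v) := by
  rw [← mder_eq_fderiv, mder_comp_apply (mdifferentiableAt_extChartAt_of_mem hx) hψ]

theorem fderiv_extChartAt_comp_self {ψ : E' → M} {y : E'}
    (hψ : MDifferentiableAt 𝓘(ℝ, E') 𝓘(ℝ, E) ψ y)
    (v : E') : fderiv ℝ (fun z ↦ extChartAt 𝓘(ℝ, E) (ψ y) (ψ z)) y v =
      mder 𝓘(ℝ, E') 𝓘(ℝ, E) ψ y v := by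
  have : IsManifold 𝓘(ℝ, E) 1 M := .of_le (n := ∞) (by exact_mod_cast le_top)
  rw [fderiv_extChartAt_comp hψ (mem_extChartAt_source _), mder_extChartAt_self]
  rfl

/-- Read in a chart, a parametrization is a map of vector spaces; this opens the way to the calculus
of `pullCoord`. -/
theorem paramForm_eventuallyEq (g : FormField 𝓘(ℝ, E) M) {ψ : E' → M} {y : E'} {x : M}
    {n : WithTop ℕ∞} (hn : 1 ≤ n) (hψ : ContMDiffAt 𝓘(ℝ, E') 𝓘(ℝ, E) n ψ y)
    (hx : ψ y ∈ (extChartAt 𝓘(ℝ, E) x).source) :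
    paramForm g ψ =ᶠ[nhds y]
      pullCoord (fun y ↦ extChartAt 𝓘(ℝ, E) x (ψ y)) (chartForm 𝓘(ℝ, E) g x) := by
  filter_upwards [eventually_mdifferentiableAt hn hψ,
    eventually_mem_extChartAt_source hψ.continuousAt hx] with z hz1 hz2
  ext v w
  rw [pullCoord_apply, chartForm_eq_paramForm, paramForm_apply, paramForm_apply,
    mder_param hz1 hz2, mder_param hz1 hz2, (extChartAt 𝓘(ℝ, E) x).left_inv hz2]

theorem IsSemiRiemannian.contDiffAt_chartForm {g : FormField 𝓘(ℝ, E) M}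
    (hg : IsSemiRiemannian 𝓘(ℝ, E) g) (x : M) :
    ContDiffAt ℝ ∞ (chartForm 𝓘(ℝ, E) g x) (extChartAt 𝓘(ℝ, E) x x) :=
  (contMDiffAt_formField_iff g x).1 hg.contMDiff.contMDiffAt

theorem IsSemiRiemannian.paramForm_symm {g : FormField 𝓘(ℝ, E) M}
    (hg : IsSemiRiemannian 𝓘(ℝ, E) g) (ψ : E' → M) (y v w : E') :
    paramForm g ψ y v w = paramForm g ψ y w v :=
  hg.symm _ _ _

theorem IsSemiRiemannian.contDiffAt_paramForm {g : FormField 𝓘(ℝ, E) M}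
    (hg : IsSemiRiemannian 𝓘(ℝ, E) g) {ψ : E' → M} {y : E'}
    {m n : WithTop ℕ∞} (hmn : m + 1 ≤ n) (hn : n ≤ ∞) (hψ : ContMDiffAt 𝓘(ℝ, E') 𝓘(ℝ, E) n ψ y) :
    ContDiffAt ℝ m (paramForm g ψ) y := by
  have hsrc := mem_extChartAt_source (I := 𝓘(ℝ, E)) (ψ y)
  refine ContDiffAt.congr_of_eventuallyEq ?_
    (paramForm_eventuallyEq g ((le_add_self).trans hmn) hψ hsrc)
  exact contDiffAt_pullCoord (contDiffAt_extChartAt_comp hn hψ hsrc) hmn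
    ((hg.contDiffAt_chartForm _).of_le ((le_self_add.trans hmn).trans hn))

theorem geodesicDefect_congr {G G' : E → E →L[ℝ] E →L[ℝ] ℝ} {c c' : ℝ → E} {t : ℝ}
    (hG : G =ᶠ[nhds (c t)] G') (hc : c =ᶠ[nhds t] c') (z : E) :
    geodesicDefect G c t z = geodesicDefect G' c' t z := by
  unfold geodesicDefect coordChristoffel
  rw [hc.deriv.deriv_eq, hc.deriv_eq, ← hc.self_of_nhds, hG.fderiv_eq, hG.self_of_nhds]

/-- The geodesic equation can be checked in any parametrization. -/
theorem isGeodesicAt_iff_of_param {g : FormField 𝓘(ℝ, E) M} (hg : IsSemiRiemannian 𝓘(ℝ, E) g)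
    {ψ : E' → M} {c : ℝ → E'} {t : ℝ} {γ : ℝ → M}
    (hψ : ContMDiffAt 𝓘(ℝ, E') 𝓘(ℝ, E) 2 ψ (c t))
    (hsurj : Function.Surjective (mder 𝓘(ℝ, E') 𝓘(ℝ, E) ψ (c t)))
    (hc : ContDiffAt ℝ 2 c t) (hγ : γ =ᶠ[nhds t] fun s ↦ ψ (c s)) :
    IsGeodesicAt g γ t ↔ ∀ z, geodesicDefect (paramForm g ψ) c t z = 0 := by
  have hle : (2 : WithTop ℕ∞) ≤ ∞ := WithTop.coe_le_coe.2 le_top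
  have hsrc : ψ (c t) ∈ (extChartAt 𝓘(ℝ, E) (γ t)).source := by
    rw [hγ.self_of_nhds]; exact mem_extChartAt_source _
  have hψ1 : MDifferentiableAt 𝓘(ℝ, E') 𝓘(ℝ, E) ψ (c t) := hψ.mdifferentiableAt (by simp)
  have e1 : (fun τ ↦ extChartAt 𝓘(ℝ, E) (γ t) (γ τ)) =ᶠ[nhds t]
      (fun y ↦ extChartAt 𝓘(ℝ, E) (γ t) (ψ y)) ∘ c := by
    filter_upwards [hγ] with s hs
    simp [hs]
  -- Both equations are compared in the chart at `γ t`. They are tested against `z` and against its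
  -- image under the derivative of `ψ`, whence the surjectivity hypothesis.
  have key : ∀ z, geodesicDefect (paramForm g ψ) c t z =
      geodesicDefect (chartForm 𝓘(ℝ, E) g (γ t)) (fun τ ↦ extChartAt 𝓘(ℝ, E) (γ t) (γ τ)) t
        (mder 𝓘(ℝ, E') 𝓘(ℝ, E) ψ (c t) z) := by
    intro z
    rw [geodesicDefect_congr (G' := chartForm 𝓘(ℝ, E) g (γ t)) Filter.EventuallyEq.rfl e1,
      geodesicDefect_congr (paramForm_eventuallyEq g (by norm_num) hψ hsrc)
        (Filter.EventuallyEq.refl _ c), ← geodesicDefect_comp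
        (contDiffAt_extChartAt_comp hle hψ hsrc) hc _ _ z]
    · congr 1
      rw [hγ.self_of_nhds]
      exact fderiv_extChartAt_comp_self hψ1 z
    · rw [show ψ (c t) = γ t from hγ.self_of_nhds.symm]
      exact (hg.contDiffAt_chartForm (γ t)).of_le (by exact_mod_cast le_top)
    · exact fun v w ↦ hg.symm _ _ _
  constructor
  · intro h z
    rw [key]; exact h _
  · intro h z
    obtain ⟨z, rfl⟩ := hsurj z
    rw [← key]; exact h z

end Parametrizations

/-! ### Uniqueness of geodesics. -/

section GeodesicUniqueness

variable {E : Type*} [NormedAddCommGroup E] [NormedSpace ℝ E]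

/-- The linear form `z ↦ Γ(v, v, z)`, written with the derivatives of `(y, v) ↦ G y v` and
`(y, v) ↦ G y v v`. -/
def christoffelForm (G : E → E →L[ℝ] E →L[ℝ] ℝ) (q : E × E) : E →L[ℝ] ℝ :=
  fderiv ℝ (fun p : E × E ↦ G p.1 p.2) q (q.2, 0)
    - (1 / 2 : ℝ) • (fderiv ℝ (fun p : E × E ↦ G p.1 p.2 p.2) q).comp
      (ContinuousLinearMap.inl ℝ E E)

-- On equal arguments the first two terms of the Christoffel symbol coincide: `Γ(v, v, z) = ∂_v G(v,
-- z) - ½ ∂_z G(v, v)`. Expressing this by total derivatives in `(y, v)` makes its smoothness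
-- visible.
set_option synthInstance.maxHeartbeats 200000 in
theorem christoffelForm_apply {G : E → E →L[ℝ] E →L[ℝ] ℝ} {q : E × E}
    (hG' : ContDiffAt ℝ 1 G q.1) (z : E) :
    christoffelForm G q z = coordChristoffel G q.1 q.2 q.2 z := by
  have hG := hG'.differentiableAt (by simp)
  have h0 : ContDiffAt ℝ 1 (fun p : E × E ↦ G p.1) q := hG'.fst'
  have h1' : ContDiffAt ℝ 1 (fun p : E × E ↦ G p.1 p.2) q := h0.clm_apply contDiffAt_snd
  have h2' : ContDiffAt ℝ 1 (fun p : E × E ↦ G p.1 p.2 p.2) q := h1'.clm_apply contDiffAt_snd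
  have h1 := h1'.differentiableAt (by simp)
  have h2 := h2'.differentiableAt (by simp)
  have hi : HasFDerivAt (fun y : E ↦ (y, q.2)) (ContinuousLinearMap.inl ℝ E E) q.1 :=
    hasFDerivAt_prodMk_left q.1 q.2
  have e1 : fderiv ℝ (fun p : E × E ↦ G p.1 p.2) q (q.2, 0) = fderiv ℝ G q.1 q.2 q.2 := by
    have h3 := (HasFDerivAt.comp (x := q.1) (g := fun p : E × E ↦ G p.1 p.2) (f := fun y ↦ (y, q.2))
      h1.hasFDerivAt hi).fderiv
    have h4 : HasFDerivAt (fun y ↦ G y q.2) _ q.1 :=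
      hG.hasFDerivAt.clm_apply (hasFDerivAt_const q.2 q.1)
    have h5 := congrArg (fun L ↦ L q.2) (h3.symm.trans h4.fderiv)
    simpa using h5
  have e2 : fderiv ℝ (fun p : E × E ↦ G p.1 p.2 p.2) q (z, 0) = fderiv ℝ G q.1 z q.2 q.2 := by
    have h3 := (HasFDerivAt.comp (x := q.1) (g := fun p : E × E ↦ G p.1 p.2 p.2)
      (f := fun y ↦ (y, q.2)) h2.hasFDerivAt hi).fderiv
    have h5 := congrArg (fun L ↦ L z) h3
    rw [fderiv_bilin_apply hG]
    simp only [Function.comp_def] at h5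
    simpa using h5.symm
  simp only [christoffelForm, coordChristoffel, sub_apply, smul_apply,
    ContinuousLinearMap.comp_apply, ContinuousLinearMap.inl_apply, smul_eq_mul, e1, e2]
  ring

theorem exists_equiv_of_nondegenerate [FiniteDimensional ℝ E] (B : E →L[ℝ] E →L[ℝ] ℝ)
    (hB : ∀ v, (∀ w, B v w = 0) → v = 0) :
    ∃ e : E ≃L[ℝ] (E →L[ℝ] ℝ), (e : E →L[ℝ] E →L[ℝ] ℝ) = B := by
  have hinj : Function.Injective (B : E →ₗ[ℝ] E →L[ℝ] ℝ) := by
    rw [← LinearMap.ker_eq_bot, LinearMap.ker_eq_bot']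
    intro v hv
    exact hB v fun w ↦ by
      have := congrArg (fun L : E →L[ℝ] ℝ ↦ L w) hv
      simpa using this
  have hfin : Module.finrank ℝ E = Module.finrank ℝ (E →L[ℝ] ℝ) := by
    rw [← (LinearMap.toContinuousLinearMap : (E →ₗ[ℝ] ℝ) ≃ₗ[ℝ] (E →L[ℝ] ℝ)).finrank_eq]
    exact (Subspace.dual_finrank_eq (K := ℝ) (V := E)).symm
  let e := (LinearEquiv.ofInjectiveOfFinrankEq (B : E →ₗ[ℝ] E →L[ℝ] ℝ) hinj
    hfin).toContinuousLinearEquiv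
  exact ⟨e, by ext v w; rfl⟩

/-- The geodesic equation as a first order system. -/
def geodesicField (G : E → E →L[ℝ] E →L[ℝ] ℝ) (q : E × E) : E × E :=
  (q.2, -(G q.1).inverse (christoffelForm G q))

theorem contDiffAt_christoffelForm {G : E → E →L[ℝ] E →L[ℝ] ℝ} {q : E × E}
    (hG : ContDiffAt ℝ 2 G q.1) : ContDiffAt ℝ 1 (christoffelForm G) q := by
  have h0 : ContDiffAt ℝ 2 (fun p : E × E ↦ G p.1) q := hG.fst'
  have h1 : ContDiffAt ℝ 2 (fun p : E × E ↦ G p.1 p.2) q := h0.clm_apply contDiffAt_snd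
  have h2 : ContDiffAt ℝ 2 (fun p : E × E ↦ G p.1 p.2 p.2) q := h1.clm_apply contDiffAt_snd
  have h3 := (h1.fderiv_right (m := 1) (by norm_num)).clm_apply
    (contDiffAt_snd.prodMk (contDiffAt_const (c := (0 : E))))
  have h4 := (h2.fderiv_right (m := 1) (by norm_num)).clm_comp
    (contDiffAt_const (c := ContinuousLinearMap.inl ℝ E E))
  exact h3.sub (h4.const_smul (1 / 2 : ℝ))

/-- Inversion is smooth at the isomorphism `G q.1`, and one derivative of `G` is spent on the
Christoffel symbol. -/
theorem contDiffAt_geodesicField [FiniteDimensional ℝ E] {G : E → E →L[ℝ] E →L[ℝ] ℝ} {q : E × E}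
    (hG : ContDiffAt ℝ 2 G q.1) (hnd : ∀ v, (∀ w, G q.1 v w = 0) → v = 0) :
    ContDiffAt ℝ 1 (geodesicField G) q := by
  obtain ⟨e, he⟩ := exists_equiv_of_nondegenerate _ hnd
  have h2 : ContDiffAt ℝ 1 (fun y ↦ (G y).inverse) q.1 := by
    refine ContDiffAt.comp q.1 (g := ContinuousLinearMap.inverse) ?_ (hG.of_le (by norm_num))
    rw [← he]
    exact contDiffAt_map_inverse e
  exact contDiffAt_snd.prodMk (h2.fst'.clm_apply (contDiffAt_christoffelForm hG)).neg

/-- Nondegeneracy lets the tested geodesic equation be solved for the second derivative. -/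
theorem hasDerivAt_geodesicField [FiniteDimensional ℝ E] {G : E → E →L[ℝ] E →L[ℝ] ℝ} {c : ℝ → E}
    {t : ℝ} (hG : ContDiffAt ℝ 1 G (c t)) (hc : ContDiffAt ℝ 2 c t)
    (hnd : ∀ v, (∀ w, G (c t) v w = 0) → v = 0)
    (hgeo : ∀ z, geodesicDefect G c t z = 0) :
    HasDerivAt (fun t ↦ (c t, deriv c t)) (geodesicField G (c t, deriv c t)) t := by
  obtain ⟨e, he⟩ := exists_equiv_of_nondegenerate _ hnd
  refine (hc.differentiableAt (by simp)).hasDerivAt.prodMk ?_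
  have h1 := ((hc.derivWithin (m := 1) (by norm_num)).differentiableAt (by simp)).hasDerivAt
  have h2 : G (c t) (deriv (deriv c) t) = -christoffelForm G (c t, deriv c t) := by
    refine ContinuousLinearMap.ext fun z ↦ ?_
    have := hgeo z
    unfold geodesicDefect at this
    have h3 := christoffelForm_apply (q := (c t, deriv c t)) hG z
    change _ = -(christoffelForm G (c t, deriv c t) z)
    rw [h3]
    linarith
  have h3 : deriv (deriv c) t = -(G (c t)).inverse (christoffelForm G (c t, deriv c t)) := by
    have h4 : (e : E →L[ℝ] E →L[ℝ] ℝ).inverse (e (deriv (deriv c) t)) = deriv (deriv c) t := by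
      rw [ContinuousLinearMap.inverse_equiv]
      exact e.symm_apply_apply _
    have h5 : e (deriv (deriv c) t) = -christoffelForm G (c t, deriv c t) := by
      rw [← h2, ← he]; rfl
    rw [← he, ← h4, h5, (e : E →L[ℝ] E →L[ℝ] ℝ).inverse.map_neg]
  rwa [h3] at h1

variable {M : Type*} [TopologicalSpace M] [ChartedSpace E M] [IsManifold 𝓘(ℝ, E) ∞ M]

theorem IsSemiRiemannian.chartForm_nondegenerate {g : FormField 𝓘(ℝ, E) M}
    (hg : IsSemiRiemannian 𝓘(ℝ, E) g) {x : M} {y : E} (hy : y ∈ (extChartAt 𝓘(ℝ, E) x).target)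
    (v : E) (hv : ∀ w, chartForm 𝓘(ℝ, E) g x y v w = 0) : v = 0 := by
  have h : mder 𝓘(ℝ, E) 𝓘(ℝ, E) (extChartAt 𝓘(ℝ, E) x).symm y v = 0 := by
    refine hg.nondegenerate ((extChartAt 𝓘(ℝ, E) x).symm y) _ fun w ↦ ?_
    have h1 := hv (mder 𝓘(ℝ, E) 𝓘(ℝ, E) (extChartAt 𝓘(ℝ, E) x) ((extChartAt 𝓘(ℝ, E) x).symm y) w)
    rw [chartForm_eq_paramForm, paramForm_apply] at h1
    have h2 := mder_symm_mder_extChartAt ((extChartAt 𝓘(ℝ, E) x).map_target hy) w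
    rw [(extChartAt 𝓘(ℝ, E) x).right_inv hy] at h2
    rw [h2] at h1
    exact h1
  have h3 := mder_extChartAt_mder_symm hy v
  rw [h, map_zero] at h3
  exact h3.symm

/-- The velocity of a curve. -/
def velocity (γ : ℝ → M) (t : ℝ) : E := mder 𝓘(ℝ, ℝ) 𝓘(ℝ, E) γ t 1

theorem deriv_extChartAt_comp {γ : ℝ → M} {t : ℝ} {x : M}
    (hγ : MDifferentiableAt 𝓘(ℝ, ℝ) 𝓘(ℝ, E) γ t) (hx : γ t ∈ (extChartAt 𝓘(ℝ, E) x).source) :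
    deriv (fun s ↦ extChartAt 𝓘(ℝ, E) x (γ s)) t =
      mder 𝓘(ℝ, E) 𝓘(ℝ, E) (extChartAt 𝓘(ℝ, E) x) (γ t) (velocity γ t) := by
  rw [← fderiv_apply_one_eq_deriv, fderiv_extChartAt_comp hγ hx]
  rfl

theorem deriv_extChartAt_comp_self {γ : ℝ → M} {t : ℝ}
    (hγ : MDifferentiableAt 𝓘(ℝ, ℝ) 𝓘(ℝ, E) γ t) :
    deriv (fun s ↦ extChartAt 𝓘(ℝ, E) (γ t) (γ s)) t = velocity γ t := by
  rw [← fderiv_apply_one_eq_deriv, fderiv_extChartAt_comp_self hγ]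
  rfl

/-- In a fixed chart, a geodesic satisfies the geodesic equation. -/
theorem IsGeodesicAt.geodesicDefect_eq_zero {g : FormField 𝓘(ℝ, E) M}
    (hg : IsSemiRiemannian 𝓘(ℝ, E) g) {γ : ℝ → M} {t : ℝ} {x : M}
    (hγ : ContMDiffAt 𝓘(ℝ, ℝ) 𝓘(ℝ, E) 2 γ t) (hgeo : IsGeodesicAt g γ t)
    (hx : γ t ∈ (extChartAt 𝓘(ℝ, E) x).source) (z : E) :
    geodesicDefect (chartForm 𝓘(ℝ, E) g x) (fun s ↦ extChartAt 𝓘(ℝ, E) x (γ s)) t z = 0 := by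
  have hle : (2 : WithTop ℕ∞) ≤ ∞ := WithTop.coe_le_coe.2 le_top
  have ht := (extChartAt 𝓘(ℝ, E) x).map_source hx
  refine (isGeodesicAt_iff_of_param hg (ψ := (extChartAt 𝓘(ℝ, E) x).symm)
    (c := fun s ↦ extChartAt 𝓘(ℝ, E) x (γ s)) (γ := γ)
    (contMDiffAt_extChartAt_symm_of_mem hle ht) ?_
    (contDiffAt_extChartAt_comp hle hγ hx) ?_).1 hgeo z
  · intro v
    exact ⟨_, mder_symm_mder_extChartAt hx v⟩
  · filter_upwards [eventually_mem_extChartAt_source hγ.continuousAt hx] with s hs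
    exact ((extChartAt 𝓘(ℝ, E) x).left_inv hs).symm

variable [FiniteDimensional ℝ E]

theorem IsGeodesicAt.eventually_hasDerivAt {g : FormField 𝓘(ℝ, E) M}
    (hg : IsSemiRiemannian 𝓘(ℝ, E) g) {γ : ℝ → M} {t : ℝ} {x : M}
    (hx : γ t ∈ (extChartAt 𝓘(ℝ, E) x).source)
    (hγ : ∀ᶠ s in nhds t, ContMDiffAt 𝓘(ℝ, ℝ) 𝓘(ℝ, E) 2 γ s ∧ IsGeodesicAt g γ s) :
    ∀ᶠ r in nhds t, HasDerivAt
      (fun r ↦ (extChartAt 𝓘(ℝ, E) x (γ r), deriv (fun s ↦ extChartAt 𝓘(ℝ, E) x (γ s)) r))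
      (geodesicField (chartForm 𝓘(ℝ, E) g x)
        (extChartAt 𝓘(ℝ, E) x (γ r), deriv (fun s ↦ extChartAt 𝓘(ℝ, E) x (γ s)) r)) r := by
  have hle : (2 : WithTop ℕ∞) ≤ ∞ := WithTop.coe_le_coe.2 le_top
  filter_upwards [hγ, eventually_mem_extChartAt_source hγ.self_of_nhds.1.continuousAt hx]
    with r hr hr'
  exact hasDerivAt_geodesicField (c := fun s ↦ extChartAt 𝓘(ℝ, E) x (γ s))
    (hg.contDiffAt_paramForm (m := 1) (by norm_num) hle (contMDiffAt_extChartAt_symm_of_mem hle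
      ((extChartAt 𝓘(ℝ, E) x).map_source hr')))
    (contDiffAt_extChartAt_comp hle hr.1 hr')
    (hg.chartForm_nondegenerate ((extChartAt 𝓘(ℝ, E) x).map_source hr'))
    (hr.2.geodesicDefect_eq_zero hg hr.1 hr')

/-- Local uniqueness of geodesics. -/
theorem geodesic_eventuallyEq {g : FormField 𝓘(ℝ, E) M} (hg : IsSemiRiemannian 𝓘(ℝ, E) g)
    {γ γ' : ℝ → M} {t : ℝ}
    (hγ : ∀ᶠ s in nhds t, ContMDiffAt 𝓘(ℝ, ℝ) 𝓘(ℝ, E) 2 γ s ∧ IsGeodesicAt g γ s)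
    (hγ' : ∀ᶠ s in nhds t, ContMDiffAt 𝓘(ℝ, ℝ) 𝓘(ℝ, E) 2 γ' s ∧ IsGeodesicAt g γ' s)
    (h0 : γ t = γ' t) (h1 : velocity γ t = (velocity γ' t : E)) : γ =ᶠ[nhds t] γ' := by
  have hle : (2 : WithTop ℕ∞) ≤ ∞ := WithTop.coe_le_coe.2 le_top
  have hs1 : γ t ∈ (extChartAt 𝓘(ℝ, E) (γ t)).source := mem_extChartAt_source _
  have hs2 : γ' t ∈ (extChartAt 𝓘(ℝ, E) (γ t)).source := h0 ▸ hs1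
  have hF : ContDiffAt ℝ 1 (geodesicField (chartForm 𝓘(ℝ, E) g (γ t)))
      (extChartAt 𝓘(ℝ, E) (γ t) (γ t), velocity γ t) :=
    contDiffAt_geodesicField ((hg.contDiffAt_chartForm _).of_le hle)
      (hg.chartForm_nondegenerate (mem_extChartAt_target _))
  obtain ⟨K, s, hs, hK⟩ := hF.exists_lipschitzOnWith
  have d1 := IsGeodesicAt.eventually_hasDerivAt hg hs1 hγ
  have d2 := IsGeodesicAt.eventually_hasDerivAt hg hs2 hγ'
  have e1 := deriv_extChartAt_comp_self (hγ.self_of_nhds.1.mdifferentiableAt (by simp))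
  have e2 : deriv (fun s ↦ extChartAt 𝓘(ℝ, E) (γ t) (γ' s)) t = velocity γ t := by
    rw [h0, h1]
    exact deriv_extChartAt_comp_self (hγ'.self_of_nhds.1.mdifferentiableAt (by simp))
  have m1 := d1.self_of_nhds.continuousAt.eventually_mem (by rw [e1]; exact hs)
  have m2 := d2.self_of_nhds.continuousAt.eventually_mem (by rw [e2, ← h0]; exact hs)
  have := ODE_solution_unique_of_eventually
    (v := fun _ ↦ geodesicField (chartForm 𝓘(ℝ, E) g (γ t))) (s := fun _ ↦ s)
    (Filter.Eventually.of_forall fun _ ↦ hK) (d1.and m1) (d2.and m2) (by rw [e1, e2, ← h0])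
  filter_upwards [this,
    eventually_mem_extChartAt_source hγ.self_of_nhds.1.continuousAt hs1,
    eventually_mem_extChartAt_source hγ'.self_of_nhds.1.continuousAt hs2] with r hr h3 h4
  exact (extChartAt 𝓘(ℝ, E) (γ t)).injOn h3 h4 (congrArg Prod.fst hr)

omit [FiniteDimensional ℝ E] in
theorem continuousAt_deriv_extChartAt {γ : ℝ → M} {t : ℝ} {x : M}
    (hγ : ContMDiffAt 𝓘(ℝ, ℝ) 𝓘(ℝ, E) 2 γ t) (hx : γ t ∈ (extChartAt 𝓘(ℝ, E) x).source) :
    ContinuousAt (deriv fun s ↦ extChartAt 𝓘(ℝ, E) x (γ s)) t :=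
  ((contDiffAt_extChartAt_comp (WithTop.coe_le_coe.2 le_top) hγ hx).derivWithin (m := 1)
    (by norm_num)).continuousAt

/-- Uniqueness of geodesics on an interval. -/
theorem geodesic_eqOn [T2Space M] {g : FormField 𝓘(ℝ, E) M} (hg : IsSemiRiemannian 𝓘(ℝ, E) g)
    {γ γ' : ℝ → M} {J : Set ℝ} (hJ : IsOpen J) (hJc : IsPreconnected J) {t₀ : ℝ} (ht₀ : t₀ ∈ J)
    (hγ : ∀ s ∈ J, ContMDiffAt 𝓘(ℝ, ℝ) 𝓘(ℝ, E) 2 γ s ∧ IsGeodesicAt g γ s)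
    (hγ' : ∀ s ∈ J, ContMDiffAt 𝓘(ℝ, ℝ) 𝓘(ℝ, E) 2 γ' s ∧ IsGeodesicAt g γ' s)
    (h0 : γ t₀ = γ' t₀) (h1 : velocity γ t₀ = (velocity γ' t₀ : E)) : EqOn γ γ' J := by
  have hloc : ∀ t ∈ J, γ t = γ' t → velocity γ t = (velocity γ' t : E) → γ =ᶠ[nhds t] γ' := by
    intro t ht
    exact geodesic_eventuallyEq hg (Filter.eventually_of_mem (hJ.mem_nhds ht) hγ)
      (Filter.eventually_of_mem (hJ.mem_nhds ht) hγ')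
  -- The set where the germs agree is open. At a limit point in `J` the positions agree because `M`
  -- is Hausdorff, the velocities agree by continuity in a chart, and local uniqueness applies
  -- again.
  have hsub : J ⊆ {t | γ =ᶠ[nhds t] γ'} := by
    refine hJc.subset_of_closure_inter_subset isOpen_setOfPred_eventually_nhds
      ⟨t₀, ht₀, hloc t₀ ht₀ h0 h1⟩ ?_
    rintro t ⟨htc, htJ⟩
    have hfreq : ∃ᶠ s in nhds t, γ =ᶠ[nhds s] γ' := mem_closure_iff_frequently.1 htc
    have hc : ContinuousAt γ t := (hγ t htJ).1.continuousAt
    have hc' : ContinuousAt γ' t := (hγ' t htJ).1.continuousAt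
    have e0 : γ t = γ' t := by
      have hcl : IsClosed {p : M × M | p.1 = p.2} := isClosed_diagonal
      have hp : Filter.Tendsto (fun s ↦ (γ s, γ' s)) (nhds t) (nhds (γ t, γ' t)) :=
        hc.prodMk_nhds hc'
      exact hcl.mem_of_frequently_of_tendsto (hfreq.mono fun s hs ↦ hs.self_of_nhds) hp
    refine hloc t htJ e0 ?_
    have hs1 : γ t ∈ (extChartAt 𝓘(ℝ, E) (γ t)).source := mem_extChartAt_source _
    have hs2 : γ' t ∈ (extChartAt 𝓘(ℝ, E) (γ t)).source := e0 ▸ hs1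
    have hd1 := continuousAt_deriv_extChartAt (hγ t htJ).1 hs1
    have hd2 := continuousAt_deriv_extChartAt (hγ' t htJ).1 hs2
    have hcl : IsClosed {p : E × E | p.1 = p.2} := isClosed_diagonal
    have e1 := hcl.mem_of_frequently_of_tendsto
      (hfreq.mono fun s hs ↦ Filter.EventuallyEq.deriv_eq (hs.fun_comp _))
      (Filter.Tendsto.prodMk_nhds hd1 hd2)
    have e2 := deriv_extChartAt_comp_self ((hγ t htJ).1.mdifferentiableAt (by simp))
    have e3 := deriv_extChartAt_comp_self ((hγ' t htJ).1.mdifferentiableAt (by simp))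
    rw [← e0] at e3
    rw [← e2, ← e3]
    exact e1
  exact fun t ht ↦ (hsub ht).self_of_nhds

end GeodesicUniqueness

/-! ### Open submanifolds. -/

section OpenSubmanifold

variable {E : Type*} [NormedAddCommGroup E] [NormedSpace ℝ E]
  {H : Type*} [TopologicalSpace H] {I : ModelWithCorners ℝ E H}
  {M : Type*} [TopologicalSpace M] [ChartedSpace H M]

/-- The preferred chart of an open submanifold is the restriction of the ambient one, so the
inclusion is the identity in coordinates. -/
theorem hasMFDerivAt_subtype_val (U : Opens M) (x : U) :
    HasMFDerivAt I I (Subtype.val : U → M) x (ContinuousLinearMap.id ℝ E) := by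
  refine ⟨continuous_subtype_val.continuousAt, ?_⟩
  refine (hasFDerivWithinAt_id _ _).congr_of_eventuallyEq ?_ ?_
  · filter_upwards [extChartAt_target_mem_nhdsWithin x] with y hy
    exact (extChartAt I x).right_inv hy
  · exact (extChartAt I x).right_inv (mem_extChartAt_target x)

theorem mder_subtype_val (U : Opens M) (x : U) :
    mder I I (Subtype.val : U → M) x = ContinuousLinearMap.id ℝ E :=
  (hasMFDerivAt_subtype_val U x).mfderiv

theorem restrictForm_apply (g : FormField I M) (U : Opens M) (x : U) (v w : E) :
    formAt I (restrictForm I g U) x v w = formAt I g x v w := by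
  change formAt I g x (mder I I (Subtype.val : U → M) x v)
    (mder I I (Subtype.val : U → M) x w) = _
  rw [mder_subtype_val]; rfl

end OpenSubmanifold

/-! ### The cone, warped and wave metrics evaluated on pairs of tangent vectors. -/

section ModelMetrics

variable {E : Type*} [NormedAddCommGroup E] [NormedSpace ℝ E]
  {H : Type*} [TopologicalSpace H] {I : ModelWithCorners ℝ E H}
  {M : Type*} [TopologicalSpace M] [ChartedSpace H M]

theorem mder_halfLine_fst (δ : ℝ) (x : halfLine δ × M) :
    mder (𝓘(ℝ, ℝ).prod I) 𝓘(ℝ, ℝ) (fun y : halfLine δ × M ↦ (y.1 : ℝ)) x =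
      ContinuousLinearMap.fst ℝ ℝ E := by
  rw [mder_comp (h := (Subtype.val : halfLine δ → ℝ)) (f := Prod.fst)
    (hasMFDerivAt_subtype_val _ _).mdifferentiableAt mdifferentiableAt_fst, mder_fst,
    mder_subtype_val]
  rfl

theorem coneMetric_apply (ε : ℝ) (g : FormField I M) (x : Cone M) (v w : ℝ × E) :
    formAt (coneModel I) (coneMetric I ε g) x v w =
      ε * (v.1 * w.1) + (x.1 : ℝ) ^ 2 * formAt I g x.2 v.2 w.2 := by
  have h1 := mder_halfLine_fst (I := I) 1 x
  have h2 := mder_snd (I := 𝓘(ℝ, ℝ)) (I' := I) x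
  have h : formAt (coneModel I) (coneMetric I ε g) x v w =
      ε * (mder (𝓘(ℝ, ℝ).prod I) 𝓘(ℝ, ℝ) (fun y : Cone M ↦ (y.1 : ℝ)) x v *
        mder (𝓘(ℝ, ℝ).prod I) 𝓘(ℝ, ℝ) (fun y : Cone M ↦ (y.1 : ℝ)) x w) +
      (x.1 : ℝ) ^ 2 * formAt I g x.2 (mder (𝓘(ℝ, ℝ).prod I) I Prod.snd x v)
        (mder (𝓘(ℝ, ℝ).prod I) I Prod.snd x w) := rfl
  rw [h, h1, h2]
  rfl

theorem expWarpedMetric_apply (ε : ℝ) (g : FormField I M) (x : ℝ × M) (v w : ℝ × E) :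
    formAt (𝓘(ℝ, ℝ).prod I) (expWarpedMetric I ε g) x v w =
      -ε * (v.1 * w.1) + Real.exp (2 * x.1) * formAt I g x.2 v.2 w.2 := by
  have h1 := mder_fst (I := 𝓘(ℝ, ℝ)) (I' := I) x
  have h2 := mder_snd (I := 𝓘(ℝ, ℝ)) (I' := I) x
  have h : formAt (𝓘(ℝ, ℝ).prod I) (expWarpedMetric I ε g) x v w =
      -ε * (mder (𝓘(ℝ, ℝ).prod I) 𝓘(ℝ, ℝ) Prod.fst x v *
        mder (𝓘(ℝ, ℝ).prod I) 𝓘(ℝ, ℝ) Prod.fst x w) +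
      Real.exp (2 * x.1) * formAt I g x.2 (mder (𝓘(ℝ, ℝ).prod I) I Prod.snd x v)
        (mder (𝓘(ℝ, ℝ).prod I) I Prod.snd x w) := rfl
  rw [h, h1, h2]
  rfl

theorem waveMetric_apply (ε : ℝ) (g : FormField I M) (x : WaveSpace ε M) (v w : ℝ × ℝ × E) :
    formAt (waveModel I) (waveMetric I ε g) x v w =
      v.1 * w.2.1 + v.2.1 * w.1 + (x.1 : ℝ) ^ 2 * formAt I g x.2.2 v.2.2 w.2.2 := by
  have h1 := mder_halfLine_fst (I := 𝓘(ℝ, ℝ).prod I) 1 x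
  have h3 : mder (waveModel I) 𝓘(ℝ, ℝ) (fun y : WaveSpace ε M ↦ (y.2.1 : ℝ)) x =
      (ContinuousLinearMap.fst ℝ ℝ E).comp (ContinuousLinearMap.snd ℝ ℝ (ℝ × E)) := by
    rw [mder_comp (h := fun y : halfLine ε × M ↦ (y.1 : ℝ)) (f := Prod.snd) (I' := 𝓘(ℝ, ℝ).prod I)
      ((hasMFDerivAt_subtype_val _ _).mdifferentiableAt.comp _ mdifferentiableAt_fst)
      mdifferentiableAt_snd, mder_snd, mder_halfLine_fst]
  have h2 : mder (waveModel I) I (fun y : WaveSpace ε M ↦ y.2.2) x =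
      (ContinuousLinearMap.snd ℝ ℝ E).comp (ContinuousLinearMap.snd ℝ ℝ (ℝ × E)) := by
    rw [mder_comp (h := fun y : halfLine ε × M ↦ y.2) (f := Prod.snd) (I' := 𝓘(ℝ, ℝ).prod I)
      mdifferentiableAt_snd mdifferentiableAt_snd, mder_snd]
    congr 1
    exact mder_snd _
  have h : formAt (waveModel I) (waveMetric I ε g) x v w =
      mder (waveModel I) 𝓘(ℝ, ℝ) (fun y : WaveSpace ε M ↦ (y.1 : ℝ)) x v *
        mder (waveModel I) 𝓘(ℝ, ℝ) (fun y : WaveSpace ε M ↦ (y.2.1 : ℝ)) x w +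
      mder (waveModel I) 𝓘(ℝ, ℝ) (fun y : WaveSpace ε M ↦ (y.2.1 : ℝ)) x v *
        mder (waveModel I) 𝓘(ℝ, ℝ) (fun y : WaveSpace ε M ↦ (y.1 : ℝ)) x w +
      (x.1 : ℝ) ^ 2 * formAt I g x.2.2
        (mder (waveModel I) I (fun y : WaveSpace ε M ↦ y.2.2) x v)
        (mder (waveModel I) I (fun y : WaveSpace ε M ↦ y.2.2) x w) := rfl
  rw [h, h1, h2, h3]
  rfl

theorem radialComponent_eq (ε : ℝ) (g : FormField I M)
    (V : ∀ x : Cone M, TangentSpace (coneModel I) x) (x : Cone M) :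
    radialComponent I ε g V x = ε * (show ℝ × E from V x).1 := by
  refine (coneMetric_apply ε g x (V x) (1, 0)).trans ?_
  simp

end ModelMetrics

/-! ### Charts of the cone. -/

section ConeCharts

variable {E : Type*} [NormedAddCommGroup E] [NormedSpace ℝ E]
  {M : Type*} [TopologicalSpace M] [ChartedSpace E M] [IsManifold 𝓘(ℝ, E) ∞ M]

theorem mem_extChartAt_halfLine_source {δ : ℝ} (r r' : halfLine δ) :
    r' ∈ (extChartAt 𝓘(ℝ, ℝ) r).source := by
  rw [extChartAt_source, Opens.chartAt_eq]
  simp only [OpenPartialHomeomorph.subtypeRestr_source]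
  simp [chartAt_self_eq]

theorem mem_extChartAt_halfLine_target {δ : ℝ} (r : halfLine δ) {t : ℝ} (ht : t ∈ halfLine δ) :
    t ∈ (extChartAt 𝓘(ℝ, ℝ) r).target :=
  (extChartAt 𝓘(ℝ, ℝ) r).map_source (x := ⟨t, ht⟩) (mem_extChartAt_halfLine_source r _)

theorem extChartAt_halfLine_symm {δ : ℝ} (r r' : halfLine δ) :
    (extChartAt 𝓘(ℝ, ℝ) r).symm (r' : ℝ) = r' :=
  (extChartAt 𝓘(ℝ, ℝ) r).left_inv (x := r') (mem_extChartAt_halfLine_source r _)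

omit [IsManifold 𝓘(ℝ, E) ∞ M] in
theorem extChartAt_cone (x : Cone M) (y : Cone M) :
    extChartAt (coneModel 𝓘(ℝ, E)) x y = ((y.1 : ℝ), extChartAt 𝓘(ℝ, E) x.2 y.2) := rfl

omit [IsManifold 𝓘(ℝ, E) ∞ M] in
theorem extChartAt_cone_symm (x : Cone M) (r : halfLine 1) (y : E) :
    (extChartAt (coneModel 𝓘(ℝ, E)) x).symm ((r : ℝ), y) =
      (r, (extChartAt 𝓘(ℝ, E) x.2).symm y) :=
  Prod.ext (extChartAt_halfLine_symm x.1 r) rfl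

/-- A chart of the cone is the inclusion of the half-line times a chart of `M`, so its derivative
leaves the radial component alone. -/
theorem mder_extChartAt_cone (x : Cone M) {y : Cone M}
    (hy : y.2 ∈ (extChartAt 𝓘(ℝ, E) x.2).source) (v : ℝ × E) :
    mder (coneModel 𝓘(ℝ, E)) 𝓘(ℝ, ℝ × E) (extChartAt (coneModel 𝓘(ℝ, E)) x) y v =
      (v.1, mder 𝓘(ℝ, E) 𝓘(ℝ, E) (extChartAt 𝓘(ℝ, E) x.2) y.2 v.2) := by
  have h1 : MDifferentiableAt (coneModel 𝓘(ℝ, E)) 𝓘(ℝ, ℝ) (fun y : Cone M ↦ (y.1 : ℝ)) y :=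
    (hasMFDerivAt_subtype_val _ _).mdifferentiableAt.comp _ mdifferentiableAt_fst
  have h2 : MDifferentiableAt (coneModel 𝓘(ℝ, E)) 𝓘(ℝ, E)
      (fun y : Cone M ↦ extChartAt 𝓘(ℝ, E) x.2 y.2) y :=
    (mdifferentiableAt_extChartAt_of_mem hy).comp _ mdifferentiableAt_snd
  have h3 : mder (coneModel 𝓘(ℝ, E)) 𝓘(ℝ, ℝ × E) (extChartAt (coneModel 𝓘(ℝ, E)) x) y =
      (mder (coneModel 𝓘(ℝ, E)) 𝓘(ℝ, ℝ) (fun y : Cone M ↦ (y.1 : ℝ)) y).prod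
        (mder (coneModel 𝓘(ℝ, E)) 𝓘(ℝ, E) (fun y : Cone M ↦ extChartAt 𝓘(ℝ, E) x.2 y.2) y) :=
    (show HasMFDerivAt (coneModel 𝓘(ℝ, E)) 𝓘(ℝ, ℝ × E) (extChartAt (coneModel 𝓘(ℝ, E)) x) y _ from
      ⟨continuousAt_extChartAt' (by
        rw [extChartAt_prod]; exact ⟨mem_extChartAt_halfLine_source _ _, hy⟩),
      h1.hasMFDerivAt.2.prodMk h2.hasMFDerivAt.2⟩).mfderiv
  rw [h3, mder_halfLine_fst,
    mder_comp (mdifferentiableAt_extChartAt_of_mem hy) mdifferentiableAt_snd, mder_snd]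
  rfl

theorem mder_extChartAt_cone_symm (x : Cone M) (r : halfLine 1) {y : E}
    (hy : y ∈ (extChartAt 𝓘(ℝ, E) x.2).target) (v : ℝ × E) :
    mder 𝓘(ℝ, ℝ × E) (coneModel 𝓘(ℝ, E)) (extChartAt (coneModel 𝓘(ℝ, E)) x).symm ((r : ℝ), y) v =
      (v.1, mder 𝓘(ℝ, E) 𝓘(ℝ, E) (extChartAt 𝓘(ℝ, E) x.2).symm y v.2) := by
  have hy' : ((r : ℝ), y) ∈ (extChartAt (coneModel 𝓘(ℝ, E)) x).target := by
    rw [extChartAt_prod]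
    exact ⟨mem_extChartAt_halfLine_target x.1 r.2, hy⟩
  have ho : (extChartAt (coneModel 𝓘(ℝ, E)) x).target ∈ nhds ((r : ℝ), y) :=
    (isOpen_extChartAt_target x).mem_nhds hy'
  have : IsManifold (coneModel 𝓘(ℝ, E)) 1 (Cone M) := .of_le (n := ∞) (by exact_mod_cast le_top)
  have hd : MDifferentiableAt 𝓘(ℝ, ℝ × E) (coneModel 𝓘(ℝ, E))
      (extChartAt (coneModel 𝓘(ℝ, E)) x).symm ((r : ℝ), y) :=
    ((contMDiffOn_extChartAt_symm (n := 1) x).contMDiffAt ho).mdifferentiableAt (by simp)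
  have hs := (extChartAt (coneModel 𝓘(ℝ, E)) x).map_target hy'
  have hd2 : MDifferentiableAt (coneModel 𝓘(ℝ, E)) 𝓘(ℝ, ℝ × E)
      (extChartAt (coneModel 𝓘(ℝ, E)) x) ((extChartAt (coneModel 𝓘(ℝ, E)) x).symm ((r : ℝ), y)) :=
    (contMDiffAt_extChartAt' (n := 1) (by simpa only [extChartAt_source] using hs)).mdifferentiableAt
      (by simp)
  have h4 : (fun y ↦ extChartAt (coneModel 𝓘(ℝ, E)) x
      ((extChartAt (coneModel 𝓘(ℝ, E)) x).symm y)) =ᶠ[nhds ((r : ℝ), y)] fun y ↦ y := by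
    filter_upwards [ho] with z hz
    exact (extChartAt (coneModel 𝓘(ℝ, E)) x).right_inv hz
  have h5 := mder_comp_apply hd2 hd v
  rw [mder_congr h4, mder_id, extChartAt_cone_symm, mder_extChartAt_cone x
    ((extChartAt 𝓘(ℝ, E) x.2).map_target hy)] at h5
  have h6 : v.1 = _ := congrArg Prod.fst h5
  have h7 : v.2 = _ := congrArg Prod.snd h5
  refine Prod.ext h6.symm ?_
  rw [h7]
  have h8 := mder_symm_mder_extChartAt ((extChartAt 𝓘(ℝ, E) x.2).map_target hy)
  rw [(extChartAt 𝓘(ℝ, E) x.2).right_inv hy] at h8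
  exact (h8 _).symm


end ConeCharts

/-! ### Smooth vector fields in charts. -/

section VectorFields

variable {E : Type*} [NormedAddCommGroup E] [NormedSpace ℝ E]
  {H : Type*} [TopologicalSpace H] {I : ModelWithCorners ℝ E H}
  {M : Type*} [TopologicalSpace M] [ChartedSpace H M]

/-- Smoothness of a section is smoothness in the trivialization at `x`, whose fibre maps are the
derivatives of the chart. -/
theorem contMDiffAt_mder_extChartAt [IsManifold I ∞ M] {V : ∀ x : M, TangentSpace I x} {x : M}
    (hV : ContMDiffAt I I.tangent ∞ (fun x ↦ (⟨x, V x⟩ : TangentBundle I M)) x) :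
    ContMDiffAt I 𝓘(ℝ, E) ∞ (fun x' ↦ mder I 𝓘(ℝ, E) (extChartAt I x) x' (V x')) x := by
  have : IsManifold I 1 M := .of_le (n := ∞) (by exact_mod_cast le_top)
  have h := (Bundle.contMDiffAt_section (n := ∞) (F := E) (E := TangentSpace I (M := M)) x).1 hV
  refine h.congr_of_eventuallyEq ?_
  filter_upwards [(chartAt H x).open_source.mem_nhds (mem_chart_source H x)] with x' hx'
  have h2 := TangentBundle.continuousLinearMapAt_trivializationAt (I := I) hx'
  have hb : x' ∈ (trivializationAt E (TangentSpace I) x).baseSet := by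
    simpa [TangentBundle.trivializationAt_baseSet] using hx'
  refine (congrArg (fun L ↦ L (V x')) h2).symm.trans ?_
  exact Trivialization.continuousLinearMapAt_apply_of_mem ℝ _ hb (V x')

end VectorFields

/-! ### From a parallel null field on the cone to a conformal gradient on the base. -/

section ConeReduction

variable {E : Type*} [NormedAddCommGroup E] [NormedSpace ℝ E]
  {M : Type*} [TopologicalSpace M] [ChartedSpace E M]

/-- The coordinate expression of a vector field, with values in the model vector space. -/
def chartVec (Z : M → E) (x : M) (y : E) : E :=
  mder 𝓘(ℝ, E) 𝓘(ℝ, E) (extChartAt 𝓘(ℝ, E) x) ((extChartAt 𝓘(ℝ, E) x).symm y)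
    (Z ((extChartAt 𝓘(ℝ, E) x).symm y))

/-- The function `u` has gradient `Z`, its Hessian is `-ε u g`, and `g(Z, Z) = -ε u²`. -/
structure IsConformalGradient (ε : ℝ) (g : FormField 𝓘(ℝ, E) M) (u : M → ℝ) (Z : M → E) :
    Prop where
  contMDiff : ContMDiff 𝓘(ℝ, E) 𝓘(ℝ, ℝ) ∞ u
  contDiffAt_chartVec : ∀ x, ContDiffAt ℝ ∞ (chartVec Z x) (extChartAt 𝓘(ℝ, E) x x)
  mder_eq : ∀ x v, mder 𝓘(ℝ, E) 𝓘(ℝ, ℝ) u x v = formAt 𝓘(ℝ, E) g x v (Z x)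
  covariant : ∀ x v z, formAt 𝓘(ℝ, E) g x
      (fderiv ℝ (chartVec Z x) (extChartAt 𝓘(ℝ, E) x x) v) z
      + coordChristoffel (chartForm 𝓘(ℝ, E) g x) (extChartAt 𝓘(ℝ, E) x x) v (Z x) z
    = -ε * u x * formAt 𝓘(ℝ, E) g x v z
  norm_sq : ∀ x, formAt 𝓘(ℝ, E) g x (Z x) (Z x) = -ε * u x ^ 2

set_option synthInstance.maxHeartbeats 200000 in
theorem coordChristoffel_zero_right (G : E → E →L[ℝ] E →L[ℝ] ℝ) (y v w : E) :
    coordChristoffel G y v w 0 = 0 := by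
  simp [coordChristoffel]

variable [IsManifold 𝓘(ℝ, E) ∞ M]

theorem chartForm_coneMetric (ε : ℝ) (g : FormField 𝓘(ℝ, E) M) (x : Cone M) (r : halfLine 1)
    {y : E} (hy : y ∈ (extChartAt 𝓘(ℝ, E) x.2).target) (v w : ℝ × E) :
    chartForm (coneModel 𝓘(ℝ, E)) (coneMetric 𝓘(ℝ, E) ε g) x ((r : ℝ), y) v w =
      ε * (v.1 * w.1) + (r : ℝ) ^ 2 * chartForm 𝓘(ℝ, E) g x.2 y v.2 w.2 := by
  have h : chartForm (coneModel 𝓘(ℝ, E)) (coneMetric 𝓘(ℝ, E) ε g) x ((r : ℝ), y) v w =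
      formAt (coneModel 𝓘(ℝ, E)) (coneMetric 𝓘(ℝ, E) ε g)
        ((extChartAt (coneModel 𝓘(ℝ, E)) x).symm ((r : ℝ), y))
        (mder 𝓘(ℝ, ℝ × E) (coneModel 𝓘(ℝ, E)) (extChartAt (coneModel 𝓘(ℝ, E)) x).symm
          ((r : ℝ), y) v)
        (mder 𝓘(ℝ, ℝ × E) (coneModel 𝓘(ℝ, E)) (extChartAt (coneModel 𝓘(ℝ, E)) x).symm
          ((r : ℝ), y) w) := rfl
  rw [h, mder_extChartAt_cone_symm x r hy, mder_extChartAt_cone_symm x r hy,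
    extChartAt_cone_symm, coneMetric_apply]
  rfl

theorem chartField_cone (V : ∀ x : Cone M, TangentSpace (coneModel 𝓘(ℝ, E)) x) (x : Cone M)
    (r : halfLine 1) {y : E} (hy : y ∈ (extChartAt 𝓘(ℝ, E) x.2).target) :
    chartField (coneModel 𝓘(ℝ, E)) V x ((r : ℝ), y) =
      ((show ℝ × E from V (r, (extChartAt 𝓘(ℝ, E) x.2).symm y)).1,
        mder 𝓘(ℝ, E) 𝓘(ℝ, E) (extChartAt 𝓘(ℝ, E) x.2) ((extChartAt 𝓘(ℝ, E) x.2).symm y)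
          (show ℝ × E from V (r, (extChartAt 𝓘(ℝ, E) x.2).symm y)).2) := by
  have h := mder_extChartAt_cone x (y := (r, (extChartAt 𝓘(ℝ, E) x.2).symm y))
    ((extChartAt 𝓘(ℝ, E) x.2).map_target hy) (V (r, (extChartAt 𝓘(ℝ, E) x.2).symm y))
  rw [← h, ← extChartAt_cone_symm x r y]
  rfl

omit [IsManifold 𝓘(ℝ, E) ∞ M] in
theorem eventually_halfLine_prod {x : Cone M} {P : ℝ × E → Prop}
    (h : ∀ (r : halfLine 1) (y : E), y ∈ (extChartAt 𝓘(ℝ, E) x.2).target → P ((r : ℝ), y)) :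
    ∀ᶠ q in nhds ((x.1 : ℝ), extChartAt 𝓘(ℝ, E) x.2 x.2), P q := by
  have h1 : (halfLine 1 : Set ℝ) ×ˢ (extChartAt 𝓘(ℝ, E) x.2).target ∈
      nhds ((x.1 : ℝ), extChartAt 𝓘(ℝ, E) x.2 x.2) :=
    prod_mem_nhds ((halfLine 1).2.mem_nhds x.1.2)
      ((isOpen_extChartAt_target x.2).mem_nhds (mem_extChartAt_target x.2))
  filter_upwards [h1] with q hq
  exact h ⟨q.1, hq.1⟩ q.2 hq.2

-- In the chart `ε dr²` has constant coefficients and `g` is scaled by `r²`, which accounts for the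
-- factor `2 r` in the radial direction.
set_option synthInstance.maxHeartbeats 200000 in
theorem fderiv_chartForm_coneMetric (ε : ℝ) {g : FormField 𝓘(ℝ, E) M}
    (hg : IsSemiRiemannian 𝓘(ℝ, E) g) (x : Cone M) (a v w : ℝ × E) :
    fderiv ℝ (chartForm (coneModel 𝓘(ℝ, E)) (coneMetric 𝓘(ℝ, E) ε g) x)
        (extChartAt (coneModel 𝓘(ℝ, E)) x x) a v w =
      2 * (x.1 : ℝ) * a.1 * formAt 𝓘(ℝ, E) g x.2 v.2 w.2 +
      (x.1 : ℝ) ^ 2 * fderiv ℝ (chartForm 𝓘(ℝ, E) g x.2) (extChartAt 𝓘(ℝ, E) x.2 x.2)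
        a.2 v.2 w.2 := by
  rw [extChartAt_cone]
  have hG := hg.contDiffAt_chartForm x.2
  -- The factor `r²` is realized by feeding `r`-scaled vectors to `g`, which presents the metric as
  -- a composition of smooth maps.
  let F : ℝ × E → (ℝ × E) →L[ℝ] (ℝ × E) →L[ℝ] ℝ := fun q ↦
    ε • (ContinuousLinearMap.fst ℝ ℝ E).smulRight (ContinuousLinearMap.fst ℝ ℝ E)
      + ((ContinuousLinearMap.compL ℝ (ℝ × E) E ℝ).flip (q.1 • ContinuousLinearMap.snd ℝ ℝ E)).comp
        ((chartForm 𝓘(ℝ, E) g x.2 q.2).comp (q.1 • ContinuousLinearMap.snd ℝ ℝ E))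
  have hF : ContDiffAt ℝ 1 F ((x.1 : ℝ), extChartAt 𝓘(ℝ, E) x.2 x.2) := by
    have h1 : ContDiffAt ℝ 1 (fun q : ℝ × E ↦ chartForm 𝓘(ℝ, E) g x.2 q.2)
        ((x.1 : ℝ), extChartAt 𝓘(ℝ, E) x.2 x.2) :=
      ContDiffAt.snd' (hG.of_le (by exact_mod_cast le_top))
    have h2 : ContDiffAt ℝ 1 (fun q : ℝ × E ↦ q.1 • ContinuousLinearMap.snd ℝ ℝ E)
        ((x.1 : ℝ), extChartAt 𝓘(ℝ, E) x.2 x.2) := contDiffAt_fst.smul contDiffAt_const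
    exact contDiffAt_const.add
      (((ContinuousLinearMap.contDiff _).contDiffAt.comp _ h2).clm_comp (h1.clm_comp h2))
  have hFa : ∀ (q v w : ℝ × E), F q v w =
      ε * (v.1 * w.1) + q.1 ^ 2 * chartForm 𝓘(ℝ, E) g x.2 q.2 v.2 w.2 := by
    intro q v w
    change ε * (v.1 * w.1) + chartForm 𝓘(ℝ, E) g x.2 q.2 (q.1 • v.2) (q.1 • w.2) = _
    rw [map_smul, map_smul, smul_apply, smul_eq_mul, smul_eq_mul]
    ring
  have e : chartForm (coneModel 𝓘(ℝ, E)) (coneMetric 𝓘(ℝ, E) ε g) x =ᶠ[nhds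
      ((x.1 : ℝ), extChartAt 𝓘(ℝ, E) x.2 x.2)] F := by
    refine eventually_halfLine_prod fun r y hy ↦ ?_
    refine ContinuousLinearMap.ext fun v ↦ ContinuousLinearMap.ext fun w ↦ ?_
    rw [chartForm_coneMetric ε g x r hy, hFa]
  rw [e.fderiv_eq, fderiv_bilin_apply (hF.differentiableAt (by simp))]
  simp only [hFa]
  have hGd := hG.differentiableAt (by simp)
  have h1 : HasFDerivAt (fun y ↦ chartForm 𝓘(ℝ, E) g x.2 y v.2 w.2) _
      (extChartAt 𝓘(ℝ, E) x.2 x.2) :=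
    (hGd.hasFDerivAt.clm_apply (hasFDerivAt_const v.2 _)).clm_apply (hasFDerivAt_const w.2 _)
  have h2 : HasFDerivAt (fun q : ℝ × E ↦ chartForm 𝓘(ℝ, E) g x.2 q.2 v.2 w.2) _
      ((x.1 : ℝ), extChartAt 𝓘(ℝ, E) x.2 x.2) :=
    HasFDerivAt.comp (g := fun y ↦ chartForm 𝓘(ℝ, E) g x.2 y v.2 w.2) _
      h1 (hasFDerivAt_snd (𝕜 := ℝ) (p := ((x.1 : ℝ), extChartAt 𝓘(ℝ, E) x.2 x.2)))
  have h3 := (((hasFDerivAt_fst (𝕜 := ℝ)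
    (p := ((x.1 : ℝ), extChartAt 𝓘(ℝ, E) x.2 x.2))).pow 2).mul h2).const_add (ε * (v.1 * w.1))
  refine (congrArg (fun L ↦ L a) h3.fderiv).trans ?_
  rw [← chartForm_self]
  simp
  ring

/-- The equation `ĝ(∇_v V, z) = 0` written out on the cone: apart from `r²` times the Christoffel
symbol of `g`, only terms from the derivative of `r²` enter. `D` stands for the coordinate
derivative of `V` along `v`, and `W` for its value. -/
theorem parallel_cone {ε : ℝ} {g : FormField 𝓘(ℝ, E) M} (hg : IsSemiRiemannian 𝓘(ℝ, E) g)
    {V : ∀ x : Cone M, TangentSpace (coneModel 𝓘(ℝ, E)) x}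
    (hV : IsParallelField (coneModel 𝓘(ℝ, E)) (coneMetric 𝓘(ℝ, E) ε g) V)
    (x : Cone M) (v z D : ℝ × E) (hD : fderiv ℝ (chartField (coneModel 𝓘(ℝ, E)) V x)
      ((x.1 : ℝ), extChartAt 𝓘(ℝ, E) x.2 x.2) v = D) (W : ℝ × E) (hW : W = V x) :
    ε * (D.1 * z.1) + (x.1 : ℝ) ^ 2 * formAt 𝓘(ℝ, E) g x.2 D.2 z.2
      + (x.1 : ℝ) * (v.1 * formAt 𝓘(ℝ, E) g x.2 W.2 z.2 + W.1 * formAt 𝓘(ℝ, E) g x.2 v.2 z.2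
        - z.1 * formAt 𝓘(ℝ, E) g x.2 v.2 W.2)
      + (x.1 : ℝ) ^ 2 * coordChristoffel (chartForm 𝓘(ℝ, E) g x.2)
        (extChartAt 𝓘(ℝ, E) x.2 x.2) v.2 W.2 z.2 = 0 := by
  have : IsManifold 𝓘(ℝ, E) 1 M := .of_le (n := ∞) (by exact_mod_cast le_top)
  have h := hV.parallel x v z
  have hc : chartField (coneModel 𝓘(ℝ, E)) V x (extChartAt (coneModel 𝓘(ℝ, E)) x x) = W := by
    rw [extChartAt_cone, chartField_cone V x x.1 (mem_extChartAt_target x.2), extChartAt_to_inv,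
      mder_extChartAt_self, hW]
    rfl
  rw [hc] at h
  unfold christoffel at h
  rw [fderiv_chartForm_coneMetric ε hg, fderiv_chartForm_coneMetric ε hg,
    fderiv_chartForm_coneMetric ε hg, extChartAt_cone,
    chartForm_coneMetric ε g x x.1 (mem_extChartAt_target x.2), hD, chartForm_self] at h
  unfold coordChristoffel
  linarith

theorem contDiffAt_chartField_cone {V : ∀ x : Cone M, TangentSpace (coneModel 𝓘(ℝ, E)) x}
    (hV : ContMDiff (coneModel 𝓘(ℝ, E)) (coneModel 𝓘(ℝ, E)).tangent ∞
      (fun x ↦ (⟨x, V x⟩ : TangentBundle (coneModel 𝓘(ℝ, E)) (Cone M)))) (x : Cone M) :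
    ContDiffAt ℝ ∞ (chartField (coneModel 𝓘(ℝ, E)) V x)
      ((x.1 : ℝ), extChartAt 𝓘(ℝ, E) x.2 x.2) := by
  rw [← contMDiffAt_iff_contDiffAt]
  have h := contMDiffAt_mder_extChartAt (hV.contMDiffAt (x := x))
  have h2 : ContMDiffAt 𝓘(ℝ, ℝ × E) (coneModel 𝓘(ℝ, E)) ∞ (extChartAt (coneModel 𝓘(ℝ, E)) x).symm
      (extChartAt (coneModel 𝓘(ℝ, E)) x x) :=
    (contMDiffOn_extChartAt_symm x).contMDiffAt
      ((isOpen_extChartAt_target x).mem_nhds (mem_extChartAt_target x))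
  exact ContMDiffAt.comp (extChartAt (coneModel 𝓘(ℝ, E)) x x)
    (g := fun x' ↦ mder (coneModel 𝓘(ℝ, E)) 𝓘(ℝ, ℝ × E) (extChartAt (coneModel 𝓘(ℝ, E)) x) x' (V x'))
    (by rw [extChartAt_to_inv]; exact h) h2

/-- A parallel null field on the cone gives a function with conformal gradient on the base. -/
theorem exists_isConformalGradient {ε : ℝ} (hε : ε = 1 ∨ ε = -1) {g : FormField 𝓘(ℝ, E) M}
    (hg : IsSemiRiemannian 𝓘(ℝ, E) g) {V : ∀ x : Cone M, TangentSpace (coneModel 𝓘(ℝ, E)) x}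
    (hV : IsParallelField (coneModel 𝓘(ℝ, E)) (coneMetric 𝓘(ℝ, E) ε g) V)
    (hnull : ∀ x, coneMetric 𝓘(ℝ, E) ε g x (V x) (V x) = 0) :
    ∃ (u : M → ℝ) (Z : M → E), IsConformalGradient ε g u Z ∧
      ∀ (r : halfLine 1) (p : M), radialComponent 𝓘(ℝ, E) ε g V (r, p) = u p := by
  have : IsManifold 𝓘(ℝ, E) 1 M := .of_le (n := ∞) (by exact_mod_cast le_top)
  have hε2 : ε * ε = 1 := by rcases hε with rfl | rfl <;> norm_num
  let W : Cone M → ℝ × E := V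
  let one : halfLine 1 := ⟨1, by change (0 : ℝ) < 1 * 1; norm_num⟩
  have hone : (one : ℝ) = 1 := rfl
  have hcf : ∀ (x : Cone M) (r : halfLine 1) (y : E), y ∈ (extChartAt 𝓘(ℝ, E) x.2).target →
      chartField (coneModel 𝓘(ℝ, E)) V x ((r : ℝ), y) =
      ((W (r, (extChartAt 𝓘(ℝ, E) x.2).symm y)).1,
        mder 𝓘(ℝ, E) 𝓘(ℝ, E) (extChartAt 𝓘(ℝ, E) x.2) ((extChartAt 𝓘(ℝ, E) x.2).symm y)
          (W (r, (extChartAt 𝓘(ℝ, E) x.2).symm y)).2) :=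
    fun x r y hy ↦ chartField_cone V x r hy
  have hdiff := contDiffAt_chartField_cone hV.contMDiff
  have hpar : ∀ x v z, _ := fun x v z ↦ parallel_cone hg hV x v z _ rfl (W x) rfl
  -- For `v = z = ∂_r` all other terms of the parallel equation vanish, leaving `ε ∂_r V^r = 0`.
  have hrad : ∀ (r : halfLine 1) (p : M), (W (r, p)).1 = (W (one, p)).1 := by
    intro r p
    let f : ℝ → ℝ := fun t ↦ (chartField (coneModel 𝓘(ℝ, E)) V (one, p)
      (t, extChartAt 𝓘(ℝ, E) p p)).1
    have hf : ∀ s : halfLine 1, f s = (W (s, p)).1 := by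
      intro s
      change (chartField (coneModel 𝓘(ℝ, E)) V (one, p) ((s : ℝ), extChartAt 𝓘(ℝ, E) p p)).1 = _
      rw [hcf (one, p) s _ (mem_extChartAt_target p), extChartAt_to_inv]
    have hd : ∀ t ∈ (halfLine 1 : Set ℝ), HasDerivAt f 0 t := by
      intro t ht
      have h1 := ((hdiff (⟨t, ht⟩, p)).differentiableAt (by simp)).hasFDerivAt
      have h2 : HasDerivAt (fun s : ℝ ↦ (s, extChartAt 𝓘(ℝ, E) p p)) (1, 0) t :=
        (hasDerivAt_id t).prodMk (hasDerivAt_const _ _)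
      have h3 := (hasFDerivAt_fst.comp t (HasFDerivAt.comp_hasDerivAt t h1 h2)).hasDerivAt
      have h4 := hpar (⟨t, ht⟩, p) (1, 0) (1, 0)
      have h5 : (fderiv ℝ (chartField (coneModel 𝓘(ℝ, E)) V (⟨t, ht⟩, p))
          (t, extChartAt 𝓘(ℝ, E) p p) (1, 0)).1 = 0 := by
        simp [coordChristoffel_zero_right] at h4
        rcases h4 with h4 | h4
        · rw [h4] at hε2; norm_num at hε2
        · exact h4
      refine HasDerivAt.congr_of_eventuallyEq (f := fun s : ℝ ↦
        (chartField (coneModel 𝓘(ℝ, E)) V (⟨t, ht⟩, p) (s, extChartAt 𝓘(ℝ, E) p p)).1) ?_ ?_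
      · have h6 : HasDerivAt _ (0 : ℝ) t := h3.congr_deriv (by simpa using h5)
        exact h6
      · filter_upwards [(halfLine 1).2.mem_nhds ht] with s hs
        rw [hf ⟨s, hs⟩, hcf (⟨t, ht⟩, p) ⟨s, hs⟩ _ (mem_extChartAt_target p), extChartAt_to_inv]
    have hconn : IsPreconnected (halfLine 1 : Set ℝ) := by
      have : (halfLine 1 : Set ℝ) = Ioi 0 := by ext t; simp [halfLine]
      rw [this]; exact isPreconnected_Ioi
    rw [← hf, ← hf]
    exact (halfLine 1).2.is_const_of_deriv_eq_zero hconn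
      (fun t ht ↦ (hd t ht).differentiableAt.differentiableWithinAt)
      (fun t ht ↦ (hd t ht).deriv) r.2 one.2
  have hfst : ∀ (p : M), ∀ᶠ y in nhds (extChartAt 𝓘(ℝ, E) p p),
      chartField (coneModel 𝓘(ℝ, E)) V (one, p) (1, y) =
        ((W (one, (extChartAt 𝓘(ℝ, E) p).symm y)).1, chartVec (fun p ↦ (W (one, p)).2) p y) := by
    intro p
    filter_upwards [(isOpen_extChartAt_target p).mem_nhds (mem_extChartAt_target p)] with y hy
    exact hcf (one, p) one y hy
  have hi : ∀ p : M, HasFDerivAt (fun y : E ↦ ((1 : ℝ), y)) (ContinuousLinearMap.inr ℝ ℝ E)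
      (extChartAt 𝓘(ℝ, E) p p) := fun p ↦ hasFDerivAt_prodMk_right 1 _
  have hc1 : ∀ p : M, ContDiffAt ℝ ∞ (fun y : E ↦ chartField (coneModel 𝓘(ℝ, E)) V (one, p) (1, y))
      (extChartAt 𝓘(ℝ, E) p p) := fun p ↦
    ContDiffAt.comp _ (hdiff (one, p)) (contDiffAt_const.prodMk contDiffAt_id)
  have hd1 : ∀ p : M, HasFDerivAt
      (fun y : E ↦ chartField (coneModel 𝓘(ℝ, E)) V (one, p) (1, y))
      ((fderiv ℝ (chartField (coneModel 𝓘(ℝ, E)) V (one, p)) (1, extChartAt 𝓘(ℝ, E) p p)).comp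
        (ContinuousLinearMap.inr ℝ ℝ E)) (extChartAt 𝓘(ℝ, E) p p) := fun p ↦
    HasFDerivAt.comp _ ((hdiff (one, p)).differentiableAt (by simp)).hasFDerivAt (hi p)
  have hcu : ∀ p : M, ContDiffAt ℝ ∞ (fun y ↦ (W (one, (extChartAt 𝓘(ℝ, E) p).symm y)).1)
      (extChartAt 𝓘(ℝ, E) p p) := fun p ↦
    (hc1 p).fst.congr_of_eventuallyEq ((hfst p).mono fun y hy ↦ by simp only [hy])
  have hcZ : ∀ p : M, ContDiffAt ℝ ∞ (chartVec (fun p ↦ (W (one, p)).2) p)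
      (extChartAt 𝓘(ℝ, E) p p) := fun p ↦
    (hc1 p).snd.congr_of_eventuallyEq ((hfst p).mono fun y hy ↦ by simp only [hy])
  have hdu : ∀ (p : M) (v : E), fderiv ℝ (fun y ↦ (W (one, (extChartAt 𝓘(ℝ, E) p).symm y)).1)
      (extChartAt 𝓘(ℝ, E) p p) v = (fderiv ℝ (chartField (coneModel 𝓘(ℝ, E)) V (one, p))
        (1, extChartAt 𝓘(ℝ, E) p p) (0, v)).1 := by
    intro p v
    have h := ((hd1 p).fst.congr_of_eventuallyEq
      (f₁ := fun y ↦ (W (one, (extChartAt 𝓘(ℝ, E) p).symm y)).1)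
      ((hfst p).mono fun y hy ↦ by simp only [hy])).fderiv
    rw [h]
    simp
  have hdZ : ∀ (p : M) (v : E), fderiv ℝ (chartVec (fun p ↦ (W (one, p)).2) p)
      (extChartAt 𝓘(ℝ, E) p p) v = (fderiv ℝ (chartField (coneModel 𝓘(ℝ, E)) V (one, p))
        (1, extChartAt 𝓘(ℝ, E) p p) (0, v)).2 := by
    intro p v
    have h := ((hd1 p).snd.congr_of_eventuallyEq (f₁ := chartVec (fun p ↦ (W (one, p)).2) p)
      ((hfst p).mono fun y hy ↦ by simp only [hy])).fderiv
    rw [h]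
    simp
  have hsm : ContMDiff 𝓘(ℝ, E) 𝓘(ℝ, ℝ) ∞ (fun p ↦ (W (one, p)).1) := by
    intro p
    have h := ContMDiffAt.comp p (hcu p).contMDiffAt
      (contMDiffAt_extChartAt_of_mem le_rfl (mem_extChartAt_source p))
    refine h.congr_of_eventuallyEq ?_
    filter_upwards [extChartAt_source_mem_nhds (I := 𝓘(ℝ, E)) p] with q hq
    simp only [Function.comp_apply]
    rw [(extChartAt 𝓘(ℝ, E) p).left_inv hq]
  have hmder : ∀ (p : M) (v : E), mder 𝓘(ℝ, E) 𝓘(ℝ, ℝ) (fun p ↦ (W (one, p)).1) p v =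
      fderiv ℝ (fun y ↦ (W (one, (extChartAt 𝓘(ℝ, E) p).symm y)).1)
        (extChartAt 𝓘(ℝ, E) p p) v := by
    intro p v
    rw [← mder_eq_fderiv, mder_comp (h := fun p ↦ (W (one, p)).1)
      ((hsm.contMDiffAt).mdifferentiableAt (by simp))
      (mdifferentiableAt_extChartAt_symm (mem_extChartAt_target p)), mder_extChartAt_symm_self,
      extChartAt_to_inv]
    rfl
  -- `u = ε V^r`, and `Z` is the tangential part of `V` at `r = 1`. With `v` tangential, the test
  -- vector `∂_r` yields `du = g(·, Z)` and tangential test vectors yield `∇Z`; nullity yields `g(Z,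
  -- Z)`.
  refine ⟨fun p ↦ ε * (W (one, p)).1, fun p ↦ (W (one, p)).2, ⟨?_, hcZ, ?_, ?_, ?_⟩, ?_⟩
  · exact contMDiff_const.mul hsm
  · intro p v
    have h1 : mder 𝓘(ℝ, E) 𝓘(ℝ, ℝ) (fun p ↦ ε * (W (one, p)).1) p v =
        ε * mder 𝓘(ℝ, E) 𝓘(ℝ, ℝ) (fun p ↦ (W (one, p)).1) p v := by
      rw [mder_comp_apply (h := fun t : ℝ ↦ ε * t) (I' := 𝓘(ℝ, ℝ))
        (by exact (differentiableAt_id.const_mul ε).mdifferentiableAt)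
        ((hsm.contMDiffAt).mdifferentiableAt (by simp)), mder_eq_fderiv,
        fderiv_const_mul differentiableAt_fun_id]
      simp
    rw [h1, hmder, hdu]
    have h2 := hpar (one, p) (0, v) (1, 0)
    simp only [hone, coordChristoffel_zero_right, map_zero] at h2
    linarith
  · intro p v z
    rw [hdZ]
    have h2 := hpar (one, p) (0, v) (0, z)
    simp only [hone] at h2
    linear_combination h2 + (W (one, p)).1 * formAt 𝓘(ℝ, E) g p v z * hε2
  · intro p
    have h2 := (coneMetric_apply ε g (one, p) (W (one, p)) (W (one, p))).symm.trans (hnull (one, p))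
    simp [hone] at h2
    linear_combination h2 + ε * (W (one, p)).1 ^ 2 * hε2
  · intro r p
    rw [radialComponent_eq]
    exact congrArg (ε * ·) (hrad r p)

end ConeReduction

/-! ### A function with conformal gradient along geodesics. -/

section ConformalGradient

variable {E : Type*} [NormedAddCommGroup E] [NormedSpace ℝ E]
  {M : Type*} [TopologicalSpace M] [ChartedSpace E M] [IsManifold 𝓘(ℝ, E) ∞ M]

set_option synthInstance.maxHeartbeats 200000 in
theorem hasDerivAt_bilin {G : E → E →L[ℝ] E →L[ℝ] ℝ} {c a b : ℝ → E} {t : ℝ} {c' a' b' : E}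
    (hG : DifferentiableAt ℝ G (c t)) (hc : HasDerivAt c c' t) (ha : HasDerivAt a a' t)
    (hb : HasDerivAt b b' t) :
    HasDerivAt (fun s ↦ G (c s) (a s) (b s))
      (fderiv ℝ G (c t) c' (a t) (b t) + G (c t) a' (b t) + G (c t) (a t) b') t := by
  have h1 := HasFDerivAt.comp_hasDerivAt (l := G) (f := c) t hG.hasFDerivAt hc
  have h2 := HasDerivAt.clm_apply (c := G ∘ c) h1 ha
  have h3 := h2.clm_apply hb
  exact h3

theorem IsSemiRiemannian.formAt_symm {g : FormField 𝓘(ℝ, E) M} (hg : IsSemiRiemannian 𝓘(ℝ, E) g)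
    (x : M) (v w : E) : formAt 𝓘(ℝ, E) g x v w = formAt 𝓘(ℝ, E) g x w v :=
  hg.symm x v w

theorem chartForm_mder (g : FormField 𝓘(ℝ, E) M) {x q : M}
    (hq : q ∈ (extChartAt 𝓘(ℝ, E) x).source) (v w : E) :
    chartForm 𝓘(ℝ, E) g x (extChartAt 𝓘(ℝ, E) x q)
      (mder 𝓘(ℝ, E) 𝓘(ℝ, E) (extChartAt 𝓘(ℝ, E) x) q v)
      (mder 𝓘(ℝ, E) 𝓘(ℝ, E) (extChartAt 𝓘(ℝ, E) x) q w) = formAt 𝓘(ℝ, E) g q v w := by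
  rw [chartForm_eq_paramForm, paramForm_apply, mder_symm_mder_extChartAt hq,
    mder_symm_mder_extChartAt hq, (extChartAt 𝓘(ℝ, E) x).left_inv hq]

omit [IsManifold 𝓘(ℝ, E) ∞ M] in
theorem chartVec_extChartAt (Z : M → E) {x q : M} (hq : q ∈ (extChartAt 𝓘(ℝ, E) x).source) :
    chartVec Z x (extChartAt 𝓘(ℝ, E) x q) =
      mder 𝓘(ℝ, E) 𝓘(ℝ, E) (extChartAt 𝓘(ℝ, E) x) q (Z q) := by
  rw [chartVec, (extChartAt 𝓘(ℝ, E) x).left_inv hq]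

theorem chartVec_self (Z : M → E) (x : M) : chartVec Z x (extChartAt 𝓘(ℝ, E) x x) = Z x := by
  have : IsManifold 𝓘(ℝ, E) 1 M := .of_le (n := ∞) (by exact_mod_cast le_top)
  rw [chartVec_extChartAt Z (mem_extChartAt_source x), mder_extChartAt_self]
  rfl

theorem eventually_deriv_chart {γ : ℝ → M} {t : ℝ}
    (hγ : ContMDiffAt 𝓘(ℝ, ℝ) 𝓘(ℝ, E) 2 γ t) :
    ∀ᶠ s in nhds t,
      deriv (fun s ↦ extChartAt 𝓘(ℝ, E) (γ t) (γ s)) s =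
        mder 𝓘(ℝ, E) 𝓘(ℝ, E) (extChartAt 𝓘(ℝ, E) (γ t)) (γ s) (velocity γ s) ∧
      γ s ∈ (extChartAt 𝓘(ℝ, E) (γ t)).source := by
  filter_upwards [eventually_mdifferentiableAt (n := 2) (by norm_num) hγ,
    eventually_mem_extChartAt_source hγ.continuousAt
      (mem_extChartAt_source (I := 𝓘(ℝ, E)) (γ t))] with s h1 h2
  exact ⟨deriv_extChartAt_comp h1 h2, h2⟩

theorem hasDerivAt_chart {γ : ℝ → M} {t : ℝ} (hγ : ContMDiffAt 𝓘(ℝ, ℝ) 𝓘(ℝ, E) 2 γ t) :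
    HasDerivAt (fun s ↦ extChartAt 𝓘(ℝ, E) (γ t) (γ s)) (velocity γ t) t ∧
    HasDerivAt (deriv fun s ↦ extChartAt 𝓘(ℝ, E) (γ t) (γ s))
      (deriv (deriv fun s ↦ extChartAt 𝓘(ℝ, E) (γ t) (γ s)) t) t := by
  have hle : (2 : WithTop ℕ∞) ≤ ∞ := WithTop.coe_le_coe.2 le_top
  have h := contDiffAt_extChartAt_comp hle hγ (mem_extChartAt_source (γ t))
  constructor
  · rw [← deriv_extChartAt_comp_self (hγ.mdifferentiableAt (by simp))]
    exact (h.differentiableAt (by simp)).hasDerivAt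
  · exact ((h.derivWithin (m := 1) (by norm_num)).differentiableAt (by simp)).hasDerivAt

/-- The energy of a geodesic is constant. -/
theorem hasDerivAt_energy {g : FormField 𝓘(ℝ, E) M} (hg : IsSemiRiemannian 𝓘(ℝ, E) g)
    {γ : ℝ → M} {t : ℝ} (hγ : ContMDiffAt 𝓘(ℝ, ℝ) 𝓘(ℝ, E) 2 γ t) (hgeo : IsGeodesicAt g γ t) :
    HasDerivAt (fun s ↦ formAt 𝓘(ℝ, E) g (γ s) (velocity γ s) (velocity γ s)) 0 t := by
  obtain ⟨h1, h2⟩ := hasDerivAt_chart hγ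
  have hG := (hg.contDiffAt_chartForm (γ t)).differentiableAt (by simp)
  have h3 := hasDerivAt_bilin hG h1 h2 h2
  have e := deriv_extChartAt_comp_self (hγ.mdifferentiableAt (by simp))
  -- Tested against the velocity `v`, the Christoffel term is `½ ∂_v G(v, v)`, so the geodesic
  -- equation is half the derivative of the energy.
  have h4 := hgeo (velocity γ t)
  unfold geodesicDefect coordChristoffel at h4
  rw [e] at h4 h3
  refine (h3.congr_deriv ?_).congr_of_eventuallyEq ?_
  · have h5 := hg.paramForm_symm (extChartAt 𝓘(ℝ, E) (γ t)).symm (extChartAt 𝓘(ℝ, E) (γ t) (γ t))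
      (velocity γ t) (deriv (deriv fun s ↦ extChartAt 𝓘(ℝ, E) (γ t) (γ s)) t)
    rw [← chartForm_eq_paramForm] at h5
    rw [h5]
    linarith
  · filter_upwards [eventually_deriv_chart hγ] with s hs
    rw [hs.1, chartForm_mder g hs.2]

namespace IsConformalGradient

variable {ε : ℝ} {g : FormField 𝓘(ℝ, E) M} {u : M → ℝ} {Z : M → E}

omit [IsManifold 𝓘(ℝ, E) ∞ M] in
theorem hasDerivAt_comp (hu : IsConformalGradient ε g u Z) {γ : ℝ → M} {t : ℝ}
    (hγ : MDifferentiableAt 𝓘(ℝ, ℝ) 𝓘(ℝ, E) γ t) :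
    HasDerivAt (fun s ↦ u (γ s)) (formAt 𝓘(ℝ, E) g (γ t) (velocity γ t) (Z (γ t))) t := by
  have h1 : MDifferentiableAt 𝓘(ℝ, E) 𝓘(ℝ, ℝ) u (γ t) :=
    hu.contMDiff.contMDiffAt.mdifferentiableAt (by simp)
  have h2 : DifferentiableAt ℝ (fun s ↦ u (γ s)) t := (h1.comp t hγ).differentiableAt
  have h3 := h2.hasDerivAt
  rw [← fderiv_apply_one_eq_deriv, ← mder_eq_fderiv, mder_comp_apply h1 hγ, hu.mder_eq] at h3
  exact h3

/-- This is `u'' = Hess u(γ', γ')`. The derivative of `G(c', Z)` is the sum of the geodesic equation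
tested against `Z` and the covariant derivative of `Z` tested against `γ'`: the two Christoffel
symbols add up to the derivative of `G` along `γ'`. -/
theorem hasDerivAt_deriv_comp (hu : IsConformalGradient ε g u Z)
    (hg : IsSemiRiemannian 𝓘(ℝ, E) g) {γ : ℝ → M} {t : ℝ}
    (hγ : ContMDiffAt 𝓘(ℝ, ℝ) 𝓘(ℝ, E) 2 γ t) (hgeo : IsGeodesicAt g γ t) :
    HasDerivAt (fun s ↦ formAt 𝓘(ℝ, E) g (γ s) (velocity γ s) (Z (γ s)))
      (-ε * u (γ t) * formAt 𝓘(ℝ, E) g (γ t) (velocity γ t) (velocity γ t)) t := by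
  obtain ⟨h1, h2⟩ := hasDerivAt_chart hγ
  have hG := (hg.contDiffAt_chartForm (γ t)).differentiableAt (by simp)
  have hZ := ((hu.contDiffAt_chartVec (γ t)).differentiableAt
    (by simp)).hasFDerivAt.comp_hasDerivAt t h1
  have h3 := hasDerivAt_bilin hG h1 h2 hZ
  have e := deriv_extChartAt_comp_self (hγ.mdifferentiableAt (by simp))
  have h4 := hgeo (Z (γ t))
  have h6 := hu.covariant (γ t) (velocity γ t) (velocity γ t)
  unfold geodesicDefect coordChristoffel at h4
  unfold coordChristoffel at h6
  simp only [Function.comp_apply] at h3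
  rw [e] at h4 h3
  rw [chartVec_self] at h3
  have hs : ∀ᶠ y in nhds (extChartAt 𝓘(ℝ, E) (γ t) (γ t)), ∀ v w,
      chartForm 𝓘(ℝ, E) g (γ t) y v w = chartForm 𝓘(ℝ, E) g (γ t) y w v :=
    Filter.Eventually.of_forall fun y v w ↦ hg.paramForm_symm _ y v w
  have h7 := fderiv_bilin_symm hG hs
  refine (h3.congr_deriv ?_).congr_of_eventuallyEq ?_
  · rw [h7 (velocity γ t) (Z (γ t)) (velocity γ t)] at h6
    rw [chartForm_self] at h4 ⊢
    rw [chartForm_self]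
    rw [hg.formAt_symm] at h6
    linarith
  · filter_upwards [eventually_deriv_chart hγ] with s hs
    rw [hs.1, chartVec_extChartAt Z hs.2, chartForm_mder g hs.2]

end IsConformalGradient

end ConformalGradient

/-! ### The normalized gradient and its integral curves. -/

section UnitField

variable {E : Type*} [NormedAddCommGroup E] [NormedSpace ℝ E]
  {M : Type*} [TopologicalSpace M] [ChartedSpace E M]

/-- The normalized gradient `-ε u⁻¹ Z`. -/
def unitField (ε : ℝ) (u : M → ℝ) (Z : M → E) (q : M) : E := (-ε / u q) • Z q

theorem chartVec_smul (f : M → ℝ) (Z : M → E) (x : M) (y : E) :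
    chartVec (fun q ↦ f q • Z q) x y = f ((extChartAt 𝓘(ℝ, E) x).symm y) • chartVec Z x y :=
  map_smul _ _ _

theorem coordChristoffel_smul (G : E → E →L[ℝ] E →L[ℝ] ℝ) (y v w z : E) (a : ℝ) :
    coordChristoffel G y v (a • w) z = a * coordChristoffel G y v w z := by
  unfold coordChristoffel
  have h1 : fderiv ℝ G y v (a • w) z = a * fderiv ℝ G y v w z := by
    rw [map_smul]; rfl
  have h2 : fderiv ℝ G y (a • w) v z = a * fderiv ℝ G y w v z := by
    rw [(fderiv ℝ G y).map_smul a w]; rfl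
  have h3 : fderiv ℝ G y z v (a • w) = a * fderiv ℝ G y z v w := by
    rw [map_smul]; rfl
  rw [h1, h2, h3]
  ring

theorem velocity_congr {γ γ' : ℝ → M} {t : ℝ} (h : γ =ᶠ[nhds t] γ') :
    velocity γ t = (velocity γ' t : E) := by
  unfold velocity
  rw [mder_congr h]

theorem velocity_comp_add (γ : ℝ → M) (a t : ℝ)
    (hγ : MDifferentiableAt 𝓘(ℝ, ℝ) 𝓘(ℝ, E) γ (t + a)) :
    velocity (fun s ↦ γ (s + a)) t = (velocity γ (t + a) : E) := by
  have h : MDifferentiableAt 𝓘(ℝ, ℝ) 𝓘(ℝ, ℝ) (fun s : ℝ ↦ s + a) t :=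
    (differentiableAt_id.add_const a).mdifferentiableAt
  unfold velocity
  rw [mder_comp_apply (h := γ) (f := fun s ↦ s + a) hγ h, mder_eq_fderiv]
  congr 1
  simp

theorem IsConformalGradient.formAt_unitField {ε : ℝ} {g : FormField 𝓘(ℝ, E) M} {u : M → ℝ}
    {Z : M → E} (hu : IsConformalGradient ε g u Z) (hε : ε * ε = 1) {q : M} (hq : u q ≠ 0) :
    formAt 𝓘(ℝ, E) g q (unitField ε u Z q) (unitField ε u Z q) = -ε := by
  unfold unitField
  rw [map_smul, map_smul, smul_apply, hu.norm_sq, smul_eq_mul, smul_eq_mul]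
  field_simp
  linear_combination (-ε) * hε

theorem IsConformalGradient.formAt_unitField_left {ε : ℝ} {g : FormField 𝓘(ℝ, E) M} {u : M → ℝ}
    {Z : M → E} (hu : IsConformalGradient ε g u Z) (hε : ε * ε = 1) {q : M} (hq : u q ≠ 0) :
    formAt 𝓘(ℝ, E) g q (unitField ε u Z q) (Z q) = u q := by
  unfold unitField
  rw [map_smul, smul_apply, hu.norm_sq, smul_eq_mul]
  field_simp
  linear_combination hε

variable [IsManifold 𝓘(ℝ, E) ∞ M] {ε : ℝ} {g : FormField 𝓘(ℝ, E) M} {u : M → ℝ} {Z : M → E}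

theorem IsConformalGradient.contDiffAt_comp_symm (hu : IsConformalGradient ε g u Z) (x : M) :
    ContDiffAt ℝ ∞ (fun y ↦ u ((extChartAt 𝓘(ℝ, E) x).symm y)) (extChartAt 𝓘(ℝ, E) x x) := by
  rw [← contMDiffAt_iff_contDiffAt]
  exact hu.contMDiff.contMDiffAt.comp _
    (contMDiffAt_extChartAt_symm_of_mem le_rfl (mem_extChartAt_target x))

theorem IsConformalGradient.fderiv_comp_symm (hu : IsConformalGradient ε g u Z) (x : M) (v : E) :
    fderiv ℝ (fun y ↦ u ((extChartAt 𝓘(ℝ, E) x).symm y)) (extChartAt 𝓘(ℝ, E) x x) v =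
      formAt 𝓘(ℝ, E) g x v (Z x) := by
  rw [← mder_eq_fderiv, mder_comp (h := u) (hu.contMDiff.contMDiffAt.mdifferentiableAt (by simp))
    (mdifferentiableAt_extChartAt_symm (mem_extChartAt_target x)), mder_extChartAt_symm_self,
    extChartAt_to_inv, ← hu.mder_eq]
  rfl

theorem IsConformalGradient.contDiffAt_chartVec_unitField (hu : IsConformalGradient ε g u Z)
    {x : M} (hx : u x ≠ 0) :
    ContDiffAt ℝ ∞ (chartVec (unitField ε u Z) x) (extChartAt 𝓘(ℝ, E) x x) := by
  have h := (contDiffAt_const (c := -ε)).div (hu.contDiffAt_comp_symm x)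
    (by rwa [extChartAt_to_inv])
  exact (h.smul (hu.contDiffAt_chartVec x)).congr_of_eventuallyEq
    (Filter.Eventually.of_forall fun y ↦ chartVec_smul _ Z x y)

/-- The covariant derivative of the normalized gradient. -/
theorem IsConformalGradient.covariant_unitField (hu : IsConformalGradient ε g u Z)
    (hε : ε * ε = 1) {x : M} (hx : u x ≠ 0) (v z : E) :
    formAt 𝓘(ℝ, E) g x (fderiv ℝ (chartVec (unitField ε u Z) x) (extChartAt 𝓘(ℝ, E) x x) v) z
      + coordChristoffel (chartForm 𝓘(ℝ, E) g x) (extChartAt 𝓘(ℝ, E) x x) v (unitField ε u Z x) z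
    = formAt 𝓘(ℝ, E) g x v z
      - formAt 𝓘(ℝ, E) g x v (Z x) / u x * formAt 𝓘(ℝ, E) g x (unitField ε u Z x) z := by
  have e : chartVec (unitField ε u Z) x = fun y ↦
      (-ε / u ((extChartAt 𝓘(ℝ, E) x).symm y)) • chartVec Z x y :=
    funext fun y ↦ chartVec_smul _ Z x y
  have h1 := ((hu.contDiffAt_comp_symm x).differentiableAt (by simp)).hasFDerivAt
  have h0 : HasDerivAt (fun s : ℝ ↦ -ε / s) (ε / u x ^ 2)
      (u ((extChartAt 𝓘(ℝ, E) x).symm (extChartAt 𝓘(ℝ, E) x x))) := by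
    rw [extChartAt_to_inv]
    refine ((hasDerivAt_inv hx).const_mul (-ε)).congr_deriv ?_
    field_simp
  have h2 := HasDerivAt.comp_hasFDerivAt (f := fun y ↦ u ((extChartAt 𝓘(ℝ, E) x).symm y))
    (extChartAt 𝓘(ℝ, E) x x) h0 h1
  have h3 := h2.smul ((hu.contDiffAt_chartVec x).differentiableAt (by simp)).hasFDerivAt
  have h4 : fderiv ℝ (chartVec (unitField ε u Z) x) (extChartAt 𝓘(ℝ, E) x x) v =
      (-ε / u x) • fderiv ℝ (chartVec Z x) (extChartAt 𝓘(ℝ, E) x x) v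
        + (ε * formAt 𝓘(ℝ, E) g x v (Z x) / u x ^ 2) • Z x := by
    rw [e]
    refine (congrArg (fun L ↦ L v) h3.fderiv).trans ?_
    rw [← hu.fderiv_comp_symm]
    simp only [add_apply, smul_apply, ContinuousLinearMap.smulRight_apply, Function.comp_apply,
      extChartAt_to_inv, chartVec_self, smul_eq_mul]
    congr 2
    ring
  have h5 := hu.covariant x v z
  rw [h4]
  unfold unitField
  rw [coordChristoffel_smul, map_add, add_apply, map_smul, map_smul, map_smul, smul_apply,
    smul_apply, smul_apply, smul_eq_mul, smul_eq_mul, smul_eq_mul]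
  field_simp
  linear_combination (-ε * u x) * h5 + u x ^ 2 * formAt 𝓘(ℝ, E) g x v z * hε

/-- Integral curves of the normalized gradient are geodesics. -/
theorem IsConformalGradient.isGeodesicAt (hu : IsConformalGradient ε g u Z)
    (hε : ε * ε = 1) {γ : ℝ → M} {t : ℝ} (hγ : ContMDiffAt 𝓘(ℝ, ℝ) 𝓘(ℝ, E) 2 γ t)
    (ht : u (γ t) ≠ 0) (h : ∀ᶠ s in nhds t, velocity γ s = unitField ε u Z (γ s)) :
    IsGeodesicAt g γ t := by
  intro z
  have h1 := (hasDerivAt_chart hγ).1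
  have h2 : deriv (fun s ↦ extChartAt 𝓘(ℝ, E) (γ t) (γ s)) =ᶠ[nhds t]
      fun s ↦ chartVec (unitField ε u Z) (γ t) (extChartAt 𝓘(ℝ, E) (γ t) (γ s)) := by
    filter_upwards [h, eventually_deriv_chart hγ] with s hs hs'
    rw [hs'.1, hs, chartVec_extChartAt _ hs'.2]
  have h3 := (((hu.contDiffAt_chartVec_unitField ht).differentiableAt
    (by simp)).hasFDerivAt.comp_hasDerivAt t h1).deriv
  have h4 : deriv (deriv (fun s ↦ extChartAt 𝓘(ℝ, E) (γ t) (γ s))) t =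
      fderiv ℝ (chartVec (unitField ε u Z) (γ t)) (extChartAt 𝓘(ℝ, E) (γ t) (γ t))
        (velocity γ t) := h2.deriv_eq.trans h3
  -- For `v = T` one has `du(T) / u = 1`, so the covariant derivative is `T - T = 0`.
  have h5 := hu.covariant_unitField hε ht (unitField ε u Z (γ t)) z
  rw [hu.formAt_unitField_left hε ht, div_self ht, one_mul, sub_self] at h5
  unfold geodesicDefect
  rw [h4, h1.deriv, h.self_of_nhds, chartForm_self]
  exact h5

end UnitField

/-! ### The flow of the normalized gradient, built from complete geodesics. -/

section GeodesicFlow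

variable {E : Type*} [NormedAddCommGroup E] [NormedSpace ℝ E]
  {M : Type*} [TopologicalSpace M] [ChartedSpace E M]

/-- The difference `k - w` solves `y' = -y` and vanishes at `0`. Hence `k = w`, and `w' = w`. -/
theorem eq_exp_of_hasDerivAt {w k : ℝ → ℝ} (hw : ∀ t, HasDerivAt w (k t) t)
    (hk : ∀ t, HasDerivAt k (w t) t) (h0 : k 0 = w 0) (t : ℝ) : w t = w 0 * Real.exp t := by
  have h1 : ∀ t, HasDerivAt (fun t ↦ (k t - w t) * Real.exp t) 0 t := fun t ↦
    (((hk t).sub (hw t)).mul (Real.hasDerivAt_exp t)).congr_deriv (by simp; ring)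
  have h2 : ∀ t, k t = w t := by
    intro t
    have := is_const_of_deriv_eq_zero (fun t ↦ (h1 t).differentiableAt) (fun t ↦ (h1 t).deriv) t 0
    simp only [h0, sub_self, zero_mul, mul_eq_zero, Real.exp_ne_zero, or_false] at this
    linarith
  have h3 : ∀ t, HasDerivAt (fun t ↦ w t * Real.exp (-t)) 0 t := fun t ↦
    ((hw t).mul ((Real.hasDerivAt_exp (-t)).comp t (hasDerivAt_neg t))).congr_deriv
      (by rw [h2]; simp)
  have := is_const_of_deriv_eq_zero (fun t ↦ (h3 t).differentiableAt) (fun t ↦ (h3 t).deriv) t 0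
  simp only [neg_zero, Real.exp_zero, mul_one] at this
  rw [← this, mul_assoc, ← Real.exp_add]
  simp

/-- The curves `t ↦ θ t q` are the geodesics with initial velocity given by the field `T`. -/
structure IsGeodesicFlow (g : FormField 𝓘(ℝ, E) M) (T : M → E) (θ : ℝ → M → M) : Prop where
  contMDiff : ∀ q, ContMDiff 𝓘(ℝ, ℝ) 𝓘(ℝ, E) ∞ (fun t ↦ θ t q)
  geodesic : ∀ q t, IsGeodesicAt g (fun t ↦ θ t q) t
  zero : ∀ q, θ 0 q = q
  velocity_zero : ∀ q, velocity (fun t ↦ θ t q) 0 = T q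

theorem exists_geodesic_of_complete {g : FormField 𝓘(ℝ, E) M}
    (h : IsGeodesicallyComplete 𝓘(ℝ, E) g) (q : M) (v : E) :
    ∃ γ : ℝ → M, ContMDiff 𝓘(ℝ, ℝ) 𝓘(ℝ, E) ∞ γ ∧ (∀ t, IsGeodesicAt g γ t) ∧ γ 0 = q ∧
      velocity γ 0 = v := by
  obtain ⟨γ, h1, h2⟩ := h ⟨q, v⟩
  refine ⟨γ, h1.1, h1.2, congrArg TotalSpace.proj h2, ?_⟩
  exact congrArg (fun ξ : TangentBundle 𝓘(ℝ, E) M ↦ (show E from ξ.2)) h2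

/-- The geodesics are chosen point by point, so nothing is known yet about their dependence on `q`.
At zeros of `u` the field `unitField` is `0` by the convention for division; the flow is used only
off these zeros. -/
theorem exists_isGeodesicFlow {g : FormField 𝓘(ℝ, E) M}
    (h : IsGeodesicallyComplete 𝓘(ℝ, E) g) (T : M → E) : ∃ θ, IsGeodesicFlow g T θ := by
  choose γ h1 h2 h3 h4 using fun q ↦ exists_geodesic_of_complete h q (T q)
  exact ⟨fun t q ↦ γ q t, h1, h2, h3, h4⟩

theorem IsGeodesicAt.comp_add {g : FormField 𝓘(ℝ, E) M} {γ : ℝ → M} {t a : ℝ}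
    (h : IsGeodesicAt g γ (t + a)) : IsGeodesicAt g (fun s ↦ γ (s + a)) t := by
  intro z
  have h1 := h z
  unfold geodesicDefect at *
  have e : deriv (fun s ↦ extChartAt 𝓘(ℝ, E) (γ (t + a)) (γ (s + a))) =
      fun s ↦ deriv (fun s ↦ extChartAt 𝓘(ℝ, E) (γ (t + a)) (γ s)) (s + a) :=
    funext fun s ↦ deriv_comp_add_const (f := fun s ↦ extChartAt 𝓘(ℝ, E) (γ (t + a)) (γ s)) a s
  rw [e]
  rw [deriv_comp_add_const (f := deriv fun s ↦ extChartAt 𝓘(ℝ, E) (γ (t + a)) (γ s)) a t]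
  exact h1

theorem contMDiffAt_comp_add {γ : ℝ → M} {t a : ℝ} {n : WithTop ℕ∞}
    (h : ContMDiffAt 𝓘(ℝ, ℝ) 𝓘(ℝ, E) n γ (t + a)) :
    ContMDiffAt 𝓘(ℝ, ℝ) 𝓘(ℝ, E) n (fun s ↦ γ (s + a)) t :=
  ContMDiffAt.comp (g := γ) (f := fun s : ℝ ↦ s + a) t h
    (contDiff_id.add contDiff_const).contMDiff.contMDiffAt

variable [IsManifold 𝓘(ℝ, E) ∞ M] {ε : ℝ} {g : FormField 𝓘(ℝ, E) M} {u : M → ℝ} {Z : M → E}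
  {θ : ℝ → M → M}

namespace IsGeodesicFlow

/-- The energy stays equal to `g(T, T) = -ε`, so `u'' = u` along the curve, and `u'(0) = g(T, Z) =
u(0)`. This is what prevents the curve from meeting `{u = 0}`. -/
theorem apply_eq_mul_exp (hθ : IsGeodesicFlow g (unitField ε u Z) θ)
    (hg : IsSemiRiemannian 𝓘(ℝ, E) g) (hu : IsConformalGradient ε g u Z) (hε : ε * ε = 1)
    {q : M} (hq : u q ≠ 0) (t : ℝ) : u (θ t q) = u q * Real.exp t := by
  have hle : (2 : WithTop ℕ∞) ≤ ∞ := WithTop.coe_le_coe.2 le_top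
  have hc : ∀ t, ContMDiffAt 𝓘(ℝ, ℝ) 𝓘(ℝ, E) 2 (fun t ↦ θ t q) t := fun t ↦
    ((hθ.contMDiff q).contMDiffAt).of_le hle
  have he := fun t ↦ hasDerivAt_energy hg (hc t) (hθ.geodesic q t)
  have he' : ∀ t, formAt 𝓘(ℝ, E) g (θ t q) (velocity (fun t ↦ θ t q) t)
      (velocity (fun t ↦ θ t q) t) = -ε := by
    intro t
    have := is_const_of_deriv_eq_zero (fun t ↦ (he t).differentiableAt) (fun t ↦ (he t).deriv) t 0
    rw [this, hθ.velocity_zero, hθ.zero, hu.formAt_unitField hε hq]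
  have h := eq_exp_of_hasDerivAt
    (fun t ↦ hu.hasDerivAt_comp ((hc t).mdifferentiableAt (by simp)))
    (fun t ↦ (hu.hasDerivAt_deriv_comp hg (hc t) (hθ.geodesic q t)).congr_deriv (by
      rw [he']; linear_combination u (θ t q) * hε))
    (by rw [hθ.velocity_zero, hθ.zero, hu.formAt_unitField_left hε hq]) t
  rw [h, hθ.zero]

variable [FiniteDimensional ℝ E] [T2Space M]

/-- Near time zero the geodesic flow is the local flow of the field. -/
theorem local_flow (hθ : IsGeodesicFlow g (unitField ε u Z) θ) (hg : IsSemiRiemannian 𝓘(ℝ, E) g)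
    (hu : IsConformalGradient ε g u Z) (hε : ε * ε = 1) {p : M} (hp : u p ≠ 0) (n : ℕ) :
    (∀ᶠ t in nhds 0, velocity (fun t ↦ θ t p) t = unitField ε u Z (θ t p)) ∧
    ContMDiffAt (𝓘(ℝ, ℝ).prod 𝓘(ℝ, E)) 𝓘(ℝ, E) n (fun x : ℝ × M ↦ θ x.1 x.2) (0, p) := by
  have hle : (2 : WithTop ℕ∞) ≤ ∞ := WithTop.coe_le_coe.2 le_top
  have hopen : {y | y ∈ (extChartAt 𝓘(ℝ, E) p).target ∧ u ((extChartAt 𝓘(ℝ, E) p).symm y) ≠ 0} ∈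
      nhds (extChartAt 𝓘(ℝ, E) p p) := by
    refine Filter.inter_mem
      ((isOpen_extChartAt_target p).mem_nhds (mem_extChartAt_target p)) ?_
    exact (hu.contDiffAt_comp_symm p).continuousAt.eventually_ne (by rwa [extChartAt_to_inv])
  obtain ⟨a, ha, hball⟩ := Metric.mem_nhds_iff.1 hopen
  -- Two extra derivatives make the integral curves of class `C²` even for `n = 0`, as the geodesic
  -- equation demands.
  obtain ⟨δ, hδ, r, hr, α, hα, hα'⟩ := exists_contDiffOn_localFlow (n + 2)
    (hu.contDiffAt_chartVec_unitField hp) ha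
  have hprod : IsOpen (Ioo (-δ) δ ×ˢ Metric.ball (extChartAt 𝓘(ℝ, E) p p) r) :=
    isOpen_Ioo.prod Metric.isOpen_ball
  have hnle : ((n + 2 : ℕ) : WithTop ℕ∞) ≤ ∞ :=
    WithTop.coe_le_coe.2 (le_top (a := ((n + 2 : ℕ) : ℕ∞)))
  have h2le : (2 : WithTop ℕ∞) ≤ ((n + 2 : ℕ) : WithTop ℕ∞) := by
    push_cast; exact le_add_self
  have hβ : ∀ y ∈ Metric.ball (extChartAt 𝓘(ℝ, E) p p) r, ∀ t ∈ Ioo (-δ) δ,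
      ContMDiffAt 𝓘(ℝ, ℝ) 𝓘(ℝ, E) 2 (fun s ↦ (extChartAt 𝓘(ℝ, E) p).symm (α s y)) t ∧
      velocity (fun s ↦ (extChartAt 𝓘(ℝ, E) p).symm (α s y)) t =
        unitField ε u Z ((extChartAt 𝓘(ℝ, E) p).symm (α t y)) := by
    intro y hy t ht
    obtain ⟨h1, h2⟩ := (hα' y hy).2 t ht
    have h3 := hball h1
    constructor
    · have h4 : ContDiffAt ℝ 2 (fun s ↦ α s y) t :=
        ContDiffAt.comp (g := fun q : ℝ × E ↦ α q.1 q.2) (f := fun s ↦ (s, y)) t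
          ((hα.contDiffAt (hprod.mem_nhds ⟨ht, hy⟩)).of_le h2le)
          (contDiffAt_id.prodMk contDiffAt_const)
      exact ContMDiffAt.comp (f := fun s ↦ α s y) t
        (contMDiffAt_extChartAt_symm_of_mem hle h3.1) h4.contMDiffAt
    · unfold velocity
      rw [mder_comp_apply (f := fun s ↦ α s y) (mdifferentiableAt_extChartAt_symm h3.1)
        h2.differentiableAt.mdifferentiableAt, mder_eq_fderiv, fderiv_apply_one_eq_deriv,
        h2.deriv, chartVec]
      have h5 := mder_symm_mder_extChartAt ((extChartAt 𝓘(ℝ, E) p).map_target h3.1)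
      rw [(extChartAt 𝓘(ℝ, E) p).right_inv h3.1] at h5
      exact h5 _
  -- Integral curves of the field are geodesics, so uniqueness identifies them with the chosen ones
  -- for all `q` near `p` at once. Regularity in `q` is thereby inherited from the local flow.
  have heq : ∀ q ∈ (extChartAt 𝓘(ℝ, E) p).source,
      extChartAt 𝓘(ℝ, E) p q ∈ Metric.ball (extChartAt 𝓘(ℝ, E) p p) r →
      EqOn (fun t ↦ θ t q)
        (fun t ↦ (extChartAt 𝓘(ℝ, E) p).symm (α t (extChartAt 𝓘(ℝ, E) p q))) (Ioo (-δ) δ) := by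
    intro q hq hqb
    have h0 : (0 : ℝ) ∈ Ioo (-δ) δ := ⟨by linarith, hδ⟩
    have h00 : (extChartAt 𝓘(ℝ, E) p).symm (α 0 (extChartAt 𝓘(ℝ, E) p q)) = q := by
      rw [(hα' _ hqb).1, (extChartAt 𝓘(ℝ, E) p).left_inv hq]
    refine geodesic_eqOn hg isOpen_Ioo isPreconnected_Ioo h0
      (fun t _ ↦ ⟨((hθ.contMDiff q).contMDiffAt).of_le hle, hθ.geodesic q t⟩)
      (fun t ht ↦ ⟨(hβ _ hqb t ht).1, ?_⟩) ?_ ?_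
    · refine hu.isGeodesicAt hε (hβ _ hqb t ht).1 (hball ((hα' _ hqb).2 t ht).1).2 ?_
      filter_upwards [isOpen_Ioo.mem_nhds ht] with s hs using (hβ _ hqb s hs).2
    · rw [hθ.zero, h00]
    · rw [hθ.velocity_zero, (hβ _ hqb 0 h0).2, h00]
  have hI : Ioo (-δ) δ ∈ nhds (0 : ℝ) := Ioo_mem_nhds (by linarith) hδ
  constructor
  · have h1 := heq p (mem_extChartAt_source p) (Metric.mem_ball_self hr)
    filter_upwards [hI] with t ht
    rw [velocity_congr (h1.eventuallyEq_of_mem (isOpen_Ioo.mem_nhds ht)),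
      (hβ _ (Metric.mem_ball_self hr) t ht).2]
    congr 1
    exact (h1 ht).symm
  · have hN : ∀ᶠ q in nhds p, q ∈ (extChartAt 𝓘(ℝ, E) p).source ∧
        extChartAt 𝓘(ℝ, E) p q ∈ Metric.ball (extChartAt 𝓘(ℝ, E) p p) r :=
      Filter.Eventually.and ((isOpen_extChartAt_source p).mem_nhds (mem_extChartAt_source p))
        ((continuousAt_extChartAt p).eventually_mem (Metric.ball_mem_nhds _ hr))
    have h1 : (fun x : ℝ × M ↦ θ x.1 x.2) =ᶠ[nhds (0, p)] fun x ↦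
        (extChartAt 𝓘(ℝ, E) p).symm (α x.1 (extChartAt 𝓘(ℝ, E) p x.2)) := by
      rw [nhds_prod_eq]
      filter_upwards [Filter.prod_mem_prod hI hN] with x hx
      exact heq x.2 hx.2.1 hx.2.2 hx.1
    refine ContMDiffAt.congr_of_eventuallyEq ?_ h1
    have h2 : ContMDiffAt (𝓘(ℝ, ℝ).prod 𝓘(ℝ, E)) 𝓘(ℝ, ℝ × E) ((n + 2 : ℕ) : WithTop ℕ∞)
        (fun x : ℝ × M ↦ (x.1, extChartAt 𝓘(ℝ, E) p x.2)) (0, p) :=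
      contMDiffAt_fst.prodMk_space (ContMDiffAt.comp (g := extChartAt 𝓘(ℝ, E) p) (0, p)
        (contMDiffAt_extChartAt_of_mem hnle (mem_extChartAt_source p)) contMDiffAt_snd)
    have h3 : ContMDiffAt 𝓘(ℝ, ℝ × E) 𝓘(ℝ, E) ((n + 2 : ℕ) : WithTop ℕ∞)
        (fun q : ℝ × E ↦ α q.1 q.2) (0, extChartAt 𝓘(ℝ, E) p p) :=
      (hα.contDiffAt (hprod.mem_nhds
        ⟨⟨by linarith, hδ⟩, Metric.mem_ball_self hr⟩)).contMDiffAt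
    have h4 := contMDiffAt_extChartAt_symm_of_mem hnle
      (hball ((hα' _ (Metric.mem_ball_self hr)).2 0 ⟨by linarith, hδ⟩).1).1
    exact (ContMDiffAt.comp (f := fun x : ℝ × M ↦ α x.1 (extChartAt 𝓘(ℝ, E) p x.2)) (0, p) h4
      (ContMDiffAt.comp (0, p) h3 h2)).of_le (by exact_mod_cast Nat.le_add_right n 2)

/-- Both sides are geodesics in `s`. They have the same position and, by the assumption on the
velocity at time `t`, the same velocity at `s = 0`. -/
theorem add_of_velocity (hθ : IsGeodesicFlow g (unitField ε u Z) θ)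
    (hg : IsSemiRiemannian 𝓘(ℝ, E) g) {q : M} {t : ℝ}
    (h : velocity (fun t ↦ θ t q) t = unitField ε u Z (θ t q)) (s : ℝ) :
    θ (s + t) q = θ s (θ t q) := by
  have hle : (2 : WithTop ℕ∞) ≤ ∞ := WithTop.coe_le_coe.2 le_top
  refine geodesic_eqOn hg (γ := fun s ↦ θ (s + t) q) (γ' := fun s ↦ θ s (θ t q)) (J := univ)
    (t₀ := 0) isOpen_univ isPreconnected_univ (mem_univ _)
    (fun s _ ↦ ⟨contMDiffAt_comp_add (γ := fun t ↦ θ t q)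
      (((hθ.contMDiff q).contMDiffAt).of_le hle),
      IsGeodesicAt.comp_add (γ := fun t ↦ θ t q) (hθ.geodesic q (s + t))⟩)
    (fun s _ ↦ ⟨((hθ.contMDiff _).contMDiffAt).of_le hle, hθ.geodesic _ s⟩) ?_ ?_ (mem_univ s)
  · simp [hθ.zero]
  · rw [velocity_comp_add (fun t ↦ θ t q) t 0
      ((hθ.contMDiff q).contMDiffAt.mdifferentiableAt (by simp)), hθ.velocity_zero, zero_add, h]

/-- The geodesic flow is the flow of the field. -/
theorem velocity_eq (hθ : IsGeodesicFlow g (unitField ε u Z) θ) (hg : IsSemiRiemannian 𝓘(ℝ, E) g)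
    (hu : IsConformalGradient ε g u Z) (hε : ε * ε = 1) {q : M} (hq : u q ≠ 0) (t : ℝ) :
    velocity (fun t ↦ θ t q) t = unitField ε u Z (θ t q) := by
  have hne : ∀ t, u (θ t q) ≠ 0 := fun t ↦ by
    rw [hθ.apply_eq_mul_exp hg hu hε hq]
    exact mul_ne_zero hq (Real.exp_ne_zero t)
  have hle : (2 : WithTop ℕ∞) ≤ ∞ := WithTop.coe_le_coe.2 le_top
  have hc : ∀ t, ContMDiffAt 𝓘(ℝ, ℝ) 𝓘(ℝ, E) 2 (fun t ↦ θ t q) t := fun t ↦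
    ((hθ.contMDiff q).contMDiffAt).of_le hle
  -- Closed by continuity of both sides in a chart. Open because, by `add_of_velocity`, the curve
  -- continues past such a time as the curve started at `θ t₀ q`, which follows the field for small
  -- times.
  have hclopen : IsClopen {t | velocity (fun t ↦ θ t q) t = unitField ε u Z (θ t q)} := by
    constructor
    · refine isClosed_of_closure_subset fun t ht ↦ ?_
      have hfreq := mem_closure_iff_frequently.1 ht
      have h1 := eventually_deriv_chart (hc t)
      have h2 : ∃ᶠ s in nhds t, deriv (fun s ↦ extChartAt 𝓘(ℝ, E) (θ t q) (θ s q)) s =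
          chartVec (unitField ε u Z) (θ t q) (extChartAt 𝓘(ℝ, E) (θ t q) (θ s q)) := by
        refine (hfreq.and_eventually h1).mono fun s hs ↦ ?_
        rw [hs.2.1, chartVec_extChartAt _ hs.2.2]
        exact congrArg _ hs.1
      have h3 := (hasDerivAt_chart (hc t)).2.continuousAt
      have h4 : ContinuousAt (fun s ↦ chartVec (unitField ε u Z) (θ t q)
          (extChartAt 𝓘(ℝ, E) (θ t q) (θ s q))) t :=
        ContinuousAt.comp (f := fun s ↦ extChartAt 𝓘(ℝ, E) (θ t q) (θ s q))
          (hu.contDiffAt_chartVec_unitField (hne t)).continuousAt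
          (hasDerivAt_chart (hc t)).1.continuousAt
      have hcl : IsClosed {p : E × E | p.1 = p.2} := isClosed_diagonal
      have h5 : deriv (fun s ↦ extChartAt 𝓘(ℝ, E) (θ t q) (θ s q)) t =
          chartVec (unitField ε u Z) (θ t q) (extChartAt 𝓘(ℝ, E) (θ t q) (θ t q)) :=
        hcl.mem_of_frequently_of_tendsto h2 (Filter.Tendsto.prodMk_nhds h3 h4)
      rw [chartVec_self] at h5
      exact (hasDerivAt_chart (hc t)).1.deriv.symm.trans h5
    · rw [isOpen_iff_mem_nhds]
      intro t₀ ht₀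
      have hadd := hθ.add_of_velocity hg ht₀
      have h1 := (hθ.local_flow hg hu hε (hne t₀) 0).1
      have h2 : Filter.Tendsto (fun t ↦ t - t₀) (nhds t₀) (nhds 0) := by
        have : ContinuousAt (fun t ↦ t - t₀) t₀ := by fun_prop
        simpa [ContinuousAt] using this
      filter_upwards [h2.eventually h1] with t ht
      have e : (fun s ↦ θ (s + t₀) q) = fun s ↦ θ s (θ t₀ q) := funext hadd
      rw [← e, velocity_comp_add (fun t ↦ θ t q) t₀ (t - t₀)
        ((hθ.contMDiff q).contMDiffAt.mdifferentiableAt (by simp)), ← hadd, sub_add_cancel] at ht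
      exact ht
  have h0 : (0 : ℝ) ∈ {t | velocity (fun t ↦ θ t q) t = unitField ε u Z (θ t q)} := by
    change velocity (fun t ↦ θ t q) 0 = _
    rw [hθ.velocity_zero, hθ.zero]
  exact eq_univ_iff_forall.1 (hclopen.eq_univ ⟨0, h0⟩) t

theorem add (hθ : IsGeodesicFlow g (unitField ε u Z) θ) (hg : IsSemiRiemannian 𝓘(ℝ, E) g)
    (hu : IsConformalGradient ε g u Z) (hε : ε * ε = 1) {q : M} (hq : u q ≠ 0) (s t : ℝ) :
    θ (s + t) q = θ s (θ t q) :=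
  hθ.add_of_velocity hg (hθ.velocity_eq hg hu hε hq t) s

/-- The geodesic flow is smooth. -/
theorem contMDiffAt (hθ : IsGeodesicFlow g (unitField ε u Z) θ) (hg : IsSemiRiemannian 𝓘(ℝ, E) g)
    (hu : IsConformalGradient ε g u Z) (hε : ε * ε = 1) {q : M} (hq : u q ≠ 0) (t : ℝ) :
    ContMDiffAt (𝓘(ℝ, ℝ).prod 𝓘(ℝ, E)) 𝓘(ℝ, E) ∞ (fun x : ℝ × M ↦ θ x.1 x.2) (t, q) := by
  rw [contMDiffAt_infty]
  intro n
  have hnle : (n : WithTop ℕ∞) ≤ ∞ := WithTop.coe_le_coe.2 (le_top (a := (n : ℕ∞)))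
  have : IsManifold 𝓘(ℝ, E) n M := .of_le hnle
  have hne : ∀ t, u (θ t q) ≠ 0 := fun t ↦ by
    rw [hθ.apply_eq_mul_exp hg hu hε hq]
    exact mul_ne_zero hq (Real.exp_ne_zero t)
  have hev : ∀ x : ℝ × M, ContMDiffAt (𝓘(ℝ, ℝ).prod 𝓘(ℝ, E)) 𝓘(ℝ, E) n
      (fun x : ℝ × M ↦ θ x.1 x.2) x → ∀ᶠ y in nhds x,
      ContMDiffAt (𝓘(ℝ, ℝ).prod 𝓘(ℝ, E)) 𝓘(ℝ, E) n (fun x : ℝ × M ↦ θ x.1 x.2) y := fun x hx ↦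
    (contMDiffAt_iff_contMDiffAt_nhds (by simp)).1 hx
  have hcont : Continuous (fun t ↦ θ t q) := (hθ.contMDiff q).continuous
  have hopen : IsOpen {y | u y ≠ 0} := isOpen_ne_fun hu.contMDiff.continuous continuous_const
  -- For closedness, choose `s` in the set so near `t` that `θ` is `Cⁿ` at `(t - s, θ s q)`, and
  -- factor `θ r = θ (r - s) ∘ θ s` for `r` near `t`.
  have hclopen : IsClopen {t | ContMDiffAt (𝓘(ℝ, ℝ).prod 𝓘(ℝ, E)) 𝓘(ℝ, E) n
      (fun x : ℝ × M ↦ θ x.1 x.2) (t, q)} := by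
    constructor
    · refine isClosed_of_closure_subset fun t ht ↦ ?_
      have h1 := hev _ (hθ.local_flow hg hu hε (hne t) n).2
      have h2 : ContinuousAt (fun s ↦ (t - s, θ s q)) t :=
        (by fun_prop : ContinuousAt (fun s ↦ t - s) t).prodMk_nhds hcont.continuousAt
      have h3 := h2.eventually (p := fun y ↦ ContMDiffAt (𝓘(ℝ, ℝ).prod 𝓘(ℝ, E)) 𝓘(ℝ, E) n
        (fun x : ℝ × M ↦ θ x.1 x.2) y) (by simpa using h1)
      obtain ⟨s, hs1, hs2⟩ := ((mem_closure_iff_frequently.1 ht).and_eventually h3).exists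
      have h4 : ContMDiffAt 𝓘(ℝ, E) 𝓘(ℝ, E) n (fun y ↦ θ s y) q :=
        ContMDiffAt.comp (g := fun x : ℝ × M ↦ θ x.1 x.2) q hs1
          (contMDiffAt_const.prodMk contMDiffAt_id)
      have h5 : ContMDiffAt (𝓘(ℝ, ℝ).prod 𝓘(ℝ, E)) 𝓘(ℝ, E) n
          (fun x : ℝ × M ↦ θ (x.1 - s) (θ s x.2)) (t, q) := by
        refine ContMDiffAt.comp (g := fun x : ℝ × M ↦ θ x.1 x.2)
          (f := fun x : ℝ × M ↦ (x.1 - s, θ s x.2)) (t, q) hs2 ?_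
        refine ContMDiffAt.prodMk ?_ (ContMDiffAt.comp (g := fun y ↦ θ s y) (t, q) h4
          contMDiffAt_snd)
        exact ContMDiffAt.comp (g := fun r : ℝ ↦ r - s) (t, q)
          (contDiff_id.sub contDiff_const).contMDiff.contMDiffAt contMDiffAt_fst
      refine h5.congr_of_eventuallyEq ?_
      filter_upwards [continuous_snd.continuousAt.preimage_mem_nhds (hopen.mem_nhds hq)] with x hx
      rw [← hθ.add hg hu hε hx, sub_add_cancel]
    · rw [isOpen_iff_mem_nhds]
      intro t ht
      have h2 : ContinuousAt (fun s : ℝ ↦ (s, q)) t := by fun_prop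
      exact h2.eventually (hev _ ht)
  exact eq_univ_iff_forall.1 (hclopen.eq_univ ⟨0, (hθ.local_flow hg hu hε hq n).2⟩) t

end IsGeodesicFlow

end GeodesicFlow

/-! ### Straightening a function at a regular point. -/

section Straightening

variable {E : Type*} [NormedAddCommGroup E] [NormedSpace ℝ E] [FiniteDimensional ℝ E]
  {E' : Type*} [NormedAddCommGroup E'] [NormedSpace ℝ E'] [FiniteDimensional ℝ E']

theorem finrank_ker_of_ne_zero {L : E →L[ℝ] ℝ} (hL : L ≠ 0) :
    Module.finrank ℝ (LinearMap.ker (L : E →ₗ[ℝ] ℝ)) + 1 = Module.finrank ℝ E := by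
  have h1 := LinearMap.finrank_range_add_finrank_ker (L : E →ₗ[ℝ] ℝ)
  have h2 : (L : E →ₗ[ℝ] ℝ) ≠ 0 := fun h ↦ hL (by ext v; exact congrArg (fun f ↦ f v) h)
  have h3 : LinearMap.range (L : E →ₗ[ℝ] ℝ) = ⊤ := LinearMap.range_eq_top.2
    (LinearMap.surjective_iff_ne_zero.2 h2)
  rw [h3, finrank_top, Module.finrank_self] at h1
  omega

/-- A nonzero linear form is the first component of an isomorphism with a product. -/
theorem exists_equiv_prod_fst {L : E →L[ℝ] ℝ} (hL : L ≠ 0)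
    (hd : Module.finrank ℝ E' = Module.finrank ℝ E - 1) :
    ∃ e : E ≃L[ℝ] ℝ × E', ∀ v, (e v).1 = L v := by
  have hk := finrank_ker_of_ne_zero hL
  obtain ⟨w, hw⟩ : ∃ w, L w = 1 := by
    obtain ⟨v, hv⟩ : ∃ v, L v ≠ 0 := by
      by_contra! h
      exact hL (by ext v; simpa using h v)
    exact ⟨(L v)⁻¹ • v, by simp [hv]⟩
  let κ : LinearMap.ker (L : E →ₗ[ℝ] ℝ) ≃ₗ[ℝ] E' := LinearEquiv.ofFinrankEq _ _ (by omega)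
  let P : E →ₗ[ℝ] LinearMap.ker (L : E →ₗ[ℝ] ℝ) :=
    LinearMap.codRestrict _ (LinearMap.id - (L : E →ₗ[ℝ] ℝ).smulRight w) (by
      intro v
      simp [hw])
  let A : E →ₗ[ℝ] ℝ × E' := (L : E →ₗ[ℝ] ℝ).prod (κ.toLinearMap ∘ₗ P)
  have hA : Function.Injective A := by
    rw [← LinearMap.ker_eq_bot, LinearMap.ker_eq_bot']
    intro v hv
    have h1 : L v = 0 := congrArg Prod.fst hv
    have h2 : κ (P v) = 0 := congrArg Prod.snd hv
    have h3 : P v = 0 := κ.map_eq_zero_iff.1 h2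
    have h4 : v - L v • w = 0 := congrArg Subtype.val h3
    simpa [h1] using h4
  have hfin : Module.finrank ℝ E = Module.finrank ℝ (ℝ × E') := by
    rw [Module.finrank_prod, Module.finrank_self]; omega
  exact ⟨(LinearEquiv.ofInjectiveOfFinrankEq A hA hfin).toContinuousLinearEquiv, fun v ↦ rfl⟩

variable {M : Type*} [TopologicalSpace M] [ChartedSpace E M] [IsManifold 𝓘(ℝ, E) ∞ M]

/-- Near a regular point, a function is the first coordinate of a chart. -/
theorem exists_straightening {f : M → ℝ} (hf : ContMDiff 𝓘(ℝ, E) 𝓘(ℝ, ℝ) ∞ f) {p : M}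
    (hp : mder 𝓘(ℝ, E) 𝓘(ℝ, ℝ) f p ≠ 0) (hd : Module.finrank ℝ E' = Module.finrank ℝ E - 1) :
    ∃ K : OpenPartialHomeomorph M (ℝ × E'), p ∈ K.source ∧ (∀ q ∈ K.source, (K q).1 = f q) ∧
      (∀ q ∈ K.source, ContMDiffAt 𝓘(ℝ, E) 𝓘(ℝ, ℝ × E') ∞ K q) ∧
      ∀ y ∈ K.target, ContMDiffAt 𝓘(ℝ, ℝ × E') 𝓘(ℝ, E) ∞ K.symm y := by
  obtain ⟨e, he⟩ := exists_equiv_prod_fst (E' := E') hp hd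
  -- Since the first component of `e` is `df`, the derivative of `h` at the centre is `e`, and the
  -- inverse function theorem applies.
  let h : E → ℝ × E' := fun y ↦ (f ((extChartAt 𝓘(ℝ, E) p).symm y), (e y).2)
  have hh : ∀ y ∈ (extChartAt 𝓘(ℝ, E) p).target, ContDiffAt ℝ ∞ h y := by
    intro y hy
    refine ContDiffAt.prodMk ?_ (contDiff_snd.contDiffAt.comp y e.contDiff.contDiffAt)
    rw [← contMDiffAt_iff_contDiffAt]
    exact hf.contMDiffAt.comp _ (contMDiffAt_extChartAt_symm_of_mem le_rfl hy)
  have hpt := mem_extChartAt_target (I := 𝓘(ℝ, E)) p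
  have hd : HasFDerivAt h (e : E →L[ℝ] ℝ × E') (extChartAt 𝓘(ℝ, E) p p) := by
    have h1 : HasFDerivAt (fun y ↦ f ((extChartAt 𝓘(ℝ, E) p).symm y))
        (mder 𝓘(ℝ, E) 𝓘(ℝ, ℝ) f p) (extChartAt 𝓘(ℝ, E) p p) := by
      have h2 : MDifferentiableAt 𝓘(ℝ, E) 𝓘(ℝ, ℝ) f
          ((extChartAt 𝓘(ℝ, E) p).symm (extChartAt 𝓘(ℝ, E) p p)) :=
        hf.contMDiffAt.mdifferentiableAt (by simp)
      have h3 := mder_comp h2 (mdifferentiableAt_extChartAt_symm hpt)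
      rw [mder_extChartAt_symm_self, extChartAt_to_inv, mder_eq_fderiv] at h3
      have h4 := ((hh _ hpt).fst.differentiableAt (by simp)).hasFDerivAt
      exact h4.congr_fderiv h3
    have h5 := h1.prodMk (hasFDerivAt_snd.comp _ e.hasFDerivAt)
    refine h5.congr_fderiv ?_
    ext v
    · exact (he v).symm
    · rfl
  let H₀ := (hh _ hpt).toOpenPartialHomeomorph h hd (by simp)
  have hcont : ContinuousAt (fderiv ℝ h) (extChartAt 𝓘(ℝ, E) p p) :=
    ((hh _ hpt).fderiv_right (m := 0) (by simp)).continuousAt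
  -- Shrinking to points where the derivative remains invertible makes the inverse smooth on its
  -- whole domain, not only at the centre.
  have hev : ∀ᶠ y in nhds (extChartAt 𝓘(ℝ, E) p p), y ∈ (extChartAt 𝓘(ℝ, E) p).target ∧
      fderiv ℝ h y ∈ range ((↑) : (E ≃L[ℝ] ℝ × E') → E →L[ℝ] ℝ × E') := by
    refine ((isOpen_extChartAt_target p).eventually_mem hpt).and ?_
    refine hcont.eventually_mem ?_
    rw [hd.fderiv]
    exact ContinuousLinearEquiv.nhds e
  obtain ⟨U, hU, hUo, hpU⟩ := mem_nhds_iff.1 hev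
  let H := H₀.restrOpen U hUo
  have hHs : ∀ y, y ∈ H.source ↔ y ∈ H₀.source ∧ y ∈ U := fun y ↦ Iff.rfl
  have hHU : ∀ y ∈ H.source, y ∈ U := fun y hy ↦ hy.2
  have hHsymm : ∀ y ∈ H.target, ContDiffAt ℝ ∞ H.symm y := by
    intro y hy
    obtain ⟨h1, e', he'⟩ := hU (hHU _ (H.map_target hy))
    refine H.contDiffAt_symm (f₀' := e') hy ?_ (hh _ h1)
    rw [he']
    exact ((hh _ h1).differentiableAt (by simp)).hasFDerivAt
  refine ⟨(chartAt E p).trans H, ?_, ?_, ?_, ?_⟩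
  · rw [OpenPartialHomeomorph.trans_source]
    exact ⟨mem_chart_source E p, (hh _ hpt).mem_toOpenPartialHomeomorph_source hd (by simp), hpU⟩
  · intro q hq
    rw [OpenPartialHomeomorph.trans_source] at hq
    exact congrArg f ((chartAt E p).left_inv hq.1)
  · intro q hq
    rw [OpenPartialHomeomorph.trans_source] at hq
    have h1 : ContMDiffAt 𝓘(ℝ, E) 𝓘(ℝ, E) ∞ (chartAt E p) q :=
      contMDiffAt_extChartAt_of_mem le_rfl (by simpa using hq.1)
    exact ContMDiffAt.comp (g := h) q (hh _ (hU (hHU _ hq.2)).1).contMDiffAt h1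
  · intro y hy
    rw [OpenPartialHomeomorph.trans_target] at hy
    exact ContMDiffAt.comp (f := H.symm) y
      (contMDiffAt_extChartAt_symm_of_mem le_rfl (hU (hHU _ (H.map_target hy.1))).1)
      (hHsymm y hy.1).contMDiffAt

end Straightening

/-! ### Regular level sets as embedded submanifolds. -/

section LevelSet

variable {M : Type*} [TopologicalSpace M]

/-- The level set `{f = 1}`. -/
structure LevelSet {M : Type*} (f : M → ℝ) where
  /-- The inclusion of a level set. -/
  incl : M
  apply_incl : f incl = 1

namespace LevelSet

variable {f : M → ℝ}

instance : TopologicalSpace (LevelSet f) := .induced incl inferInstance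

theorem isEmbedding_incl : Topology.IsEmbedding (incl : LevelSet f → M) :=
  ⟨⟨rfl⟩, fun ⟨_, _⟩ ⟨_, _⟩ h ↦ by cases h; rfl⟩

omit [TopologicalSpace M] in
theorem range_incl : range (incl : LevelSet f → M) = {q | f q = 1} :=
  Subset.antisymm (range_subset_iff.2 apply_incl) fun q hq ↦ ⟨⟨q, hq⟩, rfl⟩

variable {E' : Type*} [NormedAddCommGroup E'] [NormedSpace ℝ E']

open Classical in
/-- The inverse of a chart of a level set. -/
def chartInv (K : OpenPartialHomeomorph M (ℝ × E')) (hK : ∀ q ∈ K.source, (K q).1 = f q)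
    (p : LevelSet f) (y : E') : LevelSet f :=
  -- Outside the target the value is irrelevant; `p` only supplies a point.
  if h : ((1 : ℝ), y) ∈ K.target then
    ⟨K.symm (1, y), by rw [← hK _ (K.map_target h), K.right_inv h]⟩ else p

theorem incl_chartInv (K : OpenPartialHomeomorph M (ℝ × E')) (hK : ∀ q ∈ K.source, (K q).1 = f q)
    (p : LevelSet f) {y : E'} (hy : ((1 : ℝ), y) ∈ K.target) :
    incl (chartInv K hK p y) = K.symm (1, y) := by
  simp [chartInv, hy]

/-- The chart of the level set `{f = 1}` induced by a chart with first coordinate `f`. -/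
def chart (K : OpenPartialHomeomorph M (ℝ × E')) (hK : ∀ q ∈ K.source, (K q).1 = f q)
    (p : LevelSet f) : OpenPartialHomeomorph (LevelSet f) E' where
  toFun q := (K (incl q)).2
  invFun := chartInv K hK p
  source := incl ⁻¹' K.source
  target := {y | ((1 : ℝ), y) ∈ K.target}
  map_source' q hq := by
    have h1 : K (incl q) = (1, (K (incl q)).2) :=
      Prod.ext ((hK _ hq).trans (apply_incl q)) rfl
    change (1, (K (incl q)).2) ∈ K.target
    rw [← h1]
    exact K.map_source hq
  map_target' y hy := by
    change incl (chartInv K hK p y) ∈ K.source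
    rw [incl_chartInv K hK p hy]
    exact K.map_target hy
  left_inv' q hq := by
    have h1 : K (incl q) = (1, (K (incl q)).2) :=
      Prod.ext ((hK _ hq).trans (apply_incl q)) rfl
    have h2 : ((1 : ℝ), (K (incl q)).2) ∈ K.target := by rw [← h1]; exact K.map_source hq
    refine isEmbedding_incl.injective ?_
    rw [incl_chartInv K hK p h2, ← h1, K.left_inv hq]
  right_inv' y hy := by
    have hy' : ((1 : ℝ), y) ∈ K.target := hy
    rw [incl_chartInv K hK p hy, K.right_inv hy']
  open_source := K.open_source.preimage isEmbedding_incl.continuous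
  open_target := K.open_target.preimage (by fun_prop)
  continuousOn_toFun := continuous_snd.comp_continuousOn
    (K.continuousOn.comp isEmbedding_incl.continuous.continuousOn fun q hq ↦ hq)
  continuousOn_invFun := by
    rw [isEmbedding_incl.continuousOn_iff]
    refine (K.continuousOn_symm.comp (f := fun y : E' ↦ ((1 : ℝ), y)) (by fun_prop)
      fun y hy ↦ hy).congr fun y hy ↦ incl_chartInv K hK p hy

theorem incl_chart_symm (K : OpenPartialHomeomorph M (ℝ × E')) (hK : ∀ q ∈ K.source, (K q).1 = f q)
    (p : LevelSet f) {y : E'} (hy : ((1 : ℝ), y) ∈ K.target) :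
    incl ((chart K hK p).symm y) = K.symm (1, y) :=
  incl_chartInv K hK p hy

end LevelSet

/-- `ι : N → M` is the inclusion of the level set `{f = 1}` as an embedded submanifold. -/
structure IsRegularLevel {E : Type*} [NormedAddCommGroup E] [NormedSpace ℝ E]
    {M : Type*} [TopologicalSpace M] [ChartedSpace E M]
    {E' : Type*} [NormedAddCommGroup E'] [NormedSpace ℝ E']
    {N : Type*} [TopologicalSpace N] [ChartedSpace E' N] (f : M → ℝ) (ι : N → M) : Prop where
  isEmbedding : Topology.IsEmbedding ι
  range_eq : range ι = {q | f q = 1}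
  contMDiff : ContMDiff 𝓘(ℝ, E') 𝓘(ℝ, E) ∞ ι
  exists_retraction : ∀ p, ∃ ρ : M → N, ContMDiffAt 𝓘(ℝ, E) 𝓘(ℝ, E') ∞ ρ (ι p) ∧
    ∀ᶠ q in nhds p, ρ (ι q) = q

variable {E : Type*} [NormedAddCommGroup E] [NormedSpace ℝ E] [FiniteDimensional ℝ E]
  {E' : Type*} [NormedAddCommGroup E'] [NormedSpace ℝ E'] [FiniteDimensional ℝ E']
  [ChartedSpace E M] [IsManifold 𝓘(ℝ, E) ∞ M]

/-- A regular level set is an embedded submanifold. -/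
theorem exists_isRegularLevel {f : M → ℝ} (hf : ContMDiff 𝓘(ℝ, E) 𝓘(ℝ, ℝ) ∞ f)
    (hreg : ∀ p, f p = 1 → mder 𝓘(ℝ, E) 𝓘(ℝ, ℝ) f p ≠ 0)
    (hd : Module.finrank ℝ E' = Module.finrank ℝ E - 1) :
    ∃ (_ : ChartedSpace E' (LevelSet f)), IsManifold 𝓘(ℝ, E') ∞ (LevelSet f) ∧
      IsRegularLevel (E := E) (E' := E') f (LevelSet.incl : LevelSet f → M) := by
  choose K hKp hK hKs hKt using fun p : LevelSet f ↦
    exists_straightening (E' := E') hf (hreg (LevelSet.incl p) p.apply_incl) hd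
  let C : ChartedSpace E' (LevelSet f) :=
    { atlas := range fun p ↦ LevelSet.chart (K p) (hK p) p
      chartAt := fun p ↦ LevelSet.chart (K p) (hK p) p
      mem_chart_source := hKp
      chart_mem_atlas := fun p ↦ ⟨p, rfl⟩ }
  have hi : ∀ p (y : E'), ((1 : ℝ), y) ∈ (K p).target →
      ContMDiffAt 𝓘(ℝ, E') 𝓘(ℝ, E) ∞ (fun y ↦ (K p).symm (1, y)) y := fun p y hy ↦
    ContMDiffAt.comp (f := fun y : E' ↦ ((1 : ℝ), y)) y (hKt p _ hy)
      (contDiff_const.prodMk contDiff_id).contMDiff.contMDiffAt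
  have hm : IsManifold 𝓘(ℝ, E') ∞ (LevelSet f) := by
    refine isManifold_of_contDiffOn 𝓘(ℝ, E') ∞ (LevelSet f) ?_
    -- The transition map is the second component of `y ↦ K p' ((K p).symm (1, y))`.
    rintro _ _ ⟨p, rfl⟩ ⟨p', rfl⟩ y hy
    have hy1 : ((1 : ℝ), y) ∈ (K p).target := by
      simp only [mfld_simps] at hy; exact hy.1
    have hy2 : (K p).symm (1, y) ∈ (K p').source := by
      simp only [mfld_simps] at hy
      rw [← LevelSet.incl_chart_symm (K p) (hK p) p hy1]
      exact hy.2
    have h1 : ContMDiffAt 𝓘(ℝ, E') 𝓘(ℝ, ℝ × E') ∞ (fun y ↦ K p' ((K p).symm (1, y))) y :=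
      ContMDiffAt.comp (f := fun y ↦ (K p).symm (1, y)) y (hKs p' _ hy2) (hi p y hy1)
    have h2 : ContDiffAt ℝ ∞ (fun y ↦ (K p' ((K p).symm (1, y))).2) y :=
      (contMDiffAt_iff_contDiffAt.1 h1).snd
    have h3 : {y : E' | ((1 : ℝ), y) ∈ (K p).target} ∈ nhds y :=
      ((K p).open_target.preimage (by fun_prop : Continuous fun y : E' ↦ ((1 : ℝ), y))).mem_nhds hy1
    refine (h2.congr_of_eventuallyEq ?_).contDiffWithinAt
    filter_upwards [h3] with z hz
    rw [← LevelSet.incl_chart_symm (K p) (hK p) p hz]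
    rfl
  have hext : ∀ p : LevelSet f, ∀ q, extChartAt 𝓘(ℝ, E') p q = (K p (LevelSet.incl q)).2 :=
    fun p q ↦ rfl
  refine ⟨C, hm, ⟨LevelSet.isEmbedding_incl, LevelSet.range_incl, ?_, ?_⟩⟩
  · intro p
    have hp := K p |>.map_source (hKp p)
    have h1 : K p (LevelSet.incl p) = (1, (K p (LevelSet.incl p)).2) :=
      Prod.ext ((hK p _ (hKp p)).trans (LevelSet.apply_incl p)) rfl
    rw [h1] at hp
    have h2 : ContMDiffAt 𝓘(ℝ, E') 𝓘(ℝ, E') ∞ (extChartAt 𝓘(ℝ, E') p) p :=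
      contMDiffAt_extChartAt_of_mem le_rfl (mem_extChartAt_source p)
    have h3 := ContMDiffAt.comp (f := extChartAt 𝓘(ℝ, E') p) p (hi p _ hp) h2
    refine h3.congr_of_eventuallyEq ?_
    filter_upwards [extChartAt_source_mem_nhds (I := 𝓘(ℝ, E')) p] with q hq
    have hq' : LevelSet.incl q ∈ (K p).source := by
      rw [extChartAt_source] at hq; exact hq
    simp only [Function.comp_apply, hext]
    rw [← LevelSet.apply_incl q, ← hK p _ hq', Prod.mk.eta, (K p).left_inv hq']
  · intro p
    refine ⟨fun q ↦ (extChartAt 𝓘(ℝ, E') p).symm (K p q).2, ?_, ?_⟩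
    · have h1 : ContMDiffAt 𝓘(ℝ, E) 𝓘(ℝ, E') ∞ (fun q ↦ (K p q).2) (LevelSet.incl p) :=
        ContMDiffAt.comp (g := fun z : ℝ × E' ↦ z.2) (LevelSet.incl p)
          contDiff_snd.contMDiff.contMDiffAt (hKs p _ (hKp p))
      exact ContMDiffAt.comp (f := fun q ↦ (K p q).2) (LevelSet.incl p)
        (contMDiffAt_extChartAt_symm_of_mem le_rfl (mem_extChartAt_target p)) h1
    · filter_upwards [extChartAt_source_mem_nhds (I := 𝓘(ℝ, E')) p] with q hq
      exact (extChartAt 𝓘(ℝ, E') p).left_inv hq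

end LevelSet

/-! ### The index of a form restricted to an orthogonal complement. -/

section Index

variable {E : Type*} [NormedAddCommGroup E] [NormedSpace ℝ E]
  {E' : Type*} [NormedAddCommGroup E'] [NormedSpace ℝ E']

/-- The dimensions of the subspaces on which a bilinear form is negative definite. -/
def negDims (B : E →L[ℝ] E →L[ℝ] ℝ) : Set ℕ :=
  {d | ∃ W : Submodule ℝ E, Module.finrank ℝ W = d ∧ ∀ w ∈ W, w ≠ 0 → B w w < 0}

theorem finrank_map_of_injective {j : E' →ₗ[ℝ] E} (hj : Function.Injective j)
    (W : Submodule ℝ E') : Module.finrank ℝ (W.map j) = Module.finrank ℝ W :=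
  (LinearEquiv.finrank_eq (Submodule.equivMapOfInjective j hj W)).symm

theorem finrank_comap_of_injective {j : E' →ₗ[ℝ] E} (hj : Function.Injective j)
    {W : Submodule ℝ E} (hW : W ≤ LinearMap.range j) :
    Module.finrank ℝ (W.comap j) = Module.finrank ℝ W := by
  rw [← finrank_map_of_injective hj, Submodule.map_comap_eq_of_le hW]

variable [FiniteDimensional ℝ E] {B : E →L[ℝ] E →L[ℝ] ℝ} {B' : E' →L[ℝ] E' →L[ℝ] ℝ}
  {j : E' →ₗ[ℝ] E} {T : E} {q : ℕ}

/-- A subspace orthogonal to `T` lies in the image of `j`, so it is pulled back without loss of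
dimension. -/
theorem mem_negDims_of_comap (hB' : ∀ v w, B' v w = B (j v) (j w)) (hj : Function.Injective j)
    (hr : ∀ v, B v T = 0 → v ∈ LinearMap.range j) (W : Submodule ℝ E)
    (hWT : ∀ w ∈ W, B w T = 0) (hW : ∀ w ∈ W, w ≠ 0 → B w w < 0) :
    Module.finrank ℝ W ∈ negDims B' := by
  refine ⟨W.comap j, finrank_comap_of_injective hj fun w hw ↦ hr w (hWT w hw), fun w hw hw0 ↦ ?_⟩
  rw [hB']
  exact hW (j w) hw fun h ↦ hw0 (hj (by rw [h, map_zero]))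

/-- The index of the restriction of a form to the orthogonal complement of a positive vector. -/
theorem isGreatest_negDims_of_pos (hB : ∀ v w, B v w = B w v)
    (hB' : ∀ v w, B' v w = B (j v) (j w)) (hj : Function.Injective j)
    (hr : ∀ v, B v T = 0 → v ∈ LinearMap.range j) (hT : B T T = 1)
    (hq : IsGreatest (negDims B) q) : IsGreatest (negDims B') q := by
  obtain ⟨⟨W, hWq, hW⟩, hmax⟩ := hq
  constructor
  -- Projecting along `T` subtracts `B(w, T)²` from `B(w, w)`. A negative definite `W` stays
  -- negative definite, and the projection is injective on it.
  · let P : E →ₗ[ℝ] E := LinearMap.id - ((B.flip T : E →L[ℝ] ℝ) : E →ₗ[ℝ] ℝ).smulRight T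
    have hP : ∀ v, P v = v - B v T • T := fun v ↦ rfl
    have hPP : ∀ v, B (P v) (P v) = B v v - B v T ^ 2 := by
      intro v
      rw [hP]
      simp only [map_sub, map_smul, sub_apply, smul_apply, smul_eq_mul, hT, hB T v]
      ring
    have hneg : ∀ w ∈ W, w ≠ 0 → B (P w) (P w) < 0 := fun w hw hw0 ↦ by
      rw [hPP]; nlinarith [hW w hw hw0, sq_nonneg (B w T)]
    have hinj : Function.Injective (P.domRestrict W) := by
      rw [← LinearMap.ker_eq_bot, LinearMap.ker_eq_bot']
      rintro ⟨w, hw⟩ hPw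
      have hPw' : P w = 0 := hPw
      by_contra h0
      have := hneg w hw fun h ↦ h0 (Subtype.ext h)
      rw [hPw'] at this
      simp at this
    have hfin : Module.finrank ℝ (W.map P) = q := by
      rw [← hWq, ← LinearMap.range_domRestrict]
      exact LinearMap.finrank_range_of_inj hinj
    rw [← hfin]
    refine mem_negDims_of_comap hB' hj hr _ ?_ ?_
    · rintro _ ⟨w, hw, rfl⟩
      rw [hP]
      simp only [map_sub, map_smul, sub_apply, smul_apply, smul_eq_mul, hT]
      ring
    · rintro _ ⟨w, hw, rfl⟩ hw0
      exact hneg w hw fun h ↦ hw0 (by rw [h, map_zero])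
  · rintro d ⟨W', rfl, hW'⟩
    refine hmax ⟨W'.map j, finrank_map_of_injective hj W', ?_⟩
    rintro _ ⟨w, hw, rfl⟩ hw0
    rw [← hB']
    exact hW' w hw fun h ↦ hw0 (by rw [h, map_zero])

/-- The index of the restriction of a form to the orthogonal complement of a negative vector. -/
theorem isGreatest_negDims_of_neg (hB : ∀ v w, B v w = B w v)
    (hB' : ∀ v w, B' v w = B (j v) (j w)) (hj : Function.Injective j)
    (hr : ∀ v, B v T = 0 ↔ v ∈ LinearMap.range j) (hT : B T T = -1)
    (hq : IsGreatest (negDims B) q) : IsGreatest (negDims B') (q - 1) := by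
  obtain ⟨⟨W, hWq, hW⟩, hmax⟩ := hq
  -- Adding the negative vector `T` to a negative subspace of its orthogonal complement raises the
  -- dimension by one. In particular `q ≥ 1`, so `q - 1` is a genuine difference.
  have hub : ∀ d ∈ negDims B', d + 1 ≤ q := by
    rintro d ⟨W', rfl, hW'⟩
    have hT0 : T ≠ 0 := by rintro rfl; simp at hT
    have hdisj : Disjoint (W'.map j) (ℝ ∙ T) := by
      rw [Submodule.disjoint_def]
      rintro x ⟨w, hw, rfl⟩ hx
      obtain ⟨c, hc⟩ := Submodule.mem_span_singleton.1 hx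
      have h1 := (hr (j w)).2 ⟨w, rfl⟩
      rw [← hc, map_smul, smul_apply, hT, smul_eq_mul] at h1
      rw [← hc, show c = 0 by linarith, zero_smul]
    have hdim : Module.finrank ℝ (W'.map j ⊔ (ℝ ∙ T) : Submodule ℝ E) =
        Module.finrank ℝ W' + 1 := by
      have h := Submodule.finrank_sup_add_finrank_inf_eq (W'.map j) (ℝ ∙ T)
      rw [hdisj.eq_bot, finrank_bot, finrank_map_of_injective hj, finrank_span_singleton hT0] at h
      omega
    refine hmax ⟨_, hdim, ?_⟩
    intro x hx hx0
    obtain ⟨y, ⟨w, hw, rfl⟩, z, hz, rfl⟩ := Submodule.mem_sup.1 hx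
    obtain ⟨c, rfl⟩ := Submodule.mem_span_singleton.1 hz
    have h1 := (hr (j w)).2 ⟨w, rfl⟩
    have h2 : B (j w + c • T) (j w + c • T) = B' w w - c ^ 2 := by
      simp only [map_add, map_smul, add_apply, smul_apply, smul_eq_mul, hT, hB', h1,
        hB T (j w)]
      ring
    rw [h2]
    by_cases hw0 : w = 0
    · have hc : c ≠ 0 := by
        rintro rfl
        exact hx0 (by simp [hw0])
      rw [hw0]
      simp only [map_zero, zero_sub, Left.neg_neg_iff]
      positivity
    · nlinarith [hW' w hw hw0, sq_nonneg c]
  refine ⟨?_, fun d hd ↦ by have := hub d hd; omega⟩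
  -- Conversely, the part of `W` orthogonal to `T` has codimension at most one in `W`.
  let L : E →ₗ[ℝ] ℝ := ((B.flip T : E →L[ℝ] ℝ) : E →ₗ[ℝ] ℝ)
  have h1 : Module.finrank ℝ (W ⊓ LinearMap.ker L : Submodule ℝ E) ∈ negDims B' :=
    mem_negDims_of_comap hB' hj (fun v ↦ (hr v).1) _ (fun w hw ↦ hw.2)
      fun w hw hw0 ↦ hW w hw.1 hw0
  have h2 := Submodule.finrank_sup_add_finrank_inf_eq W (LinearMap.ker L)
  have h3 : Module.finrank ℝ (W ⊔ LinearMap.ker L : Submodule ℝ E) ≤ Module.finrank ℝ E :=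
    Submodule.finrank_le _
  have h4 := LinearMap.finrank_range_add_finrank_ker L
  have h5 : Module.finrank ℝ (LinearMap.range L) ≤ 1 := by
    simpa using Submodule.finrank_le (LinearMap.range L)
  have h6 := hub _ h1
  have h7 : Module.finrank ℝ (W ⊓ LinearMap.ker L : Submodule ℝ E) = q - 1 := by omega
  exact h7 ▸ h1

end Index

/-! ### Maps into a regular level set, and its tangent spaces. -/

section RegularLevel

variable {E : Type*} [NormedAddCommGroup E] [NormedSpace ℝ E]
  {M : Type*} [TopologicalSpace M] [ChartedSpace E M]
  {E' : Type*} [NormedAddCommGroup E'] [NormedSpace ℝ E']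
  {N : Type*} [TopologicalSpace N] [ChartedSpace E' N] {f : M → ℝ} {ι : N → M}

namespace IsRegularLevel

theorem apply_eq (hι : IsRegularLevel (E := E) (E' := E') f ι) (p : N) : f (ι p) = 1 := by
  have : ι p ∈ range ι := ⟨p, rfl⟩
  rwa [hι.range_eq] at this

/-- Compose with a local smooth retraction; continuity, needed to stay where it is a left inverse,
comes from the embedding. -/
theorem contMDiffAt_of_comp (hι : IsRegularLevel (E := E) (E' := E') f ι)
    {F : Type*} [NormedAddCommGroup F] [NormedSpace ℝ F] {H : Type*} [TopologicalSpace H]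
    {I : ModelWithCorners ℝ F H} {X : Type*} [TopologicalSpace X] [ChartedSpace H X]
    {φ : X → N} {x : X} (h : ContMDiffAt I 𝓘(ℝ, E) ∞ (fun x ↦ ι (φ x)) x) :
    ContMDiffAt I 𝓘(ℝ, E') ∞ φ x := by
  have hc : ContinuousAt φ x := hι.isEmbedding.continuousAt_iff.2 h.continuousAt
  obtain ⟨ρ, hρ, hρ'⟩ := hι.exists_retraction (φ x)
  refine (ContMDiffAt.comp (f := fun x ↦ ι (φ x)) x hρ h).congr_of_eventuallyEq ?_
  filter_upwards [hc.eventually hρ'] with y hy using hy.symm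

theorem mder_injective (hι : IsRegularLevel (E := E) (E' := E') f ι) (p : N) :
    Function.Injective (mder 𝓘(ℝ, E') 𝓘(ℝ, E) ι p) := by
  obtain ⟨ρ, hρ, hρ'⟩ := hι.exists_retraction p
  have h := mder_comp (hρ.mdifferentiableAt (by simp))
    (hι.contMDiff.contMDiffAt.mdifferentiableAt (by simp))
  have h2 : (fun q ↦ ρ (ι q)) =ᶠ[nhds p] fun q ↦ q := hρ'
  rw [mder_congr h2, mder_id] at h
  intro v w hvw
  have h3 := congrArg (fun L ↦ L v) h
  have h4 := congrArg (fun L ↦ L w) h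
  simp only [ContinuousLinearMap.comp_apply, hvw] at h3 h4
  exact h3.trans h4.symm

theorem mder_mder (hι : IsRegularLevel (E := E) (E' := E') f ι)
    (hf : ContMDiff 𝓘(ℝ, E) 𝓘(ℝ, ℝ) ∞ f) (p : N) (v : E') :
    mder 𝓘(ℝ, E) 𝓘(ℝ, ℝ) f (ι p) (mder 𝓘(ℝ, E') 𝓘(ℝ, E) ι p v) = 0 := by
  rw [← mder_comp_apply (hf.contMDiffAt.mdifferentiableAt (by simp))
    (hι.contMDiff.contMDiffAt.mdifferentiableAt (by simp))]
  have h : (fun x ↦ f (ι x)) = fun _ ↦ (1 : ℝ) := funext hι.apply_eq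
  rw [h, mder_const]
  rfl

/-- The range of `dι` lies in the kernel of `df`, and both have dimension `dim M - 1`. -/
theorem exists_mder_eq [FiniteDimensional ℝ E] [FiniteDimensional ℝ E']
    (hι : IsRegularLevel (E := E) (E' := E') f ι)
    (hf : ContMDiff 𝓘(ℝ, E) 𝓘(ℝ, ℝ) ∞ f) (p : N)
    (hp : mder 𝓘(ℝ, E) 𝓘(ℝ, ℝ) f (ι p) ≠ 0)
    (hd : Module.finrank ℝ E' = Module.finrank ℝ E - 1) (v : E)
    (hv : mder 𝓘(ℝ, E) 𝓘(ℝ, ℝ) f (ι p) v = 0) : ∃ w, mder 𝓘(ℝ, E') 𝓘(ℝ, E) ι p w = v := by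
  have h1 := finrank_ker_of_ne_zero hp
  have h2 : LinearMap.range (mder 𝓘(ℝ, E') 𝓘(ℝ, E) ι p : E' →ₗ[ℝ] E) =
      LinearMap.ker (mder 𝓘(ℝ, E) 𝓘(ℝ, ℝ) f (ι p) : E →ₗ[ℝ] ℝ) := by
    refine Submodule.eq_of_le_of_finrank_eq ?_ ?_
    · rintro _ ⟨w, rfl⟩
      exact hι.mder_mder hf p w
    · rw [LinearMap.finrank_range_of_inj (hι.mder_injective p)]
      omega
  have h3 : v ∈ LinearMap.range (mder 𝓘(ℝ, E') 𝓘(ℝ, E) ι p : E' →ₗ[ℝ] E) := by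
    rw [h2]; exact hv
  exact h3

end IsRegularLevel

end RegularLevel

/-! ### The level set `{σ u = 1}` with its induced metric. -/

section LevelSplitting

variable {E : Type*} [NormedAddCommGroup E] [NormedSpace ℝ E]
  {M : Type*} [TopologicalSpace M] [ChartedSpace E M]
  {E' : Type*} [NormedAddCommGroup E'] [NormedSpace ℝ E']
  {N : Type*} [TopologicalSpace N] [ChartedSpace E' N]

/-- The pull-back of a field of bilinear forms under a map. -/
def inducedForm (g : FormField 𝓘(ℝ, E) M) (ι : N → M) : FormField 𝓘(ℝ, E') N := fun p ↦
  pullForm 𝓘(ℝ, E') 𝓘(ℝ, E) (mfderiv 𝓘(ℝ, E') 𝓘(ℝ, E) ι p) (g (ι p))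

theorem inducedForm_apply (g : FormField 𝓘(ℝ, E) M) (ι : N → M) (p : N) (v w : E') :
    formAt 𝓘(ℝ, E') (inducedForm g ι) p v w = formAt 𝓘(ℝ, E) g (ι p)
      (mder 𝓘(ℝ, E') 𝓘(ℝ, E) ι p v) (mder 𝓘(ℝ, E') 𝓘(ℝ, E) ι p w) := rfl

theorem mder_const_mul {f : M → ℝ} {p : M} (hf : MDifferentiableAt 𝓘(ℝ, E) 𝓘(ℝ, ℝ) f p) (c : ℝ)
    (v : E) : mder 𝓘(ℝ, E) 𝓘(ℝ, ℝ) (fun q ↦ c * f q) p v =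
      c * mder 𝓘(ℝ, E) 𝓘(ℝ, ℝ) f p v := by
  rw [mder_comp_apply (h := fun t : ℝ ↦ c * t) (I' := 𝓘(ℝ, ℝ))
    (differentiableAt_id.const_mul c).mdifferentiableAt hf, mder_eq_fderiv,
    fderiv_const_mul differentiableAt_fun_id]
  simp

theorem IsConformalGradient.mder_const_mul {ε : ℝ} {g : FormField 𝓘(ℝ, E) M} {u : M → ℝ}
    {Z : M → E} (hu : IsConformalGradient ε g u Z) (c : ℝ) (q : M) (v : E) :
    mder 𝓘(ℝ, E) 𝓘(ℝ, ℝ) (fun q ↦ c * u q) q v = c * formAt 𝓘(ℝ, E) g q v (Z q) := by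
  rw [_root_.mder_const_mul (hu.contMDiff.contMDiffAt.mdifferentiableAt (by simp)), hu.mder_eq]

/-- Evaluate on the normalized gradient, where `du` equals `u`. -/
theorem IsConformalGradient.mder_ne_zero {ε : ℝ} {g : FormField 𝓘(ℝ, E) M} {u : M → ℝ}
    {Z : M → E} (hu : IsConformalGradient ε g u Z) (hε : ε * ε = 1) {c : ℝ} {q : M}
    (hq : c * u q ≠ 0) : mder 𝓘(ℝ, E) 𝓘(ℝ, ℝ) (fun q ↦ c * u q) q ≠ 0 := by
  intro h
  have h1 := hu.mder_const_mul c q (unitField ε u Z q)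
  rw [hu.formAt_unitField_left hε (right_ne_zero_of_mul hq), h] at h1
  exact hq h1.symm

variable [FiniteDimensional ℝ E] [FiniteDimensional ℝ E'] [IsManifold 𝓘(ℝ, E) ∞ M]
  [IsManifold 𝓘(ℝ, E') ∞ N]

/-- A function `u` with conformal gradient, the geodesic flow `θ` of the normalized gradient, and
the inclusion `ι` of the level set `{σ u = 1}`. -/
structure LevelSplitting (ε σ : ℝ) (g : FormField 𝓘(ℝ, E) M) (u : M → ℝ) (Z : M → E)
    (θ : ℝ → M → M) (ι : N → M) : Prop where
  metric : IsSemiRiemannian 𝓘(ℝ, E) g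
  gradient : IsConformalGradient ε g u Z
  flow : IsGeodesicFlow g (unitField ε u Z) θ
  level : IsRegularLevel (E := E) (E' := E') (fun q ↦ σ * u q) ι
  eps_cases : ε = 1 ∨ ε = -1
  sign_sq : σ * σ = 1
  finrank_eq : Module.finrank ℝ E' = Module.finrank ℝ E - 1

namespace LevelSplitting

variable {ε σ : ℝ} {g : FormField 𝓘(ℝ, E) M} {u : M → ℝ} {Z : M → E} {θ : ℝ → M → M} {ι : N → M}

theorem eps_sq (h : LevelSplitting (E' := E') ε σ g u Z θ ι) : ε * ε = 1 := by
  rcases h.eps_cases with rfl | rfl <;> norm_num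

theorem apply_incl (h : LevelSplitting (E' := E') ε σ g u Z θ ι) (p : N) : u (ι p) = σ := by
  have h1 := h.level.apply_eq p
  linear_combination σ * h1 - u (ι p) * h.sign_sq

theorem sign_ne_zero (h : LevelSplitting (E' := E') ε σ g u Z θ ι) : σ ≠ 0 := by
  intro h0
  have := h.sign_sq
  rw [h0] at this
  norm_num at this

theorem incl_ne_zero (h : LevelSplitting (E' := E') ε σ g u Z θ ι) (p : N) : u (ι p) ≠ 0 := by
  rw [h.apply_incl]; exact h.sign_ne_zero

theorem contMDiff_mul (h : LevelSplitting (E' := E') ε σ g u Z θ ι) :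
    ContMDiff 𝓘(ℝ, E) 𝓘(ℝ, ℝ) ∞ (fun q ↦ σ * u q) :=
  contMDiff_const.mul h.gradient.contMDiff

theorem formAt_unitField_eq_zero_iff (h : LevelSplitting (E' := E') ε σ g u Z θ ι) {q : M}
    (hq : u q ≠ 0) (v : E) : formAt 𝓘(ℝ, E) g q v (unitField ε u Z q) = 0 ↔
      formAt 𝓘(ℝ, E) g q v (Z q) = 0 := by
  have hε : ε ≠ 0 := by
    intro h0
    have := h.eps_sq
    rw [h0] at this
    norm_num at this
  unfold unitField
  rw [map_smul, smul_eq_mul, mul_eq_zero]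
  simp [hε, hq]

/-- `T` is a nonzero multiple of `Z`, so its orthogonal complement is the kernel of `du`, the
tangent space of the level. -/
theorem formAt_mder_unitField_iff (h : LevelSplitting (E' := E') ε σ g u Z θ ι) (p : N) (v : E) :
    formAt 𝓘(ℝ, E) g (ι p) v (unitField ε u Z (ι p)) = 0 ↔
      v ∈ LinearMap.range (mder 𝓘(ℝ, E') 𝓘(ℝ, E) ι p : E' →ₗ[ℝ] E) := by
  rw [h.formAt_unitField_eq_zero_iff (h.incl_ne_zero p)]
  have h1 := h.gradient.mder_const_mul σ (ι p)
  constructor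
  · intro hv
    have hne : σ * u (ι p) ≠ 0 := mul_ne_zero h.sign_ne_zero (h.incl_ne_zero p)
    exact h.level.exists_mder_eq h.contMDiff_mul p (h.gradient.mder_ne_zero h.eps_sq hne)
      h.finrank_eq v (by rw [h1, hv, mul_zero])
  · rintro ⟨w, rfl⟩
    have h2 := h.level.mder_mder h.contMDiff_mul p w
    rw [h1, mul_eq_zero] at h2
    exact h2.resolve_left h.sign_ne_zero

/-- The chart expression of the induced form. -/
theorem chartForm_inducedForm (h : LevelSplitting (E' := E') ε σ g u Z θ ι) (p : N) {y : E'}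
    (hy : y ∈ (extChartAt 𝓘(ℝ, E') p).target) :
    chartForm 𝓘(ℝ, E') (inducedForm g ι) p y =
      paramForm g (fun y ↦ ι ((extChartAt 𝓘(ℝ, E') p).symm y)) y := by
  refine ContinuousLinearMap.ext fun v ↦ ContinuousLinearMap.ext fun w ↦ ?_
  rw [chartForm_eq_paramForm, paramForm_apply, paramForm_apply, inducedForm_apply,
    mder_comp_apply (h.level.contMDiff.contMDiffAt.mdifferentiableAt (by simp))
      (mdifferentiableAt_extChartAt_symm hy),
    mder_comp_apply (h.level.contMDiff.contMDiffAt.mdifferentiableAt (by simp))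
      (mdifferentiableAt_extChartAt_symm hy)]

/-- Every `z` is tangent to the level up to a multiple of `T`, and `T` is orthogonal to the level. A
tangent vector orthogonal to the level is therefore orthogonal to everything. -/
theorem inducedForm_nondegenerate (h : LevelSplitting (E' := E') ε σ g u Z θ ι) (p : N) (v : E')
    (hv : ∀ w : E', formAt 𝓘(ℝ, E') (inducedForm g ι) p v w = 0) : v = 0 := by
  refine h.level.mder_injective p ?_
  rw [map_zero]
  suffices key : ∀ z : E, formAt 𝓘(ℝ, E) g (ι p) (mder 𝓘(ℝ, E') 𝓘(ℝ, E) ι p v) z = 0 from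
    h.metric.nondegenerate (ι p) _ key
  intro z
  have hT := h.gradient.formAt_unitField_left h.eps_sq (h.incl_ne_zero p)
  have hv' := (h.formAt_mder_unitField_iff p _).2 ⟨v, rfl⟩
  let c : ℝ := formAt 𝓘(ℝ, E) g (ι p) z (Z (ι p)) / u (ι p)
  have h1 : formAt 𝓘(ℝ, E) g (ι p) (z - c • unitField ε u Z (ι p)) (unitField ε u Z (ι p)) = 0 := by
    rw [h.formAt_unitField_eq_zero_iff (h.incl_ne_zero p), map_sub, map_smul, sub_apply,
      smul_apply, hT, smul_eq_mul, div_mul_cancel₀ _ (h.incl_ne_zero p), sub_self]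
  obtain ⟨w, hw⟩ := (h.formAt_mder_unitField_iff p _).1 h1
  have h2 : formAt 𝓘(ℝ, E) g (ι p) (mder 𝓘(ℝ, E') 𝓘(ℝ, E) ι p v)
      (mder 𝓘(ℝ, E') 𝓘(ℝ, E) ι p w) = 0 := hv w
  have hw' : mder 𝓘(ℝ, E') 𝓘(ℝ, E) ι p w = z - c • unitField ε u Z (ι p) := hw
  have hv'' : formAt 𝓘(ℝ, E) g (ι p) (mder 𝓘(ℝ, E') 𝓘(ℝ, E) ι p v)
    (unitField ε u Z (ι p)) = 0 := hv'
  rw [hw', map_sub, map_smul, hv'', smul_zero, sub_zero] at h2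
  exact h2

theorem isSemiRiemannian_inducedForm (h : LevelSplitting (E' := E') ε σ g u Z θ ι) :
    IsSemiRiemannian 𝓘(ℝ, E') (inducedForm g ι) where
  symm p v w := h.metric.symm _ _ _
  nondegenerate p := h.inducedForm_nondegenerate p
  contMDiff p := by
    refine (contMDiffAt_formField_iff (inducedForm g ι) p).2 ?_
    have h1 : ContMDiffAt 𝓘(ℝ, E') 𝓘(ℝ, E) ∞ (fun y ↦ ι ((extChartAt 𝓘(ℝ, E') p).symm y))
        (extChartAt 𝓘(ℝ, E') p p) :=
      h.level.contMDiff.contMDiffAt.comp _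
        (contMDiffAt_extChartAt_symm_of_mem le_rfl (mem_extChartAt_target p))
    refine (h.metric.contDiffAt_paramForm (m := ∞) (n := ∞) (by simp) le_rfl
      h1).congr_of_eventuallyEq ?_
    filter_upwards [(isOpen_extChartAt_target p).mem_nhds (mem_extChartAt_target p)] with y hy
    exact h.chartForm_inducedForm p hy
  constant_index := by
    obtain ⟨q, hq⟩ := h.metric.constant_index
    have hT := fun p ↦ h.gradient.formAt_unitField h.eps_sq (h.incl_ne_zero p)
    -- The normal `T` has square `-ε`. For `ε = 1` it is negative and the index drops by one; for `ε
    -- = -1` it is positive and the index stays.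
    rcases h.eps_cases with rfl | rfl
    · refine ⟨q - 1, fun p ↦ ?_⟩
      exact isGreatest_negDims_of_neg (B := formAt 𝓘(ℝ, E) g (ι p))
        (B' := formAt 𝓘(ℝ, E') (inducedForm g ι) p) (h.metric.formAt_symm (ι p))
        (fun v w ↦ rfl) (h.level.mder_injective p) (h.formAt_mder_unitField_iff p) (hT p)
        (hq (ι p))
    · refine ⟨q, fun p ↦ ?_⟩
      exact isGreatest_negDims_of_pos (B := formAt 𝓘(ℝ, E) g (ι p))
        (B' := formAt 𝓘(ℝ, E') (inducedForm g ι) p) (h.metric.formAt_symm (ι p))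
        (fun v w ↦ rfl) (h.level.mder_injective p) (fun v ↦ (h.formAt_mder_unitField_iff p v).1)
        (by rw [hT p]; norm_num) (hq (ι p))

end LevelSplitting

end LevelSplitting

/-! ### The map `(s, p) ↦ θ s (ι p)` and the metric pulled back by it. -/

section SplitMap

/-- If `C` is a flow of the vector field `X`, then its derivatives in the initial value satisfy the
linearized equation. -/
theorem hasDerivAt_fderiv_of_flow {E F : Type*} [NormedAddCommGroup E] [NormedSpace ℝ E]
    [NormedAddCommGroup F] [NormedSpace ℝ F] {C : ℝ × F → E} {X : E → E} {s₀ : ℝ} {y₀ : F}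
    (hC : ContDiffAt ℝ 2 C (s₀, y₀)) (hX : DifferentiableAt ℝ X (C (s₀, y₀)))
    (hflow : (fun z ↦ fderiv ℝ C z (1, 0)) =ᶠ[nhds (s₀, y₀)] fun z ↦ X (C z)) (w : F) :
    HasDerivAt (fun s ↦ fderiv ℝ C (s, y₀) (0, w))
      (fderiv ℝ X (C (s₀, y₀)) (fderiv ℝ C (s₀, y₀) (0, w))) s₀ := by
  have hCd : HasFDerivAt C (fderiv ℝ C (s₀, y₀)) (s₀, y₀) :=
    (hC.differentiableAt (by simp)).hasFDerivAt
  have hD : ∀ a : ℝ × F, HasFDerivAt (fun z ↦ fderiv ℝ C z a)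
      ((fderiv ℝ (fderiv ℝ C) (s₀, y₀)).flip a) (s₀, y₀) := by
    intro a
    have h1 : DifferentiableAt ℝ (fderiv ℝ C) (s₀, y₀) :=
      (hC.fderiv_right (m := 1) (by norm_num)).differentiableAt (by simp)
    have h2 := h1.hasFDerivAt.clm_apply (hasFDerivAt_const a (s₀, y₀))
    simpa using h2
  have hi : HasDerivAt (fun s : ℝ ↦ (s, y₀)) (1, 0) s₀ :=
    (hasDerivAt_id s₀).prodMk (hasDerivAt_const _ _)
  have h1 := HasFDerivAt.comp_hasDerivAt (l := fun z ↦ fderiv ℝ C z (0, w))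
    (f := fun s ↦ (s, y₀)) s₀ (hD (0, w)) hi
  refine h1.congr_deriv ?_
  have h2 : HasFDerivAt (fun z ↦ X (C z)) ((fderiv ℝ X (C (s₀, y₀))).comp (fderiv ℝ C (s₀, y₀)))
    (s₀, y₀) := HasFDerivAt.comp (g := X) (f := C) (s₀, y₀) hX.hasFDerivAt hCd
  have h3 := (hD (1, 0)).unique (h2.congr_of_eventuallyEq hflow)
  -- Symmetry of the second derivative exchanges the time derivative with the derivative in the
  -- initial value.
  have h4 := (hC.isSymmSndFDerivAt (by simp)).eq (1, 0) (0, w)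
  exact h4.trans (congrArg (fun L : (ℝ × F) →L[ℝ] E ↦ L (0, w)) h3)

variable {E : Type*} [NormedAddCommGroup E] [NormedSpace ℝ E]
  {M : Type*} [TopologicalSpace M] [ChartedSpace E M]
  {E' : Type*} [NormedAddCommGroup E'] [NormedSpace ℝ E']
  {N : Type*} [TopologicalSpace N] [ChartedSpace E' N]

/-- The map `(s, p) ↦ θ s (ι p)`. -/
def splitMap (θ : ℝ → M → M) (ι : N → M) (x : ℝ × N) : M := θ x.1 (ι x.2)

variable [FiniteDimensional ℝ E] [FiniteDimensional ℝ E'] [IsManifold 𝓘(ℝ, E) ∞ M]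
  [IsManifold 𝓘(ℝ, E') ∞ N] [T2Space M]

namespace LevelSplitting

variable {ε σ : ℝ} {g : FormField 𝓘(ℝ, E) M} {u : M → ℝ} {Z : M → E} {θ : ℝ → M → M} {ι : N → M}

theorem contMDiff_splitMap (h : LevelSplitting (E' := E') ε σ g u Z θ ι) :
    ContMDiff (𝓘(ℝ, ℝ).prod 𝓘(ℝ, E')) 𝓘(ℝ, E) ∞ (splitMap θ ι) := fun x ↦
  ContMDiffAt.comp (g := fun x : ℝ × M ↦ θ x.1 x.2) (f := fun x : ℝ × N ↦ (x.1, ι x.2)) x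
    (h.flow.contMDiffAt h.metric h.gradient h.eps_sq (h.incl_ne_zero x.2) x.1)
    (contMDiffAt_fst.prodMk (h.level.contMDiff.contMDiffAt.comp x contMDiffAt_snd))

theorem mdifferentiableAt_splitMap (h : LevelSplitting (E' := E') ε σ g u Z θ ι) (x : ℝ × N) :
    MDifferentiableAt (𝓘(ℝ, ℝ).prod 𝓘(ℝ, E')) 𝓘(ℝ, E) (splitMap θ ι) x :=
  h.contMDiff_splitMap.contMDiffAt.mdifferentiableAt (by simp)

theorem apply_splitMap (h : LevelSplitting (E' := E') ε σ g u Z θ ι) (x : ℝ × N) :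
    u (splitMap θ ι x) = σ * Real.exp x.1 := by
  rw [splitMap, h.flow.apply_eq_mul_exp h.metric h.gradient h.eps_sq (h.incl_ne_zero x.2),
    h.apply_incl]

theorem splitMap_ne_zero (h : LevelSplitting (E' := E') ε σ g u Z θ ι) (x : ℝ × N) :
    u (splitMap θ ι x) ≠ 0 := by
  rw [h.apply_splitMap]
  exact mul_ne_zero h.sign_ne_zero (Real.exp_ne_zero _)

theorem mder_splitMap_one (h : LevelSplitting (E' := E') ε σ g u Z θ ι) (x : ℝ × N) :
    mder (𝓘(ℝ, ℝ).prod 𝓘(ℝ, E')) 𝓘(ℝ, E) (splitMap θ ι) x (1, 0) =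
      unitField ε u Z (splitMap θ ι x) := by
  have h1 := h.flow.velocity_eq h.metric h.gradient h.eps_sq (h.incl_ne_zero x.2) x.1
  have h2 : MDifferentiableAt 𝓘(ℝ, ℝ) (𝓘(ℝ, ℝ).prod 𝓘(ℝ, E')) (fun s : ℝ ↦ (s, x.2)) x.1 :=
    mdifferentiableAt_id.prodMk mdifferentiableAt_const
  have h3 := mder_comp_apply (h := splitMap θ ι) (f := fun s : ℝ ↦ (s, x.2))
    (h.mdifferentiableAt_splitMap x) h2 1
  rw [mder_prodMk (f := fun s : ℝ ↦ s) mdifferentiableAt_id mdifferentiableAt_const,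
    mder_const] at h3
  have h4 : mder 𝓘(ℝ, ℝ) 𝓘(ℝ, ℝ) (fun s : ℝ ↦ s) x.1 = ContinuousLinearMap.id ℝ ℝ := mder_id x.1
  rw [h4] at h3
  exact h3.symm.trans h1

theorem mder_splitMap_zero (h : LevelSplitting (E' := E') ε σ g u Z θ ι) (p : N) (w : E') :
    mder (𝓘(ℝ, ℝ).prod 𝓘(ℝ, E')) 𝓘(ℝ, E) (splitMap θ ι) (0, p) (0, w) =
      mder 𝓘(ℝ, E') 𝓘(ℝ, E) ι p w := by
  have h2 : MDifferentiableAt 𝓘(ℝ, E') (𝓘(ℝ, ℝ).prod 𝓘(ℝ, E')) (fun q : N ↦ ((0 : ℝ), q)) p :=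
    mdifferentiableAt_const.prodMk mdifferentiableAt_id
  have h3 := mder_comp_apply (h := splitMap θ ι) (f := fun q : N ↦ ((0 : ℝ), q))
    (h.mdifferentiableAt_splitMap (0, p)) h2 w
  rw [mder_prodMk (h := fun q : N ↦ q) mdifferentiableAt_const mdifferentiableAt_id,
    mder_const] at h3
  have h4 : mder 𝓘(ℝ, E') 𝓘(ℝ, E') (fun q : N ↦ q) p = ContinuousLinearMap.id ℝ E' := mder_id p
  have h5 : (fun q ↦ splitMap θ ι ((0 : ℝ), q)) = ι := funext fun q ↦ h.flow.zero (ι q)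
  rw [h4, h5] at h3
  exact h3.symm

/-- The tangent vectors of the level sets are orthogonal to the gradient. -/
theorem formAt_mder_splitMap_gradient (h : LevelSplitting (E' := E') ε σ g u Z θ ι) (x : ℝ × N)
    (w : E') : formAt 𝓘(ℝ, E) g (splitMap θ ι x)
      (mder (𝓘(ℝ, ℝ).prod 𝓘(ℝ, E')) 𝓘(ℝ, E) (splitMap θ ι) x (0, w)) (Z (splitMap θ ι x)) = 0 := by
  have hu : MDifferentiableAt 𝓘(ℝ, E) 𝓘(ℝ, ℝ) u (splitMap θ ι x) :=
    h.gradient.contMDiff.contMDiffAt.mdifferentiableAt (by simp)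
  rw [← h.gradient.mder_eq, ← mder_comp_apply hu (h.mdifferentiableAt_splitMap x)]
  have e : (fun x ↦ u (splitMap θ ι x)) = fun x : ℝ × N ↦ σ * Real.exp x.1 :=
    funext h.apply_splitMap
  have hd : Differentiable ℝ (fun s : ℝ ↦ σ * Real.exp s) := by fun_prop
  rw [e, mder_comp_apply (h := fun s : ℝ ↦ σ * Real.exp s) (f := Prod.fst) (I' := 𝓘(ℝ, ℝ))
    (hd _).mdifferentiableAt mdifferentiableAt_fst, mder_fst]
  exact map_zero _

/-- The map `(s, y) ↦ θ s (ι (κ⁻¹ y))`, where `κ` is the chart at `p`. -/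
def splitParam (θ : ℝ → M → M) (ι : N → M) (p : N) (z : ℝ × E') : M :=
  splitMap θ ι (z.1, (extChartAt 𝓘(ℝ, E') p).symm z.2)

theorem contMDiffAt_splitParam (h : LevelSplitting (E' := E') ε σ g u Z θ ι) (p : N) {z : ℝ × E'}
    (hz : z.2 ∈ (extChartAt 𝓘(ℝ, E') p).target) :
    ContMDiffAt 𝓘(ℝ, ℝ × E') 𝓘(ℝ, E) ∞ (splitParam θ ι p) z := by
  refine ContMDiffAt.comp (f := fun z : ℝ × E' ↦ (z.1, (extChartAt 𝓘(ℝ, E') p).symm z.2)) z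
    h.contMDiff_splitMap.contMDiffAt ?_
  refine ContMDiffAt.prodMk contDiff_fst.contMDiff.contMDiffAt ?_
  exact ContMDiffAt.comp (f := Prod.snd) z (contMDiffAt_extChartAt_symm_of_mem le_rfl hz)
    contDiff_snd.contMDiff.contMDiffAt

theorem mder_splitParam (h : LevelSplitting (E' := E') ε σ g u Z θ ι) (p : N) {z : ℝ × E'}
    (hz : z.2 ∈ (extChartAt 𝓘(ℝ, E') p).target) (v : ℝ × E') :
    mder 𝓘(ℝ, ℝ × E') 𝓘(ℝ, E) (splitParam θ ι p) z v =
      mder (𝓘(ℝ, ℝ).prod 𝓘(ℝ, E')) 𝓘(ℝ, E) (splitMap θ ι) (z.1, (extChartAt 𝓘(ℝ, E') p).symm z.2)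
        (v.1, mder 𝓘(ℝ, E') 𝓘(ℝ, E') (extChartAt 𝓘(ℝ, E') p).symm z.2 v.2) := by
  have h1 : MDifferentiableAt 𝓘(ℝ, ℝ × E') 𝓘(ℝ, ℝ) (Prod.fst : ℝ × E' → ℝ) z :=
    differentiableAt_fst.mdifferentiableAt
  have h2 : MDifferentiableAt 𝓘(ℝ, ℝ × E') 𝓘(ℝ, E') (Prod.snd : ℝ × E' → E') z :=
    differentiableAt_snd.mdifferentiableAt
  have h3 := mdifferentiableAt_extChartAt_symm hz
  have h4 : MDifferentiableAt 𝓘(ℝ, ℝ × E') 𝓘(ℝ, E')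
      (fun z : ℝ × E' ↦ (extChartAt 𝓘(ℝ, E') p).symm z.2) z := h3.comp z h2
  refine (mder_comp_apply (h := splitMap θ ι)
    (f := fun z : ℝ × E' ↦ (z.1, (extChartAt 𝓘(ℝ, E') p).symm z.2))
    (h.mdifferentiableAt_splitMap _) (h1.prodMk h4) v).trans ?_
  rw [mder_prodMk h1 h4, mder_comp h3 h2, mder_eq_fderiv, mder_eq_fderiv, fderiv_fst, fderiv_snd]
  rfl

/-- A field `X` transported by the flow satisfies `∇_T X = ∇_X T`. If `X` is tangent to the levels
this equals `X`, so `g(X, X')' = g(X, X') + g(X, X')`. -/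
theorem hasDerivAt_formAt_splitMap (h : LevelSplitting (E' := E') ε σ g u Z θ ι) (p : N)
    (w w' : E') (s₀ : ℝ) :
    HasDerivAt (fun s ↦ formAt 𝓘(ℝ, E) g (splitMap θ ι (s, p))
      (mder (𝓘(ℝ, ℝ).prod 𝓘(ℝ, E')) 𝓘(ℝ, E) (splitMap θ ι) (s, p) (0, w))
      (mder (𝓘(ℝ, ℝ).prod 𝓘(ℝ, E')) 𝓘(ℝ, E) (splitMap θ ι) (s, p) (0, w')))
      (2 * formAt 𝓘(ℝ, E) g (splitMap θ ι (s₀, p))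
      (mder (𝓘(ℝ, ℝ).prod 𝓘(ℝ, E')) 𝓘(ℝ, E) (splitMap θ ι) (s₀, p) (0, w))
      (mder (𝓘(ℝ, ℝ).prod 𝓘(ℝ, E')) 𝓘(ℝ, E) (splitMap θ ι) (s₀, p) (0, w'))) s₀ := by
  have hle : (2 : WithTop ℕ∞) ≤ ∞ := WithTop.coe_le_coe.2 le_top
  obtain ⟨x₀, hx₀⟩ : ∃ x₀, x₀ = splitMap θ ι (s₀, p) := ⟨_, rfl⟩
  obtain ⟨y₀, hy₀⟩ : ∃ y₀, y₀ = extChartAt 𝓘(ℝ, E') p p := ⟨_, rfl⟩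
  have hy₀t : y₀ ∈ (extChartAt 𝓘(ℝ, E') p).target := hy₀ ▸ mem_extChartAt_target p
  have hy₀p : (extChartAt 𝓘(ℝ, E') p).symm y₀ = p := by rw [hy₀, extChartAt_to_inv]
  have hψ₀ : splitParam θ ι p (s₀, y₀) = x₀ := by rw [hx₀, splitParam, hy₀p]
  have hψ := h.contMDiffAt_splitParam p (z := (s₀, y₀)) hy₀t
  have hsrc : splitParam θ ι p (s₀, y₀) ∈ (extChartAt 𝓘(ℝ, E) x₀).source := by
    rw [hψ₀]; exact mem_extChartAt_source x₀
  let C : ℝ × E' → E := fun z ↦ extChartAt 𝓘(ℝ, E) x₀ (splitParam θ ι p z)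
  have hC : ContDiffAt ℝ 2 C (s₀, y₀) := contDiffAt_extChartAt_comp hle (hψ.of_le hle) hsrc
  have hC₀ : C (s₀, y₀) = extChartAt 𝓘(ℝ, E) x₀ x₀ := congrArg _ hψ₀
  have hev : ∀ᶠ z in nhds (s₀, y₀), z.2 ∈ (extChartAt 𝓘(ℝ, E') p).target ∧
      splitParam θ ι p z ∈ (extChartAt 𝓘(ℝ, E) x₀).source :=
    (continuous_snd.continuousAt.eventually_mem
      ((isOpen_extChartAt_target p).mem_nhds hy₀t)).and
      (eventually_mem_extChartAt_source hψ.continuousAt hsrc)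
  have hD : ∀ z, z.2 ∈ (extChartAt 𝓘(ℝ, E') p).target →
      splitParam θ ι p z ∈ (extChartAt 𝓘(ℝ, E) x₀).source → ∀ v, fderiv ℝ C z v =
      mder 𝓘(ℝ, E) 𝓘(ℝ, E) (extChartAt 𝓘(ℝ, E) x₀) (splitParam θ ι p z)
        (mder 𝓘(ℝ, ℝ × E') 𝓘(ℝ, E) (splitParam θ ι p) z v) := fun z hz hz' v ↦
    fderiv_extChartAt_comp ((h.contMDiffAt_splitParam p hz).mdifferentiableAt (by simp)) hz' v
  have hmy : ∀ s w, mder 𝓘(ℝ, ℝ × E') 𝓘(ℝ, E) (splitParam θ ι p) (s, y₀) (0, w) =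
      mder (𝓘(ℝ, ℝ).prod 𝓘(ℝ, E')) 𝓘(ℝ, E) (splitMap θ ι) (s, p) (0, w) := by
    intro s w
    rw [h.mder_splitParam p hy₀t]
    simp only
    rw [hy₀, mder_extChartAt_symm_self, extChartAt_to_inv]
    rfl
  have hT : (fun z ↦ fderiv ℝ C z (1, 0)) =ᶠ[nhds (s₀, y₀)]
      fun z ↦ chartVec (unitField ε u Z) x₀ (C z) := by
    filter_upwards [hev] with z hz
    rw [hD z hz.1 hz.2, h.mder_splitParam p hz.1]
    simp only [map_zero]
    rw [h.mder_splitMap_one, chartVec_extChartAt _ hz.2]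
    rfl
  have hx₀ne : u x₀ ≠ 0 := hx₀ ▸ h.splitMap_ne_zero _
  have hTd : DifferentiableAt ℝ (chartVec (unitField ε u Z) x₀) (C (s₀, y₀)) := by
    rw [hC₀]
    exact (h.gradient.contDiffAt_chartVec_unitField hx₀ne).differentiableAt (by simp)
  have hi : HasDerivAt (fun s : ℝ ↦ (s, y₀)) (1, 0) s₀ :=
    (hasDerivAt_id s₀).prodMk (hasDerivAt_const _ _)
  have hCd : HasFDerivAt C (fderiv ℝ C (s₀, y₀)) (s₀, y₀) :=
    (hC.differentiableAt (by simp)).hasFDerivAt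
  have hc : HasDerivAt (fun s ↦ C (s, y₀)) (fderiv ℝ C (s₀, y₀) (1, 0)) s₀ :=
    HasFDerivAt.comp_hasDerivAt (l := C) (f := fun s ↦ (s, y₀)) s₀ hCd hi
  have ha := hasDerivAt_fderiv_of_flow hC hTd hT
  have hG : DifferentiableAt ℝ (chartForm 𝓘(ℝ, E) g x₀) (C (s₀, y₀)) := by
    rw [hC₀]; exact (h.metric.contDiffAt_chartForm x₀).differentiableAt (by simp)
  have hmain := hasDerivAt_bilin hG hc (ha w) (ha w')
  have hA : ∀ w, fderiv ℝ C (s₀, y₀) (0, w) =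
      mder (𝓘(ℝ, ℝ).prod 𝓘(ℝ, E')) 𝓘(ℝ, E) (splitMap θ ι) (s₀, p) (0, w) := by
    intro w
    have : IsManifold 𝓘(ℝ, E) 1 M := .of_le (n := ∞) (by exact_mod_cast le_top)
    rw [hD _ hy₀t hsrc, hmy, hψ₀, mder_extChartAt_self]
    rfl
  have hT₀ : fderiv ℝ C (s₀, y₀) (1, 0) = unitField ε u Z x₀ := by
    have := hT.self_of_nhds
    simp only at this
    rw [this, hC₀, chartVec_self]
  refine (hmain.congr_deriv ?_).congr_of_eventuallyEq ?_
  · have hZ := h.formAt_mder_splitMap_gradient (s₀, p)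
    rw [← hx₀] at hZ ⊢
    have hcov := h.gradient.covariant_unitField h.eps_sq hx₀ne
    -- The correction term in `∇_X T` carries the factor `g(X, Z) = 0`.
    have c1 := hcov (fderiv ℝ C (s₀, y₀) (0, w)) (fderiv ℝ C (s₀, y₀) (0, w'))
    have c2 := hcov (fderiv ℝ C (s₀, y₀) (0, w')) (fderiv ℝ C (s₀, y₀) (0, w))
    rw [hT₀, hC₀, chartForm_self, chartForm_self]
    rw [hA, hA, hZ, zero_div, zero_mul, sub_zero] at c1 c2
    rw [hA, hA]
    have hs : ∀ᶠ y in nhds (extChartAt 𝓘(ℝ, E) x₀ x₀), ∀ v w,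
        chartForm 𝓘(ℝ, E) g x₀ y v w = chartForm 𝓘(ℝ, E) g x₀ y w v :=
      Filter.Eventually.of_forall fun y v w ↦ h.metric.paramForm_symm _ y v w
    rw [hC₀] at hG
    have h7 := fderiv_bilin_symm hG hs
    obtain ⟨a, ha⟩ : ∃ a, a = mder (𝓘(ℝ, ℝ).prod 𝓘(ℝ, E')) 𝓘(ℝ, E) (splitMap θ ι) (s₀, p) (0, w) :=
      ⟨_, rfl⟩
    obtain ⟨b, hb⟩ : ∃ b, b = mder (𝓘(ℝ, ℝ).prod 𝓘(ℝ, E')) 𝓘(ℝ, E) (splitMap θ ι) (s₀, p) (0, w') :=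
      ⟨_, rfl⟩
    rw [← ha, ← hb] at c1 c2 ⊢
    unfold coordChristoffel at c1 c2
    rw [h7 b (unitField ε u Z x₀) a, h7 (unitField ε u Z x₀) b a, h7 a b (unitField ε u Z x₀),
      h.metric.formAt_symm x₀ b a, h.metric.formAt_symm x₀ _ a] at c2
    linarith
  · have h1 : ∀ᶠ s in nhds s₀, splitParam θ ι p (s, y₀) ∈ (extChartAt 𝓘(ℝ, E) x₀).source :=
      (hi.continuousAt.eventually hev).mono fun s hs ↦ hs.2
    filter_upwards [h1] with s hs
    rw [hD _ hy₀t hs, hD _ hy₀t hs, chartForm_mder g hs, hmy, hmy]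
    simp only [splitParam, hy₀p]

/-- After multiplication by `e^{-2s}` the product has zero derivative in `s`, and at `s = 0` it is
the induced metric. -/
theorem formAt_mder_splitMap_level (h : LevelSplitting (E' := E') ε σ g u Z θ ι) (x : ℝ × N)
    (w w' : E') :
    formAt 𝓘(ℝ, E) g (splitMap θ ι x)
      (mder (𝓘(ℝ, ℝ).prod 𝓘(ℝ, E')) 𝓘(ℝ, E) (splitMap θ ι) x (0, w))
      (mder (𝓘(ℝ, ℝ).prod 𝓘(ℝ, E')) 𝓘(ℝ, E) (splitMap θ ι) x (0, w')) =
    Real.exp (2 * x.1) * formAt 𝓘(ℝ, E') (inducedForm g ι) x.2 w w' := by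
  obtain ⟨s, p⟩ := x
  have h1 := h.hasDerivAt_formAt_splitMap p w w'
  have h2 : ∀ s, HasDerivAt (fun s : ℝ ↦ Real.exp (-(2 * s))) (Real.exp (-(2 * s)) * (-2)) s := by
    intro s
    have := ((hasDerivAt_id s).const_mul 2).neg.exp
    simpa using this
  have h3 := fun s ↦ ((h2 s).mul (h1 s)).congr_deriv (g' := 0) (by ring)
  have h4 := is_const_of_deriv_eq_zero (fun s ↦ (h3 s).differentiableAt) (fun s ↦ (h3 s).deriv) s 0
  simp only [Pi.mul_apply, mul_zero, neg_zero, Real.exp_zero, one_mul] at h4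
  rw [h.mder_splitMap_zero, h.mder_splitMap_zero] at h4
  have h5 : splitMap θ ι ((0 : ℝ), p) = ι p := h.flow.zero (ι p)
  rw [h5, ← inducedForm_apply] at h4
  rw [← h4, ← mul_assoc, ← Real.exp_add]
  simp

/-- The pull-back of the metric under `(s, p) ↦ θ s (ι p)` is `-ε ds² + e^{2 s} g_N`. -/
theorem formAt_mder_splitMap (h : LevelSplitting (E' := E') ε σ g u Z θ ι) (x : ℝ × N)
    (v w : ℝ × E') :
    formAt 𝓘(ℝ, E) g (splitMap θ ι x)
      (mder (𝓘(ℝ, ℝ).prod 𝓘(ℝ, E')) 𝓘(ℝ, E) (splitMap θ ι) x v)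
      (mder (𝓘(ℝ, ℝ).prod 𝓘(ℝ, E')) 𝓘(ℝ, E) (splitMap θ ι) x w) =
    -ε * (v.1 * w.1) + Real.exp (2 * x.1) * formAt 𝓘(ℝ, E') (inducedForm g ι) x.2 v.2 w.2 := by
  have hsplit : ∀ v : ℝ × E', mder (𝓘(ℝ, ℝ).prod 𝓘(ℝ, E')) 𝓘(ℝ, E) (splitMap θ ι) x v =
      v.1 • unitField ε u Z (splitMap θ ι x) +
      mder (𝓘(ℝ, ℝ).prod 𝓘(ℝ, E')) 𝓘(ℝ, E) (splitMap θ ι) x (0, v.2) := by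
    intro v
    rw [← h.mder_splitMap_one, ← map_smul, ← map_add]
    congr 1
    ext <;> simp
  have h1 := fun w ↦ (h.formAt_unitField_eq_zero_iff (h.splitMap_ne_zero x) _).2
    (h.formAt_mder_splitMap_gradient x w)
  have h2 := h.gradient.formAt_unitField h.eps_sq (h.splitMap_ne_zero x)
  have h3 := fun w ↦ (h.metric.formAt_symm _ _ _).trans (h1 w)
  rw [hsplit v, hsplit w]
  simp only [map_add, map_smul, add_apply, smul_apply, smul_eq_mul, h1, h2, h3,
    h.formAt_mder_splitMap_level]
  ring

end LevelSplitting

end SplitMap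

/-! ### The diffeomorphism from `ℝ × N` onto `{σ u > 0}`. -/

section SplitDiffeo

variable {E : Type*} [NormedAddCommGroup E] [NormedSpace ℝ E]
  {M : Type*} [TopologicalSpace M] [ChartedSpace E M]
  {E' : Type*} [NormedAddCommGroup E'] [NormedSpace ℝ E']
  {N : Type*} [TopologicalSpace N] [ChartedSpace E' N]

/-- The projection to the level `{σ u = 1}` along the flow lines. -/
def levelProj (σ : ℝ) (u : M → ℝ) (θ : ℝ → M → M) (q : M) : M := θ (-Real.log (σ * u q)) q

variable [FiniteDimensional ℝ E] [FiniteDimensional ℝ E'] [IsManifold 𝓘(ℝ, E) ∞ M]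
  [IsManifold 𝓘(ℝ, E') ∞ N] [T2Space M]

namespace LevelSplitting

variable {ε σ : ℝ} {g : FormField 𝓘(ℝ, E) M} {u : M → ℝ} {Z : M → E} {θ : ℝ → M → M} {ι : N → M}

/-- Flowing for time `-log (σ u q)` multiplies `σ u` by `(σ u q)⁻¹`, which lands on the level `1`.
-/
theorem exists_incl_eq (h : LevelSplitting (E' := E') ε σ g u Z θ ι) {q : M} (hq : 0 < σ * u q) :
    ∃ p, ι p = levelProj σ u θ q := by
  have h1 : levelProj σ u θ q ∈ {q | σ * u q = 1} := by
    have h2 := h.flow.apply_eq_mul_exp h.metric h.gradient h.eps_sq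
      (right_ne_zero_of_mul hq.ne') (-Real.log (σ * u q))
    rw [mem_ofPred_eq, levelProj, h2, ← mul_assoc, Real.exp_neg, Real.exp_log hq,
      mul_inv_cancel₀ hq.ne']
  rw [← h.level.range_eq] at h1
  exact h1

theorem contMDiffAt_levelProj (h : LevelSplitting (E' := E') ε σ g u Z θ ι) {q : M}
    (hq : 0 < σ * u q) : ContMDiffAt 𝓘(ℝ, E) 𝓘(ℝ, E) ∞ (levelProj σ u θ) q := by
  have h1 : ContMDiffAt 𝓘(ℝ, E) 𝓘(ℝ, ℝ) ∞ (fun q ↦ -Real.log (σ * u q)) q :=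
    ContMDiffAt.comp (g := fun t : ℝ ↦ -Real.log t) (f := fun q ↦ σ * u q) q
      (Real.contDiffAt_log.2 hq.ne').neg.contMDiffAt h.contMDiff_mul.contMDiffAt
  exact ContMDiffAt.comp (g := fun x : ℝ × M ↦ θ x.1 x.2)
    (f := fun q ↦ (-Real.log (σ * u q), q)) q
    (h.flow.contMDiffAt h.metric h.gradient h.eps_sq (right_ne_zero_of_mul hq.ne') _)
    (h1.prodMk contMDiffAt_id)

theorem splitMap_of_incl_eq (h : LevelSplitting (E' := E') ε σ g u Z θ ι) {q : M}
    (hq : 0 < σ * u q) {p : N} (hp : ι p = levelProj σ u θ q) :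
    splitMap θ ι (Real.log (σ * u q), p) = q := by
  rw [splitMap, hp, levelProj, ← h.flow.add h.metric h.gradient h.eps_sq
    (right_ne_zero_of_mul hq.ne'), add_neg_cancel, h.flow.zero]

theorem mul_apply_splitMap (h : LevelSplitting (E' := E') ε σ g u Z θ ι) (x : ℝ × N) :
    σ * u (splitMap θ ι x) = Real.exp x.1 := by
  rw [h.apply_splitMap, ← mul_assoc, h.sign_sq, one_mul]

theorem levelProj_splitMap (h : LevelSplitting (E' := E') ε σ g u Z θ ι) (x : ℝ × N) :
    levelProj σ u θ (splitMap θ ι x) = ι x.2 := by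
  rw [levelProj, h.mul_apply_splitMap, Real.log_exp, splitMap, ← h.flow.add h.metric h.gradient
    h.eps_sq (h.incl_ne_zero x.2), neg_add_cancel, h.flow.zero]

/-- The open set `{σ u > 0}`. -/
def domain (h : LevelSplitting (E' := E') ε σ g u Z θ ι) : Opens M :=
  ⟨{q | 0 < σ * u q}, isOpen_lt continuous_const h.contMDiff_mul.continuous⟩

/-- The projection of `{σ u > 0}` to the level set. -/
def proj (h : LevelSplitting (E' := E') ε σ g u Z θ ι) (q : h.domain) : N :=
  (h.exists_incl_eq q.2).choose

theorem incl_proj (h : LevelSplitting (E' := E') ε σ g u Z θ ι) (q : h.domain) :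
    ι (h.proj q) = levelProj σ u θ q :=
  (h.exists_incl_eq q.2).choose_spec

/-- The diffeomorphism `(s, p) ↦ θ s (ι p)` onto `{σ u > 0}`. -/
def splitDiffeo (h : LevelSplitting (E' := E') ε σ g u Z θ ι) :
    (ℝ × N) ≃ₘ^∞⟮𝓘(ℝ, ℝ).prod 𝓘(ℝ, E'), 𝓘(ℝ, E)⟯ h.domain where
  toFun x := ⟨splitMap θ ι x, by
    change 0 < σ * u (splitMap θ ι x)
    rw [h.mul_apply_splitMap]; exact Real.exp_pos _⟩
  invFun q := (Real.log (σ * u q), h.proj q)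
  left_inv x := by
    refine Prod.ext ?_ ?_
    · change Real.log (σ * u (splitMap θ ι x)) = x.1
      rw [h.mul_apply_splitMap, Real.log_exp]
    · refine h.level.isEmbedding.injective ?_
      rw [h.incl_proj, ← h.levelProj_splitMap]
  right_inv q := Subtype.ext (h.splitMap_of_incl_eq q.2 (h.incl_proj q))
  contMDiff_toFun := (ContMDiff.subtypeVal_comp_iff h.domain _).1 h.contMDiff_splitMap
  contMDiff_invFun q := by
    have hv : ContMDiffAt 𝓘(ℝ, E) 𝓘(ℝ, E) ∞ (Subtype.val : h.domain → M) q :=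
      contMDiff_subtype_val.contMDiffAt
    refine ContMDiffAt.prodMk ?_ ?_
    · exact ContMDiffAt.comp (g := fun q ↦ Real.log (σ * u q)) (f := Subtype.val) q
        (ContMDiffAt.comp (g := Real.log) (f := fun q ↦ σ * u q) q.1
          (Real.contDiffAt_log.2 q.2.ne').contMDiffAt h.contMDiff_mul.contMDiffAt) hv
    -- `proj` is defined by choice; its composite with `ι` is the smooth map `levelProj`.
    · refine h.level.contMDiffAt_of_comp ?_
      have e : (fun q ↦ ι (h.proj q)) = fun q : h.domain ↦ levelProj σ u θ q := funext h.incl_proj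
      rw [e]
      exact ContMDiffAt.comp (f := Subtype.val) q (h.contMDiffAt_levelProj q.2) hv

theorem coe_splitDiffeo (h : LevelSplitting (E' := E') ε σ g u Z θ ι) (x : ℝ × N) :
    (h.splitDiffeo x : M) = splitMap θ ι x := rfl

theorem isIsometry_splitDiffeo (h : LevelSplitting (E' := E') ε σ g u Z θ ι) :
    IsIsometry _ _ (expWarpedMetric 𝓘(ℝ, E') ε (inducedForm g ι))
      (restrictForm 𝓘(ℝ, E) g h.domain) h.splitDiffeo := by
  intro x
  suffices key : ∀ v w : ℝ × E', formAt 𝓘(ℝ, E) (restrictForm 𝓘(ℝ, E) g h.domain) (h.splitDiffeo x)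
      (mder (𝓘(ℝ, ℝ).prod 𝓘(ℝ, E')) 𝓘(ℝ, E) h.splitDiffeo x v)
      (mder (𝓘(ℝ, ℝ).prod 𝓘(ℝ, E')) 𝓘(ℝ, E) h.splitDiffeo x w) =
      formAt (𝓘(ℝ, ℝ).prod 𝓘(ℝ, E')) (expWarpedMetric 𝓘(ℝ, E') ε (inducedForm g ι)) x v w from key
  intro v w
  have e : ∀ v, mder (𝓘(ℝ, ℝ).prod 𝓘(ℝ, E')) 𝓘(ℝ, E) (splitMap θ ι) x v =
      mder (𝓘(ℝ, ℝ).prod 𝓘(ℝ, E')) 𝓘(ℝ, E) h.splitDiffeo x v := by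
    intro v
    have h1 := mder_comp_apply (h := (Subtype.val : h.domain → M)) (f := h.splitDiffeo) (x := x)
      (hasMFDerivAt_subtype_val _ _).mdifferentiableAt
      (h.splitDiffeo.contMDiff.contMDiffAt.mdifferentiableAt (by simp)) v
    rw [mder_subtype_val] at h1
    exact h1
  rw [restrictForm_apply, expWarpedMetric_apply, ← e, ← e, coe_splitDiffeo,
    h.formAt_mder_splitMap]

end LevelSplitting

end SplitDiffeo

/-! ### Null coordinates on the cone over a warped product. -/

section WaveDiffeo

variable {E : Type*} [NormedAddCommGroup E] [NormedSpace ℝ E]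
  {H : Type*} [TopologicalSpace H] {I : ModelWithCorners ℝ E H}
  {M : Type*} [TopologicalSpace M] [ChartedSpace H M]
  {E' : Type*} [NormedAddCommGroup E'] [NormedSpace ℝ E']
  {H' : Type*} [TopologicalSpace H'] {J : ModelWithCorners ℝ E' H'}
  {N : Type*} [TopologicalSpace N] [ChartedSpace H' N]

theorem Diffeomorph.mder_mder_symm (Φ : M ≃ₘ^∞⟮I, J⟯ N) (y : N) (v : E') :
    mder I J Φ (Φ.symm y) (mder J I Φ.symm y v) = v := by
  rw [← mder_comp_apply (Φ.contMDiff.contMDiffAt.mdifferentiableAt (by simp))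
    (Φ.symm.contMDiff.contMDiffAt.mdifferentiableAt (by simp))]
  have e : (fun y ↦ Φ (Φ.symm y)) = fun y ↦ y := funext Φ.apply_symm_apply
  rw [e, mder_id]
  rfl

theorem IsIsometry.formAt_symm {g : FormField I M} {k : FormField J N} {Φ : M ≃ₘ^∞⟮I, J⟯ N}
    (hΦ : IsIsometry I J g k Φ) (y : N) (v w : E') :
    formAt I g (Φ.symm y) (mder J I Φ.symm y v) (mder J I Φ.symm y w) = formAt J k y v w := by
  have h2 : formAt J k (Φ (Φ.symm y)) (mder I J Φ (Φ.symm y) (mder J I Φ.symm y v))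
      (mder I J Φ (Φ.symm y) (mder J I Φ.symm y w)) =
      formAt I g (Φ.symm y) (mder J I Φ.symm y v) (mder J I Φ.symm y w) := hΦ _ _ _
  rw [← h2, Φ.mder_mder_symm, Φ.mder_mder_symm, Φ.apply_symm_apply]

theorem mder_coe_opens {U : Opens N} {f : M → U} {x : M} (hf : MDifferentiableAt I J f x) :
    mder I J (fun x ↦ (f x : N)) x = mder I J f x := by
  rw [mder_comp (h := (Subtype.val : U → N)) (I' := J)
    (hasMFDerivAt_subtype_val _ _).mdifferentiableAt hf, mder_subtype_val]
  rfl

theorem ContMDiff.mdiffAt {f : M → N} (hf : ContMDiff I J ∞ f) (x : M) :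
    MDifferentiableAt I J f x :=
  hf.contMDiffAt.mdifferentiableAt (by simp)

theorem mder_mul {p q : M → ℝ} {x : M} (hp : MDifferentiableAt I 𝓘(ℝ, ℝ) p x)
    (hq : MDifferentiableAt I 𝓘(ℝ, ℝ) q x) (v : E) :
    mder I 𝓘(ℝ, ℝ) (fun x ↦ p x * q x) x v =
      p x * mder I 𝓘(ℝ, ℝ) q x v + q x * mder I 𝓘(ℝ, ℝ) p x v :=
  congrArg (fun L : E →L[ℝ] ℝ ↦ L v) (hp.hasMFDerivAt.mul hq.hasMFDerivAt).mfderiv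

theorem mder_real_comp {F : ℝ → ℝ} {F' : ℝ} {p : M → ℝ} {x : M}
    (hp : MDifferentiableAt I 𝓘(ℝ, ℝ) p x) (hF : HasDerivAt F F' (p x)) (v : E) :
    mder I 𝓘(ℝ, ℝ) (fun x ↦ F (p x)) x v = F' * mder I 𝓘(ℝ, ℝ) p x v := by
  rw [mder_comp_apply (h := F) (I' := 𝓘(ℝ, ℝ)) hF.differentiableAt.mdifferentiableAt hp,
    mder_eq_fderiv, hF.hasFDerivAt.fderiv]
  simp [mul_comm]

/-- Inverts `a = r e^s`, `b = (ε/2) r e^{-s}`: the product gives `r² = 2 ε a b`, and the quotient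
gives `e^{2s} = a / (2 ε b)`. -/
theorem mul_mul_inv_exp_eq {ε a b : ℝ} (hε : ε = 1 ∨ ε = -1) (ha : 0 < 1 * a) (hb : 0 < ε * b) :
    0 < 2 * ε * (a * b) ∧ 0 < a / (2 * ε * b) ∧
    Real.sqrt (2 * ε * (a * b)) * Real.exp (Real.log (a / (2 * ε * b)) / 2) = a ∧
    ε / 2 * Real.sqrt (2 * ε * (a * b)) * Real.exp (-(Real.log (a / (2 * ε * b)) / 2)) = b := by
  have hεε : ε * ε = 1 := by rcases hε with rfl | rfl <;> norm_num
  rw [one_mul] at ha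
  have h1 : 0 < 2 * ε * b := by linarith
  have h2 : 0 < 2 * ε * (a * b) := by
    have := mul_pos ha h1
    linarith
  have h3 : 0 < a / (2 * ε * b) := div_pos ha h1
  have h4 : Real.exp (Real.log (a / (2 * ε * b)) / 2) = Real.sqrt (a / (2 * ε * b)) := by
    rw [← Real.log_sqrt h3.le, Real.exp_log (Real.sqrt_pos.2 h3)]
  have h5 : Real.sqrt (2 * ε * (a * b)) * Real.sqrt (a / (2 * ε * b)) = a := by
    rw [← Real.sqrt_mul h2.le]
    have e : 2 * ε * (a * b) * (a / (2 * ε * b)) = a * a := by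
      rw [mul_div_assoc', div_eq_iff h1.ne']; ring
    rw [e, Real.sqrt_mul_self ha.le]
  refine ⟨h2, h3, by rw [h4, h5], ?_⟩
  rw [Real.exp_neg, h4]
  have h6 := Real.sqrt_pos.2 h3
  have h9 := Real.mul_self_sqrt h3.le
  rw [eq_div_iff h1.ne'] at h9
  generalize Real.sqrt (a / (2 * ε * b)) = k at *
  generalize Real.sqrt (2 * ε * (a * b)) = S at *
  have h7 : S = k * (2 * ε * b) := by
    refine mul_right_cancel₀ h6.ne' ?_
    linarith
  rw [h7, ← div_eq_mul_inv, div_eq_iff h6.ne']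
  linear_combination b * k * hεε

/-- If `U` is isometric to `(ℝ × N, -ε ds² + e^{2 s} k)`, then the cone over `U` is isometric to
`(ℝ_+ × ℝ_ε × N, 2 du dv + u² k)`. -/
theorem exists_waveDiffeo [IsManifold I ∞ M] [IsManifold J ∞ N] {ε : ℝ} (hε : ε = 1 ∨ ε = -1)
    {g : FormField I M} {k : FormField J N} {U : Opens M}
    {Φ : (ℝ × N) ≃ₘ^∞⟮𝓘(ℝ, ℝ).prod J, I⟯ U}
    (hΦ : IsIsometry _ _ (expWarpedMetric J ε k) (restrictForm I g U) Φ)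
    {C : Opens (Cone M)} (hC : ∀ x : Cone M, x ∈ C ↔ x.2 ∈ U) :
    ∃ Ψ : C ≃ₘ^∞⟮coneModel I, waveModel J⟯ (WaveSpace ε N),
      IsIsometry _ _ (restrictForm (coneModel I) (coneMetric I ε g) C) (waveMetric J ε k) Ψ ∧
      ∀ (r : halfLine 1) (s : ℝ) (p : N), ∃ h : (r, (Φ (s, p) : M)) ∈ C,
        ((Ψ ⟨(r, (Φ (s, p) : M)), h⟩).1 : ℝ) = r * Real.exp s ∧
        ((Ψ ⟨(r, (Φ (s, p) : M)), h⟩).2.1 : ℝ) = ε / 2 * r * Real.exp (-s) ∧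
        (Ψ ⟨(r, (Φ (s, p) : M)), h⟩).2.2 = p := by
  have hεε : ε * ε = 1 := by rcases hε with rfl | rfl <;> norm_num
  have hr : ∀ r : halfLine 1, 0 < (r : ℝ) := fun r ↦ by
    have h : 0 < 1 * (r : ℝ) := r.2
    rwa [one_mul] at h
  let base : C → U := fun x ↦ ⟨x.1.2, (hC _).1 x.2⟩
  let coord : C → ℝ × N := fun x ↦ Φ.symm (base x)
  have hval : ContMDiff (coneModel I) (coneModel I) ∞ (Subtype.val : C → Cone M) :=
    contMDiff_subtype_val
  have hbase : ContMDiff (coneModel I) I ∞ base :=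
    (ContMDiff.subtypeVal_comp_iff U base).1 (contMDiff_snd.comp hval)
  have hcoord : ContMDiff (coneModel I) (𝓘(ℝ, ℝ).prod J) ∞ coord := Φ.symm.contMDiff.comp hbase
  have hrad : ContMDiff (coneModel I) 𝓘(ℝ, ℝ) ∞ (fun x : C ↦ (x.1.1 : ℝ)) :=
    (contMDiff_subtype_val (U := halfLine 1)).comp (contMDiff_fst.comp hval)
  have hs : ContMDiff (coneModel I) 𝓘(ℝ, ℝ) ∞ (fun x : C ↦ (coord x).1) := contMDiff_fst.comp hcoord
  have hp : ContMDiff (coneModel I) J ∞ (fun x : C ↦ (coord x).2) := contMDiff_snd.comp hcoord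
  let a : C → halfLine 1 := fun x ↦ ⟨x.1.1 * Real.exp (coord x).1, by
    change 0 < 1 * (x.1.1 * Real.exp (coord x).1)
    rw [one_mul]; exact mul_pos (hr _) (Real.exp_pos _)⟩
  let b : C → halfLine ε := fun x ↦ ⟨ε / 2 * x.1.1 * Real.exp (-(coord x).1), by
    change 0 < ε * (ε / 2 * x.1.1 * Real.exp (-(coord x).1))
    have h1 := mul_pos (hr x.1.1) (Real.exp_pos (-(coord x).1))
    have h2 : ε * (ε / 2 * x.1.1 * Real.exp (-(coord x).1)) =
      (ε * ε) * (x.1.1 * Real.exp (-(coord x).1)) / 2 := by ring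
    rw [h2, hεε]
    linarith⟩
  have ha : ContMDiff (coneModel I) 𝓘(ℝ, ℝ) ∞ a := by
    refine (ContMDiff.subtypeVal_comp_iff _ a).1 ?_
    exact hrad.mul (Real.contDiff_exp.contMDiff.comp hs)
  have hb : ContMDiff (coneModel I) 𝓘(ℝ, ℝ) ∞ b := by
    refine (ContMDiff.subtypeVal_comp_iff _ b).1 ?_
    exact (contMDiff_const.mul hrad).mul
      ((Real.contDiff_exp.comp contDiff_neg).contMDiff.comp hs)
  have hinv := fun y : WaveSpace ε N ↦ mul_mul_inv_exp_eq hε y.1.2 y.2.1.2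
  let r' : WaveSpace ε N → halfLine 1 := fun y ↦ ⟨Real.sqrt (2 * ε * (y.1 * y.2.1)), by
    change 0 < 1 * Real.sqrt (2 * ε * (y.1 * y.2.1))
    rw [one_mul]; exact Real.sqrt_pos.2 (hinv y).1⟩
  let c' : WaveSpace ε N → ℝ × N := fun y ↦ (Real.log (y.1 / (2 * ε * y.2.1)) / 2, y.2.2)
  let inv : WaveSpace ε N → C := fun y ↦ ⟨(r' y, Φ (c' y)), (hC _).2 (Φ (c' y)).2⟩
  have hy1 : ContMDiff (waveModel J) 𝓘(ℝ, ℝ) ∞ (fun y : WaveSpace ε N ↦ (y.1 : ℝ)) :=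
    (contMDiff_subtype_val (U := halfLine 1)).comp contMDiff_fst
  have hy2 : ContMDiff (waveModel J) 𝓘(ℝ, ℝ) ∞ (fun y : WaveSpace ε N ↦ (y.2.1 : ℝ)) :=
    (contMDiff_subtype_val (U := halfLine ε)).comp (contMDiff_fst.comp contMDiff_snd)
  have hr' : ContMDiff (waveModel J) 𝓘(ℝ, ℝ) ∞ r' := by
    refine (ContMDiff.subtypeVal_comp_iff _ r').1 fun y ↦ ?_
    exact ContMDiffAt.comp (g := Real.sqrt)
      (f := fun y : WaveSpace ε N ↦ 2 * ε * ((y.1 : ℝ) * y.2.1)) y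
      (Real.contDiffAt_sqrt (hinv y).1.ne').contMDiffAt
      (contMDiff_const.mul (hy1.mul hy2)).contMDiffAt
  have hc' : ContMDiff (waveModel J) (𝓘(ℝ, ℝ).prod J) ∞ c' := by
    refine ContMDiff.prodMk (fun y ↦ ?_) (contMDiff_snd.comp contMDiff_snd)
    have h1 : 2 * ε * (y.2.1 : ℝ) ≠ 0 := by
      intro h0
      have := (hinv y).2.1
      rw [h0, div_zero] at this
      exact lt_irrefl _ this
    have h2 : ContMDiffAt (waveModel J) 𝓘(ℝ, ℝ) ∞ (fun y : WaveSpace ε N ↦ 2 * ε * (y.2.1 : ℝ)) y :=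
      (contMDiff_const.mul hy2).contMDiffAt
    exact ContMDiffAt.comp (g := fun t ↦ Real.log t / 2)
      (f := fun y : WaveSpace ε N ↦ (y.1 : ℝ) / (2 * ε * y.2.1)) y
      ((Real.contDiffAt_log.2 (hinv y).2.1.ne').div_const 2).contMDiffAt
      (hy1.contMDiffAt.div₀ h2 h1)
  have hleft : ∀ x : C, inv (a x, b x, (coord x).2) = x := by
    intro x
    have e1 : 2 * ε * ((a x : ℝ) * b x) = x.1.1 ^ 2 := by
      change 2 * ε * (x.1.1 * Real.exp (coord x).1 * (ε / 2 * x.1.1 * Real.exp (-(coord x).1))) = _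
      have := Real.exp_ne_zero (coord x).1
      rw [Real.exp_neg]
      field_simp
      linear_combination (x.1.1 : ℝ) ^ 2 * hεε
    have e2 : (a x : ℝ) / (2 * ε * b x) = Real.exp (2 * (coord x).1) := by
      change x.1.1 * Real.exp (coord x).1 /
        (2 * ε * (ε / 2 * x.1.1 * Real.exp (-(coord x).1))) = _
      have h1 : 2 * ε * (ε / 2 * x.1.1 * Real.exp (-(coord x).1)) =
        x.1.1 * Real.exp (-(coord x).1) := by
        linear_combination (x.1.1 : ℝ) * Real.exp (-(coord x).1) * hεε
      rw [h1, mul_div_mul_left _ _ (hr _).ne', ← Real.exp_sub]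
      congr 1
      ring
    have e3 : c' (a x, b x, (coord x).2) = coord x := by
      refine Prod.ext ?_ rfl
      change Real.log ((a x : ℝ) / (2 * ε * b x)) / 2 = (coord x).1
      rw [e2, Real.log_exp]
      ring
    refine Subtype.ext (Prod.ext (Subtype.ext ?_) ?_)
    · change Real.sqrt (2 * ε * ((a x : ℝ) * b x)) = x.1.1
      rw [e1, Real.sqrt_sq (hr _).le]
    · change (Φ (c' (a x, b x, (coord x).2)) : M) = x.1.2
      rw [e3]
      change (Φ (Φ.symm (base x)) : M) = x.1.2
      rw [Φ.apply_symm_apply]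
  have hcoord_inv : ∀ y, coord (inv y) = c' y := fun y ↦ Φ.symm_apply_apply _
  let Ψ : C ≃ₘ^∞⟮coneModel I, waveModel J⟯ (WaveSpace ε N) :=
    { toFun := fun x ↦ (a x, b x, (coord x).2)
      invFun := inv
      left_inv := hleft
      right_inv := fun y ↦ by
        refine Prod.ext (Subtype.ext ?_) (Prod.ext (Subtype.ext ?_) ?_)
        · change (r' y : ℝ) * Real.exp (coord (inv y)).1 = y.1
          rw [hcoord_inv]; exact (hinv y).2.2.1
        · change ε / 2 * (r' y : ℝ) * Real.exp (-(coord (inv y)).1) = y.2.1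
          rw [hcoord_inv]; exact (hinv y).2.2.2
        · change (coord (inv y)).2 = y.2.2
          rw [hcoord_inv]
      contMDiff_toFun := ha.prodMk (hb.prodMk hp)
      contMDiff_invFun := (ContMDiff.subtypeVal_comp_iff C inv).1
        (hr'.prodMk ((contMDiff_subtype_val (U := U)).comp (Φ.contMDiff.comp hc'))) }
  refine ⟨Ψ, ?_, fun r s p ↦ ?_⟩
  -- The identity behind this is `du = e^s (dr + r ds)`, `dv = (ε/2) e^{-s} (dr - r ds)`. Hence `2
  -- du dv = ε (dr² - r² ds²)`, while `u² k = r² e^{2s} k`.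
  · intro x
    suffices key : ∀ v w : ℝ × E, formAt (waveModel J) (waveMetric J ε k) (Ψ x)
        (mder (coneModel I) (waveModel J) Ψ x v) (mder (coneModel I) (waveModel J) Ψ x w) =
        formAt (coneModel I) (restrictForm (coneModel I) (coneMetric I ε g) C) x v w from key
    intro v w
    have dbase : ∀ v : ℝ × E, mder (coneModel I) I base x v = v.2 := by
      intro v
      rw [← mder_coe_opens (hbase.mdiffAt x)]
      change mder (coneModel I) I (fun x : C ↦ x.1.2) x v = v.2
      rw [mder_comp_apply (h := Prod.snd) (f := (Subtype.val : C → Cone M)) (I' := coneModel I)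
        mdifferentiableAt_snd (hval.mdiffAt x), mder_subtype_val, mder_snd]
      rfl
    have drad : ∀ v : ℝ × E, mder (coneModel I) 𝓘(ℝ, ℝ) (fun x : C ↦ (x.1.1 : ℝ)) x v = v.1 := by
      intro v
      rw [mder_comp_apply (h := fun y : Cone M ↦ (y.1 : ℝ)) (f := (Subtype.val : C → Cone M))
        (I' := coneModel I) ((hasMFDerivAt_subtype_val _ _).mdifferentiableAt.comp _
          mdifferentiableAt_fst) (hval.mdiffAt x), mder_subtype_val, mder_halfLine_fst]
      rfl
    let L : E →L[ℝ] ℝ × E' := mder I (𝓘(ℝ, ℝ).prod J) Φ.symm (base x)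
    have dcoord : ∀ v : ℝ × E, mder (coneModel I) (𝓘(ℝ, ℝ).prod J) coord x v = L v.2 := by
      intro v
      rw [← dbase v]
      exact mder_comp_apply (Φ.symm.contMDiff.contMDiffAt.mdifferentiableAt (by simp)) (hbase.mdiffAt x) v
    have ds : ∀ v : ℝ × E, mder (coneModel I) 𝓘(ℝ, ℝ) (fun x : C ↦ (coord x).1) x v =
        (L v.2).1 := by
      intro v
      rw [mder_comp_apply (h := Prod.fst) (I' := 𝓘(ℝ, ℝ).prod J) mdifferentiableAt_fst (hcoord.mdiffAt x),
        mder_fst, dcoord]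
      rfl
    have dp : ∀ v : ℝ × E, mder (coneModel I) J (fun x : C ↦ (coord x).2) x v = (L v.2).2 := by
      intro v
      rw [mder_comp_apply (h := Prod.snd) (I' := 𝓘(ℝ, ℝ).prod J) mdifferentiableAt_snd (hcoord.mdiffAt x),
        mder_snd, dcoord]
      rfl
    have da : ∀ v : ℝ × E, mder (coneModel I) 𝓘(ℝ, ℝ) a x v =
        Real.exp (coord x).1 * (v.1 + x.1.1 * (L v.2).1) := by
      intro v
      rw [← mder_coe_opens (ha.mdiffAt x)]
      change mder (coneModel I) 𝓘(ℝ, ℝ) (fun x : C ↦ (x.1.1 : ℝ) * Real.exp (coord x).1) x v = _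
      rw [mder_mul (q := fun x ↦ Real.exp (coord x).1) (hrad.mdiffAt x) ((Real.contDiff_exp.contMDiff.comp hs).mdiffAt x), drad,
        mder_real_comp (hs.mdiffAt x) (Real.hasDerivAt_exp _), ds]
      ring
    have db : ∀ v : ℝ × E, mder (coneModel I) 𝓘(ℝ, ℝ) b x v =
        ε / 2 * Real.exp (-(coord x).1) * (v.1 - x.1.1 * (L v.2).1) := by
      intro v
      rw [← mder_coe_opens (hb.mdiffAt x)]
      change mder (coneModel I) 𝓘(ℝ, ℝ)
        (fun x : C ↦ ε / 2 * (x.1.1 : ℝ) * Real.exp (-(coord x).1)) x v = _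
      rw [mder_mul (p := fun x : C ↦ ε / 2 * (x.1.1 : ℝ)) (q := fun x ↦ Real.exp (-(coord x).1))
          ((contMDiff_const.mul hrad).mdiffAt x)
          (((Real.contDiff_exp.comp contDiff_neg).contMDiff.comp hs).mdiffAt x),
        mder_mul mdifferentiableAt_const (hrad.mdiffAt x), mder_const, drad,
        mder_real_comp (F := fun s ↦ Real.exp (-s)) (hs.mdiffAt x) (hasDerivAt_neg _).exp, ds]
      simp only [zero_apply]
      ring
    have dΨ : ∀ v : ℝ × E, mder (coneModel I) (waveModel J) Ψ x v =
        (Real.exp (coord x).1 * (v.1 + x.1.1 * (L v.2).1),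
          ε / 2 * Real.exp (-(coord x).1) * (v.1 - x.1.1 * (L v.2).1), (L v.2).2) := by
      intro v
      rw [← da, ← db, ← dp]
      have h1 : mder (coneModel I) (waveModel J) Ψ x = _ :=
        mder_prodMk (ha.mdiffAt x) ((hb.prodMk hp).mdiffAt x)
      rw [h1, mder_prodMk (hb.mdiffAt x) (hp.mdiffAt x)]
      rfl
    have hsymm := hΦ.formAt_symm (base x) v.2 w.2
    rw [expWarpedMetric_apply, restrictForm_apply] at hsymm
    rw [waveMetric_apply, restrictForm_apply, coneMetric_apply, dΨ, dΨ, ← hsymm]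
    change _ + (x.1.1 * Real.exp (coord x).1) ^ 2 * formAt J k (coord x).2 (L v.2).2 (L w.2).2 =
      ε * (v.1 * w.1) + (x.1.1 : ℝ) ^ 2 * (-ε * ((L v.2).1 * (L w.2).1) +
        Real.exp (2 * (coord x).1) * formAt J k (coord x).2 (L v.2).2 (L w.2).2)
    have e1 : Real.exp (2 * (coord x).1) = Real.exp (coord x).1 ^ 2 := by
      rw [← Real.exp_nat_mul]; rfl
    have e2 : Real.exp (coord x).1 * Real.exp (-(coord x).1) = 1 := by
      rw [← Real.exp_add, add_neg_cancel, Real.exp_zero]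
    rw [e1]
    simp only
    linear_combination ε * (v.1 * w.1 - (x.1.1 : ℝ) ^ 2 * ((L v.2).1 * (L w.2).1)) * e2
  · have hm : (r, (Φ (s, p) : M)) ∈ C := (hC _).2 (Φ (s, p)).2
    have e : coord ⟨(r, (Φ (s, p) : M)), hm⟩ = (s, p) := Φ.symm_apply_apply _
    refine ⟨hm, ?_, ?_, ?_⟩
    · change (r : ℝ) * Real.exp (coord ⟨(r, (Φ (s, p) : M)), hm⟩).1 = _
      rw [e]
    · change ε / 2 * (r : ℝ) * Real.exp (-(coord ⟨(r, (Φ (s, p) : M)), hm⟩).1) = _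
      rw [e]
    · change (coord ⟨(r, (Φ (s, p) : M)), hm⟩).2 = _
      rw [e]

end WaveDiffeo

/-! ### The parameter change `T' = 1 / Q` with quadratic `Q`. -/

section Reparametrization

/-- The component of `0` in `{Q > 0}` is an open interval around the compact one, so that two-sided
derivatives make sense at `b`. -/
theorem exists_isOpen_isPreconnected_pos {Q : ℝ → ℝ} (hQ : Continuous Q) {b : ℝ}
    (hpos : ∀ x ∈ uIcc 0 b, 0 < Q x) :
    ∃ J : Set ℝ, IsOpen J ∧ IsPreconnected J ∧ 0 ∈ J ∧ b ∈ J ∧ ∀ x ∈ J, 0 < Q x := by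
  have ho : IsOpen {x | 0 < Q x} := isOpen_lt continuous_const hQ
  have hsub : uIcc 0 b ⊆ connectedComponentIn {x | 0 < Q x} 0 :=
    isPreconnected_uIcc.subset_connectedComponentIn left_mem_uIcc hpos
  exact ⟨connectedComponentIn {x | 0 < Q x} 0, ho.connectedComponentIn,
    isPreconnected_connectedComponentIn, hsub left_mem_uIcc, hsub right_mem_uIcc,
    fun x hx ↦ connectedComponentIn_subset {x | 0 < Q x} 0 hx⟩

/-- A primitive of `1 / Q` on an interval on which `Q` is positive. -/
theorem exists_primitive_inv {Q : ℝ → ℝ} (hQ : ContDiff ℝ ∞ Q) {J : Set ℝ} (hJ : IsOpen J)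
    (hJc : IsPreconnected J) (h0 : 0 ∈ J) (hpos : ∀ x ∈ J, 0 < Q x) :
    ∃ T : ℝ → ℝ, T 0 = 0 ∧ (∀ x ∈ J, HasDerivAt T (Q x)⁻¹ x) ∧ ∀ x ∈ J, ContDiffAt ℝ ∞ T x := by
  let T : ℝ → ℝ := fun x ↦ ∫ y in (0 : ℝ)..x, (Q y)⁻¹
  have hcont : ContinuousOn (fun y ↦ (Q y)⁻¹) J :=
    hQ.continuous.continuousOn.inv₀ fun x hx ↦ (hpos x hx).ne'
  have hT : ∀ x ∈ J, HasDerivAt T (Q x)⁻¹ x := by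
    intro x hx
    have hsub : uIcc 0 x ⊆ J := hJc.ordConnected.uIcc_subset h0 hx
    exact intervalIntegral.integral_hasDerivAt_right
      ((hcont.mono hsub).intervalIntegrable)
      (hcont.stronglyMeasurableAtFilter hJ x hx) (hcont.continuousAt (hJ.mem_nhds hx))
  refine ⟨T, intervalIntegral.integral_same, hT, fun x hx ↦ ?_⟩
  refine ContDiffOn.contDiffAt ((contDiffOn_infty_iff_deriv_of_isOpen hJ).2 ⟨fun y hy ↦
    (hT y hy).differentiableAt.differentiableWithinAt, ?_⟩) (hJ.mem_nhds hx)
  refine ContDiffOn.congr (f := fun y ↦ (Q y)⁻¹) ?_ fun y hy ↦ (hT y hy).deriv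
  exact hQ.contDiffOn.inv fun y hy ↦ (hpos y hy).ne'

theorem eq_of_hasDerivAt_zero {f : ℝ → ℝ} {J : Set ℝ} (hJ : IsOpen J) (hJc : IsPreconnected J)
    (hf : ∀ x ∈ J, HasDerivAt f 0 x) {x y : ℝ} (hx : x ∈ J) (hy : y ∈ J) : f x = f y :=
  hJ.is_const_of_deriv_eq_zero hJc
    (fun x hx ↦ (hf x hx).differentiableAt.differentiableWithinAt) (fun x hx ↦ (hf x hx).deriv) hx hy

theorem hasDerivAt_quadratic (a b x : ℝ) :
    HasDerivAt (fun x ↦ 1 - 2 * a * x + b * x ^ 2) (-2 * a + 2 * b * x) x := by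
  have h1 := (((hasDerivAt_id x).const_mul (2 * a)).const_sub 1).add
    (((hasDerivAt_id x).pow 2).const_mul b)
  refine h1.congr_deriv ?_
  simp
  ring

/-- The logarithmic derivative of the solution of `w'' = (a² - b) w` in the parameter `∫ 1 / Q`,
where `Q = 1 - 2 a x + b x²`. -/
theorem add_mul_deriv_quadratic_eq_zero {a b : ℝ} {w w' T : ℝ → ℝ}
    (hw : ∀ t, HasDerivAt w (w' t) t)
    (hw' : ∀ t, HasDerivAt w' ((a ^ 2 - b) * w t) t) (hw0 : w 0 = 1) (hw'0 : w' 0 = a)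
    {J : Set ℝ} (hJ : IsOpen J) (hJc : IsPreconnected J) (h0 : 0 ∈ J)
    (hpos : ∀ x ∈ J, 0 < 1 - 2 * a * x + b * x ^ 2) (hT0 : T 0 = 0)
    (hT : ∀ x ∈ J, HasDerivAt T (1 - 2 * a * x + b * x ^ 2)⁻¹ x) {x : ℝ} (hx : x ∈ J) :
    w' (T x) + w (T x) * (-2 * a + 2 * b * x) / 2 = 0 := by
  have hQ' : ∀ x, HasDerivAt (fun x ↦ -2 * a + 2 * b * x) (2 * b) x := by
    intro x
    simpa using ((hasDerivAt_id x).const_mul (2 * b)).const_add (-2 * a)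
  -- `k` solves the linear equation `k' = (Q' / (2 Q)) k`, so `k² / Q` is constant, and `k` vanishes
  -- at `0`.
  let k : ℝ → ℝ := fun x ↦ w' (T x) + w (T x) * (-2 * a + 2 * b * x) / 2
  have hk : ∀ x ∈ J, HasDerivAt k
      ((-2 * a + 2 * b * x) / (2 * (1 - 2 * a * x + b * x ^ 2)) * k x) x := by
    intro x hx
    have h1 := ((hw' (T x)).comp x (hT x hx)).add
      ((((hw (T x)).comp x (hT x hx)).mul (hQ' x)).div_const 2)
    refine h1.congr_deriv ?_
    have hne := (hpos x hx).ne'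
    simp only [k, Function.comp_apply]
    obtain ⟨D, hD⟩ : ∃ D, D = 1 - 2 * a * x + b * x ^ 2 := ⟨_, rfl⟩
    rw [← hD] at hne ⊢
    field_simp
    rw [hD]
    ring
  have h1 : ∀ x ∈ J, HasDerivAt (fun x ↦ k x * k x / (1 - 2 * a * x + b * x ^ 2)) 0 x := by
    intro x hx
    have := (hpos x hx).ne'
    refine (((hk x hx).mul (hk x hx)).div (hasDerivAt_quadratic a b x) this).congr_deriv ?_
    simp only [Pi.mul_apply]
    field_simp
    ring
  have h2 := eq_of_hasDerivAt_zero hJ hJc h1 hx h0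
  have h3 : k 0 = 0 := by simp only [k, hT0, hw0, hw'0]; ring
  simp only [h3, mul_zero, zero_div] at h2
  rcases div_eq_zero_iff.1 h2 with h4 | h4
  · exact mul_self_eq_zero.1 h4
  · exact absurd h4 (hpos x hx).ne'

/-- The solution of `w'' = (a² - b) w` in the parameter `∫ 1 / Q`, `Q = 1 - 2 a x + b x²`, is
`1 / √Q`. -/
theorem mul_sqrt_eq_one {a b : ℝ} {w w' T : ℝ → ℝ} (hw : ∀ t, HasDerivAt w (w' t) t)
    (hw' : ∀ t, HasDerivAt w' ((a ^ 2 - b) * w t) t) (hw0 : w 0 = 1) (hw'0 : w' 0 = a)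
    {J : Set ℝ} (hJ : IsOpen J) (hJc : IsPreconnected J) (h0 : 0 ∈ J)
    (hpos : ∀ x ∈ J, 0 < 1 - 2 * a * x + b * x ^ 2) (hT0 : T 0 = 0)
    (hT : ∀ x ∈ J, HasDerivAt T (1 - 2 * a * x + b * x ^ 2)⁻¹ x) {x : ℝ} (hx : x ∈ J) :
    w (T x) * Real.sqrt (1 - 2 * a * x + b * x ^ 2) = 1 := by
  -- The derivative is `(w' + w Q' / 2) / √Q`, whose numerator vanishes by the previous lemma.
  have h1 : ∀ x ∈ J, HasDerivAt
      (fun x ↦ w (T x) * Real.sqrt (1 - 2 * a * x + b * x ^ 2)) 0 x := by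
    intro x hx
    refine (((hw (T x)).comp x (hT x hx)).mul
      ((hasDerivAt_quadratic a b x).sqrt (hpos x hx).ne')).congr_deriv ?_
    have h2 := add_mul_deriv_quadratic_eq_zero hw hw' hw0 hw'0 hJ hJc h0 hpos hT0 hT hx
    have h3 := Real.sqrt_pos.2 (hpos x hx)
    have h4 := Real.sq_sqrt (hpos x hx).le
    simp only [Function.comp_apply]
    generalize Real.sqrt (1 - 2 * a * x + b * x ^ 2) = S at *
    rw [← h4]
    field_simp
    linear_combination h2
  have h2 := eq_of_hasDerivAt_zero hJ hJc h1 hx h0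
  rw [h2, hT0, hw0]
  simp

end Reparametrization

/-! ### Reparametrizing and gluing geodesics. -/

section Geodesics

variable {E : Type*} [NormedAddCommGroup E] [NormedSpace ℝ E]

/-- The new acceleration is `T'² c'' + T'' c'`. The term `T'' c' = l T'² c'` cancels the tangential
defect `-l c'` of the pregeodesic, scaled by `T'²`. -/
theorem geodesicDefect_reparam {G : E → E →L[ℝ] E →L[ℝ] ℝ} {c : ℝ → E} {T : ℝ → ℝ} {x l : ℝ} {z : E}
    (hc : ContDiffAt ℝ 2 c (T x)) (hT : ContDiffAt ℝ 2 T x)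
    (h : geodesicDefect G c (T x) z = -l * G (c (T x)) (deriv c (T x)) z)
    (hl : deriv (deriv T) x = l * deriv T x ^ 2) :
    geodesicDefect G (fun y ↦ c (T y)) x z = 0 := by
  have hcd : ∀ᶠ t in nhds (T x), HasDerivAt c (deriv c t) t := by
    filter_upwards [hc.eventually (by simp)] with t ht
    exact (ht.differentiableAt (by simp)).hasDerivAt
  have hTd : ∀ᶠ y in nhds x, HasDerivAt T (deriv T y) y := by
    filter_upwards [hT.eventually (by simp)] with t ht
    exact (ht.differentiableAt (by simp)).hasDerivAt
  have e1 : deriv (fun y ↦ c (T y)) =ᶠ[nhds x] fun y ↦ deriv T y • deriv c (T y) := by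
    filter_upwards [hT.continuousAt.eventually hcd, hTd] with y h1 h2
    exact (h1.scomp y h2).deriv
  have hc2 : HasDerivAt (deriv c) (deriv (deriv c) (T x)) (T x) := by
    have : ContDiffAt ℝ 1 (deriv c) (T x) := hc.derivWithin (by norm_num)
    exact (this.differentiableAt (by simp)).hasDerivAt
  have hT2 : HasDerivAt (deriv T) (deriv (deriv T) x) x := by
    have : ContDiffAt ℝ 1 (deriv T) x := hT.derivWithin (by norm_num)
    exact (this.differentiableAt (by simp)).hasDerivAt
  have e2 : deriv (deriv (fun y ↦ c (T y))) x =
      deriv T x • deriv T x • deriv (deriv c) (T x) + deriv (deriv T) x • deriv c (T x) := by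
    rw [e1.deriv_eq]
    exact (hT2.smul (hc2.scomp x hTd.self_of_nhds)).deriv
  have e3 : ∀ s : ℝ, ∀ v : E, coordChristoffel G (c (T x)) (s • v) (s • v) z =
      s ^ 2 * coordChristoffel G (c (T x)) v v z := by
    intro s v
    rw [coordChristoffel_smul]
    unfold coordChristoffel
    have h1 : fderiv ℝ G (c (T x)) v (s • v) z = s * fderiv ℝ G (c (T x)) v v z := by
      rw [map_smul]; rfl
    have h2 : fderiv ℝ G (c (T x)) (s • v) v z = s * fderiv ℝ G (c (T x)) v v z := by
      rw [(fderiv ℝ G (c (T x))).map_smul s v]; rfl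
    have h3 : fderiv ℝ G (c (T x)) z (s • v) v = s * fderiv ℝ G (c (T x)) z v v := by
      rw [map_smul]; rfl
    rw [h2, h3, h1]
    ring
  unfold geodesicDefect at *
  rw [e2, e1.self_of_nhds, e3, map_add, map_smul, map_smul, map_smul, hl]
  simp only [add_apply, smul_apply, smul_eq_mul]
  linear_combination deriv T x ^ 2 * h

variable {M : Type*} [TopologicalSpace M] [ChartedSpace E M] [IsManifold 𝓘(ℝ, E) ∞ M]

/-- Geodesics defined on larger and larger intervals fit together. -/
theorem exists_global_geodesic [FiniteDimensional ℝ E] [T2Space M] {g : FormField 𝓘(ℝ, E) M}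
    (hg : IsSemiRiemannian 𝓘(ℝ, E) g) (p : M) (v : E)
    (h : ∀ b : ℝ, ∃ (J : Set ℝ) (γ : ℝ → M), IsOpen J ∧ IsPreconnected J ∧ 0 ∈ J ∧ b ∈ J ∧
      (∀ s ∈ J, ContMDiffAt 𝓘(ℝ, ℝ) 𝓘(ℝ, E) ∞ γ s ∧ IsGeodesicAt g γ s) ∧ γ 0 = p ∧
      velocity γ 0 = v) :
    ∃ γ : ℝ → M, IsGeodesic 𝓘(ℝ, E) g γ ∧ γ 0 = p ∧ velocity γ 0 = v := by
  have hle : (2 : WithTop ℕ∞) ≤ ∞ := WithTop.coe_le_coe.2 le_top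
  choose J γ hJ hJc h0 hb hγ hp hv using h
  -- The glued curve takes at time `s` the value of the piece that was built to reach `s`;
  -- uniqueness on intersections of intervals makes this consistent.
  have key : ∀ b, ∀ s ∈ J b, γ s s = γ b s := by
    intro b s hs
    have h1 : IsPreconnected (J s ∩ J b) :=
      ((hJc s).ordConnected.inter (hJc b).ordConnected).isPreconnected
    exact geodesic_eqOn hg ((hJ s).inter (hJ b)) h1 ⟨h0 s, h0 b⟩
      (fun r hr ↦ ⟨(hγ s r hr.1).1.of_le hle, (hγ s r hr.1).2⟩)
      (fun r hr ↦ ⟨(hγ b r hr.2).1.of_le hle, (hγ b r hr.2).2⟩)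
      ((hp s).trans (hp b).symm) ((hv s).trans (hv b).symm) ⟨hb s, hs⟩
  have hev : ∀ b, ∀ s ∈ J b, γ b =ᶠ[nhds s] fun s ↦ γ s s := by
    intro b s hs
    filter_upwards [(hJ b).mem_nhds hs] with r hr using (key b r hr).symm
  refine ⟨fun s ↦ γ s s, (isGeodesic_iff _ _).2 ⟨fun s ↦ ?_, fun s ↦ ?_⟩, hp 0, ?_⟩
  · exact (hγ s s (hb s)).1.congr_of_eventuallyEq (hev s s (hb s)).symm
  · exact isGeodesicAt_congr (hev s s (hb s)) (hγ s s (hb s)).2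
  · rw [← velocity_congr (hev 0 0 (h0 0)), hv]

end Geodesics

/-! ### Geodesics of a warped product. -/

section WarpedGeodesics

variable {F : Type*} [NormedAddCommGroup F] [NormedSpace ℝ F]

/-- The geodesic equation of a warped product `-ε ds² + e^{2 s} K`, tested against vectors tangent to
the fibre. -/
theorem geodesicDefect_warped {ε : ℝ} {G : ℝ × F → (ℝ × F) →L[ℝ] (ℝ × F) →L[ℝ] ℝ}
    {K : F → F →L[ℝ] F →L[ℝ] ℝ} {c : ℝ → ℝ × F} {t : ℝ} (hc : ContDiffAt ℝ 2 c t)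
    (hG : DifferentiableAt ℝ G (c t)) (hK : DifferentiableAt ℝ K (c t).2)
    (h : ∀ᶠ x in nhds (c t), ∀ v w, G x v w =
      -ε * (v.1 * w.1) + Real.exp (2 * x.1) * K x.2 v.2 w.2) (z : F) :
    geodesicDefect G c t (0, z) = Real.exp (2 * (c t).1) *
      (geodesicDefect K (fun s ↦ (c s).2) t z +
        2 * deriv (fun s ↦ (c s).1) t * K (c t).2 (deriv (fun s ↦ (c s).2) t) z) := by
  have hD : ∀ a v w : ℝ × F, fderiv ℝ G (c t) a v w =
      2 * a.1 * Real.exp (2 * (c t).1) * K (c t).2 v.2 w.2 +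
      Real.exp (2 * (c t).1) * fderiv ℝ K (c t).2 a.2 v.2 w.2 := by
    intro a v w
    rw [fderiv_bilin_apply hG, fderiv_bilin_apply hK]
    have e : (fun x ↦ G x v w) =ᶠ[nhds (c t)]
        fun x ↦ -ε * (v.1 * w.1) + Real.exp (2 * x.1) * K x.2 v.2 w.2 := by
      filter_upwards [h] with x hx using hx v w
    rw [e.fderiv_eq]
    have h1 : HasFDerivAt (fun x : ℝ × F ↦ Real.exp (2 * x.1))
        (Real.exp (2 * (c t).1) • (2 : ℝ) • ContinuousLinearMap.fst ℝ ℝ F) (c t) :=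
      (hasFDerivAt_fst.const_mul 2).exp
    have hK' : DifferentiableAt ℝ (fun y ↦ K y v.2 w.2) (c t).2 :=
      (hK.clm_apply (differentiableAt_const _)).clm_apply (differentiableAt_const _)
    have h2 : HasFDerivAt (fun x : ℝ × F ↦ K x.2 v.2 w.2)
        ((fderiv ℝ (fun y ↦ K y v.2 w.2) (c t).2).comp (ContinuousLinearMap.snd ℝ ℝ F)) (c t) :=
      HasFDerivAt.comp (g := fun y ↦ K y v.2 w.2) (f := Prod.snd) (c t) hK'.hasFDerivAt
        hasFDerivAt_snd
    have h3 : HasFDerivAt (fun x ↦ -ε * (v.1 * w.1) + Real.exp (2 * x.1) * K x.2 v.2 w.2) _ (c t) :=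
      (h1.mul h2).const_add (-ε * (v.1 * w.1))
    rw [h3.fderiv]
    simp only [add_apply, smul_apply, smul_eq_mul, ContinuousLinearMap.comp_apply,
      ContinuousLinearMap.coe_fst', ContinuousLinearMap.coe_snd']
    ring
  have hcd : ∀ᶠ s in nhds t, HasDerivAt c (deriv c s) s := by
    filter_upwards [hc.eventually (by simp)] with s hs
    exact (hs.differentiableAt (by simp)).hasDerivAt
  have hcd2 : HasDerivAt (deriv c) (deriv (deriv c) t) t := by
    have : ContDiffAt ℝ 1 (deriv c) t := hc.derivWithin (by norm_num)
    exact (this.differentiableAt (by simp)).hasDerivAt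
  have hfst {f : ℝ → ℝ × F} {f' : ℝ × F} {s : ℝ} (hf : HasDerivAt f f' s) :
      HasDerivAt (fun s ↦ (f s).1) f'.1 s :=
    HasFDerivAt.comp_hasDerivAt (l := Prod.fst) (f := f) s hasFDerivAt_fst hf
  have hsnd {f : ℝ → ℝ × F} {f' : ℝ × F} {s : ℝ} (hf : HasDerivAt f f' s) :
      HasDerivAt (fun s ↦ (f s).2) f'.2 s :=
    HasFDerivAt.comp_hasDerivAt (l := Prod.snd) (f := f) s hasFDerivAt_snd hf
  have e1 : deriv (fun s ↦ (c s).1) =ᶠ[nhds t] fun s ↦ (deriv c s).1 := by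
    filter_upwards [hcd] with s hs using (hfst hs).deriv
  have e2 : deriv (fun s ↦ (c s).2) =ᶠ[nhds t] fun s ↦ (deriv c s).2 := by
    filter_upwards [hcd] with s hs using (hsnd hs).deriv
  have e3 : deriv (deriv fun s ↦ (c s).2) t = (deriv (deriv c) t).2 := by
    rw [e2.deriv_eq]; exact (hsnd hcd2).deriv
  unfold geodesicDefect coordChristoffel
  rw [hD, hD, h.self_of_nhds, e3, e2.self_of_nhds, e1.self_of_nhds]
  simp only
  ring

end WarpedGeodesics

/-! ### Projections of geodesics to the level set. -/

section Completeness

variable {E : Type*} [NormedAddCommGroup E] [NormedSpace ℝ E]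
  {M : Type*} [TopologicalSpace M] [ChartedSpace E M]
  {E' : Type*} [NormedAddCommGroup E'] [NormedSpace ℝ E']
  {N : Type*} [TopologicalSpace N] [ChartedSpace E' N]

variable [FiniteDimensional ℝ E] [FiniteDimensional ℝ E'] [IsManifold 𝓘(ℝ, E) ∞ M]
  [IsManifold 𝓘(ℝ, E') ∞ N] [T2Space M]

namespace LevelSplitting

variable {ε σ : ℝ} {g : FormField 𝓘(ℝ, E) M} {u : M → ℝ} {Z : M → E} {θ : ℝ → M → M} {ι : N → M}

theorem mder_splitDiffeo (h : LevelSplitting (E' := E') ε σ g u Z θ ι) (x : ℝ × N) :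
    mder (𝓘(ℝ, ℝ).prod 𝓘(ℝ, E')) 𝓘(ℝ, E) h.splitDiffeo x =
      mder (𝓘(ℝ, ℝ).prod 𝓘(ℝ, E')) 𝓘(ℝ, E) (splitMap θ ι) x :=
  (mder_coe_opens (h.splitDiffeo.contMDiff.mdiffAt x)).symm

theorem mder_splitMap_bijective (h : LevelSplitting (E' := E') ε σ g u Z θ ι) (x : ℝ × N) :
    Function.Bijective (mder (𝓘(ℝ, ℝ).prod 𝓘(ℝ, E')) 𝓘(ℝ, E) (splitMap θ ι) x) := by
  rw [← h.mder_splitDiffeo]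
  have h1 := h.splitDiffeo.symm.mder_mder_symm
  have h2 := h.splitDiffeo.mder_mder_symm (h.splitDiffeo x)
  rw [h.splitDiffeo.symm_apply_apply] at h2
  exact ⟨fun v w hvw ↦ by
    rw [← h1 x v, ← h1 x w]
    exact congrArg _ hvw, fun v ↦ ⟨_, h2 v⟩⟩

theorem paramForm_splitParam (h : LevelSplitting (E' := E') ε σ g u Z θ ι) (p : N) {z : ℝ × E'}
    (hz : z.2 ∈ (extChartAt 𝓘(ℝ, E') p).target) (v w : ℝ × E') :
    paramForm g (splitParam θ ι p) z v w = -ε * (v.1 * w.1) + Real.exp (2 * z.1) *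
      chartForm 𝓘(ℝ, E') (inducedForm g ι) p z.2 v.2 w.2 := by
  rw [paramForm_apply, h.mder_splitParam p hz, h.mder_splitParam p hz, splitParam,
    h.formAt_mder_splitMap, chartForm_eq_paramForm, paramForm_apply]

theorem mder_splitParam_surjective (h : LevelSplitting (E' := E') ε σ g u Z θ ι) (p : N)
    {z : ℝ × E'} (hz : z.2 ∈ (extChartAt 𝓘(ℝ, E') p).target) :
    Function.Surjective (mder 𝓘(ℝ, ℝ × E') 𝓘(ℝ, E) (splitParam θ ι p) z) := by
  intro v
  obtain ⟨w, rfl⟩ := (h.mder_splitMap_bijective (z.1, (extChartAt 𝓘(ℝ, E') p).symm z.2)).2 v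
  have h1 := mder_symm_mder_extChartAt ((extChartAt 𝓘(ℝ, E') p).map_target hz) w.2
  rw [(extChartAt 𝓘(ℝ, E') p).right_inv hz] at h1
  refine ⟨(w.1, mder 𝓘(ℝ, E') 𝓘(ℝ, E') (extChartAt 𝓘(ℝ, E') p)
    ((extChartAt 𝓘(ℝ, E') p).symm z.2) w.2), ?_⟩
  rw [h.mder_splitParam p hz, h1]

theorem contMDiffAt_of_incl_eq (h : LevelSplitting (E' := E') ε σ g u Z θ ι) {γ : ℝ → M} {t : ℝ}
    (hγ : ContMDiffAt 𝓘(ℝ, ℝ) 𝓘(ℝ, E) ∞ γ t) (ht : 0 < σ * u (γ t)) {β : ℝ → N}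
    (hβ : ∀ᶠ s in nhds t, ι (β s) = levelProj σ u θ (γ s)) :
    ContMDiffAt 𝓘(ℝ, ℝ) 𝓘(ℝ, E') ∞ β t :=
  h.level.contMDiffAt_of_comp ((ContMDiffAt.comp (g := levelProj σ u θ) (f := γ) t
    (h.contMDiffAt_levelProj ht) hγ).congr_of_eventuallyEq hβ)

theorem eventually_pos (h : LevelSplitting (E' := E') ε σ g u Z θ ι) {γ : ℝ → M} {t : ℝ}
    (hγ : ContinuousAt γ t) (ht : 0 < σ * u (γ t)) : ∀ᶠ s in nhds t, 0 < σ * u (γ s) :=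
  hγ.eventually_mem (h.domain.2.mem_nhds ht)

/-- The projection of a geodesic to the level set is a pregeodesic. -/
theorem geodesicDefect_proj (h : LevelSplitting (E' := E') ε σ g u Z θ ι) {γ : ℝ → M} {t : ℝ}
    (hγ : ContMDiffAt 𝓘(ℝ, ℝ) 𝓘(ℝ, E) ∞ γ t) (hgeo : IsGeodesicAt g γ t)
    (ht : 0 < σ * u (γ t)) {β : ℝ → N}
    (hβ : ∀ᶠ s in nhds t, ι (β s) = levelProj σ u θ (γ s)) (z : E') :
    geodesicDefect (chartForm 𝓘(ℝ, E') (inducedForm g ι) (β t))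
      (fun s ↦ extChartAt 𝓘(ℝ, E') (β t) (β s)) t z =
    -(2 * deriv (fun s ↦ Real.log (σ * u (γ s))) t) *
      chartForm 𝓘(ℝ, E') (inducedForm g ι) (β t) (extChartAt 𝓘(ℝ, E') (β t) (β t))
        (deriv (fun s ↦ extChartAt 𝓘(ℝ, E') (β t) (β s)) t) z := by
  have hle : (2 : WithTop ℕ∞) ≤ ∞ := WithTop.coe_le_coe.2 le_top
  have hβs := h.contMDiffAt_of_incl_eq hγ ht hβ
  let c : ℝ → ℝ × E' := fun s ↦ (Real.log (σ * u (γ s)), extChartAt 𝓘(ℝ, E') (β t) (β s))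
  have hlog : ContMDiffAt 𝓘(ℝ, ℝ) 𝓘(ℝ, ℝ) ∞ (fun s ↦ Real.log (σ * u (γ s))) t :=
    ContMDiffAt.comp (g := Real.log) (f := fun s ↦ σ * u (γ s)) t
      (Real.contDiffAt_log.2 ht.ne').contMDiffAt
      (ContMDiffAt.comp (g := fun q ↦ σ * u q) (f := γ) t h.contMDiff_mul.contMDiffAt hγ)
  have hc : ContDiffAt ℝ 2 c t :=
    (hlog.contDiffAt.of_le hle).prodMk
      (contDiffAt_extChartAt_comp hle (hβs.of_le hle) (mem_extChartAt_source (I := 𝓘(ℝ, E')) (β t)))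
  have hct : (c t).2 ∈ (extChartAt 𝓘(ℝ, E') (β t)).target := mem_extChartAt_target (β t)
  have hψ := h.contMDiffAt_splitParam (β t) (z := c t) hct
  -- In the splitting, the first coordinate of `γ` is `log (σ u)` and the second is `β`. The
  -- equation along the fibre is then that of the warped product, and its factor `e^{2s}` cancels.
  have hev : γ =ᶠ[nhds t] fun s ↦ splitParam θ ι (β t) (c s) := by
    filter_upwards [hβ, h.eventually_pos hγ.continuousAt ht,
      eventually_mem_extChartAt_source hβs.continuousAt
        (mem_extChartAt_source (I := 𝓘(ℝ, E')) (β t))]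
      with s h1 h2 h3
    change _ = splitMap θ ι (Real.log (σ * u (γ s)),
      (extChartAt 𝓘(ℝ, E') (β t)).symm (extChartAt 𝓘(ℝ, E') (β t) (β s)))
    rw [(extChartAt 𝓘(ℝ, E') (β t)).left_inv h3, h.splitMap_of_incl_eq h2 h1]
  have h1 := (isGeodesicAt_iff_of_param h.metric (hψ.of_le hle)
    (h.mder_splitParam_surjective (β t) hct) hc hev).1 hgeo (0, z)
  have hG : DifferentiableAt ℝ (paramForm g (splitParam θ ι (β t))) (c t) :=
    (h.metric.contDiffAt_paramForm (m := ∞) (n := ∞) (by simp) le_rfl hψ).differentiableAt (by simp)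
  have hK : DifferentiableAt ℝ (chartForm 𝓘(ℝ, E') (inducedForm g ι) (β t)) (c t).2 :=
    (h.isSemiRiemannian_inducedForm.contDiffAt_chartForm (β t)).differentiableAt (by simp)
  rw [geodesicDefect_warped (ε := ε) hc hG hK] at h1
  · have h2 := (mul_eq_zero.1 h1).resolve_left (Real.exp_ne_zero _)
    linear_combination h2
  · filter_upwards [continuous_snd.continuousAt.eventually_mem
      ((isOpen_extChartAt_target (I := 𝓘(ℝ, E')) (β t)).mem_nhds hct)] with x hx v w
    exact h.paramForm_splitParam (β t) hx v w

end LevelSplitting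

end Completeness

/-! ### Completeness of the level set. -/

section LevelComplete

variable {E : Type*} [NormedAddCommGroup E] [NormedSpace ℝ E]
  {M : Type*} [TopologicalSpace M] [ChartedSpace E M]
  {E' : Type*} [NormedAddCommGroup E'] [NormedSpace ℝ E']
  {N : Type*} [TopologicalSpace N] [ChartedSpace E' N]

variable [FiniteDimensional ℝ E] [FiniteDimensional ℝ E'] [IsManifold 𝓘(ℝ, E) ∞ M]
  [IsManifold 𝓘(ℝ, E') ∞ N] [T2Space M]

namespace LevelSplitting

variable {ε σ : ℝ} {g : FormField 𝓘(ℝ, E) M} {u : M → ℝ} {Z : M → E} {θ : ℝ → M → M} {ι : N → M}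

theorem splitMap_zero (h : LevelSplitting (E' := E') ε σ g u Z θ ι) (p : N) :
    splitMap θ ι ((0 : ℝ), p) = ι p := h.flow.zero (ι p)

theorem mder_splitMap_zero_apply (h : LevelSplitting (E' := E') ε σ g u Z θ ι) (p : N) (a : ℝ)
    (w : E') : mder (𝓘(ℝ, ℝ).prod 𝓘(ℝ, E')) 𝓘(ℝ, E) (splitMap θ ι) ((0 : ℝ), p) (a, w) =
      a • unitField ε u Z (ι p) + mder 𝓘(ℝ, E') 𝓘(ℝ, E) ι p w := by
  have e : ((a, w) : ℝ × E') = a • ((1, 0) : ℝ × E') + (0, w) := by simp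
  rw [e, map_add, map_smul, h.mder_splitMap_one, h.mder_splitMap_zero, h.splitMap_zero]

/-- The geodesic of the level set with initial velocity `ξ`, on an interval containing `b`, is the
projection of a reparametrized geodesic. -/
theorem exists_geodesic_on (h : LevelSplitting (E' := E') ε σ g u Z θ ι)
    (hM : IsGeodesicallyComplete 𝓘(ℝ, E) g) (p : N) (ξ : E') (b : ℝ) :
    ∃ (J : Set ℝ) (β : ℝ → N), IsOpen J ∧ IsPreconnected J ∧ 0 ∈ J ∧ b ∈ J ∧
      (∀ s ∈ J, ContMDiffAt 𝓘(ℝ, ℝ) 𝓘(ℝ, E') ∞ β s ∧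
        IsGeodesicAt (inducedForm (E' := E') g ι) β s) ∧
      β 0 = p ∧ velocity β 0 = ξ := by
  have hle : (2 : WithTop ℕ∞) ≤ ∞ := WithTop.coe_le_coe.2 le_top
  obtain ⟨q, hq⟩ : ∃ q, q = formAt 𝓘(ℝ, E') (inducedForm g ι) p ξ ξ := ⟨_, rfl⟩
  -- The normal component `a` is free. Between `0` and `b` this choice gives `-2 a x = 2 |q| b x ≥ 2
  -- |q| x²`, which outweighs `ε q x² ≥ -|q| x²` and keeps `Q ≥ 1`.
  obtain ⟨a, ha⟩ : ∃ a, a = -|q| * b := ⟨_, rfl⟩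
  have hTZ := h.gradient.formAt_unitField_left h.eps_sq (h.incl_ne_zero p)
  have hTT := h.gradient.formAt_unitField h.eps_sq (h.incl_ne_zero p)
  have hξT : formAt 𝓘(ℝ, E) g (ι p) (mder 𝓘(ℝ, E') 𝓘(ℝ, E) ι p ξ) (unitField ε u Z (ι p)) = 0 :=
    (h.formAt_mder_unitField_iff p _).2 ⟨ξ, rfl⟩
  have hξZ := (h.formAt_unitField_eq_zero_iff (h.incl_ne_zero p) _).1 hξT
  have hTξ := (h.metric.formAt_symm (ι p) (unitField ε u Z (ι p)) _).trans hξT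
  obtain ⟨γ, hγ, hgeo, hγ0, hγv⟩ := exists_geodesic_of_complete hM (ι p)
    (a • unitField ε u Z (ι p) + mder 𝓘(ℝ, E') 𝓘(ℝ, E) ι p ξ)
  have hγ2 : ∀ t, ContMDiffAt 𝓘(ℝ, ℝ) 𝓘(ℝ, E) 2 γ t := fun t ↦ hγ.contMDiffAt.of_le hle
  have henergy : ∀ t, formAt 𝓘(ℝ, E) g (γ t) (velocity γ t) (velocity γ t) = -ε * a ^ 2 + q := by
    intro t
    have h1 := fun t ↦ hasDerivAt_energy h.metric (hγ2 t) (hgeo t)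
    rw [is_const_of_deriv_eq_zero (fun t ↦ (h1 t).differentiableAt) (fun t ↦ (h1 t).deriv) t 0,
      hγ0, hγv, map_add, map_add, map_smul, map_smul]
    simp only [add_apply, smul_apply, smul_eq_mul, hTT, hξT, hTξ]
    rw [hq, inducedForm_apply]
    ring
  -- The constant energy `-ε a² + q` turns the equation for `u` along `γ` into `w'' = (a² - ε q) w`,
  -- with `w(0) = 1` and `w'(0) = a`.
  let w : ℝ → ℝ := fun t ↦ σ * u (γ t)
  let w' : ℝ → ℝ := fun t ↦ σ * formAt 𝓘(ℝ, E) g (γ t) (velocity γ t) (Z (γ t))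
  have hw : ∀ t, HasDerivAt w (w' t) t := fun t ↦
    (h.gradient.hasDerivAt_comp ((hγ2 t).mdifferentiableAt (by simp))).const_mul σ
  have hw' : ∀ t, HasDerivAt w' ((a ^ 2 - ε * q) * w t) t := by
    intro t
    refine ((h.gradient.hasDerivAt_deriv_comp h.metric (hγ2 t) (hgeo t)).const_mul σ).congr_deriv ?_
    rw [henergy]
    simp only [w]
    linear_combination σ * u (γ t) * a ^ 2 * h.eps_sq
  have hw0 : w 0 = 1 := by simp only [w, hγ0, h.apply_incl, h.sign_sq]
  have hw'0 : w' 0 = a := by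
    simp only [w']
    rw [hγ0, hγv, map_add, map_smul]
    simp only [add_apply, smul_apply, smul_eq_mul, hTZ, hξZ, h.apply_incl]
    linear_combination a * h.sign_sq
  have hQc : ContDiff ℝ ∞ (fun x : ℝ ↦ 1 - 2 * a * x + ε * q * x ^ 2) := by fun_prop
  have hQpos : ∀ x ∈ uIcc 0 b, 0 < 1 - 2 * a * x + ε * q * x ^ 2 := by
    intro x hx
    have h1 : x ^ 2 ≤ b * x := by
      rcases mem_uIcc.1 hx with h1 | h1 <;> nlinarith
    have h2 : -|q| ≤ ε * q := by
      rcases h.eps_cases with rfl | rfl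
      · rw [one_mul]; exact neg_abs_le q
      · have := le_abs_self q; linarith
    have h3 := mul_le_mul_of_nonneg_left h1 (abs_nonneg q)
    have h4 := mul_le_mul_of_nonneg_right h2 (sq_nonneg x)
    have h5 := mul_nonneg (abs_nonneg q) (sq_nonneg x)
    rw [ha]
    nlinarith
  obtain ⟨J, hJ, hJc, h0J, hbJ, hJpos⟩ := exists_isOpen_isPreconnected_pos hQc.continuous hQpos
  obtain ⟨T, hT0, hT, hTs⟩ := exists_primitive_inv hQc hJ hJc h0J hJpos
  -- `γ` may leave `{σ u > 0}`, but not at parameters in `T(J)`, because there `w √Q = 1`.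
  have hwpos : ∀ x ∈ J, 0 < w (T x) := by
    intro x hx
    have h1 := mul_sqrt_eq_one hw hw' hw0 hw'0 hJ hJc h0J hJpos hT0 hT hx
    have h2 := Real.sqrt_pos.2 (hJpos x hx)
    exact pos_of_mul_pos_left (by rw [h1]; exact one_pos) h2.le
  classical
  let β : ℝ → N := fun t ↦ if ht : 0 < σ * u (γ t) then h.proj ⟨γ t, ht⟩ else p
  have hβ : ∀ t, 0 < σ * u (γ t) → ι (β t) = levelProj σ u θ (γ t) := by
    intro t ht
    simp only [β, dif_pos ht]
    exact h.incl_proj ⟨γ t, ht⟩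
  have hβev : ∀ x ∈ J, ∀ᶠ s in nhds (T x), ι (β s) = levelProj σ u θ (γ s) := by
    intro x hx
    filter_upwards [h.eventually_pos hγ.continuous.continuousAt (hwpos x hx)] with s hs
      using hβ s hs
  have hβs : ∀ x ∈ J, ContMDiffAt 𝓘(ℝ, ℝ) 𝓘(ℝ, E') ∞ β (T x) := fun x hx ↦
    h.contMDiffAt_of_incl_eq hγ.contMDiffAt (hwpos x hx) (hβev x hx)
  have hβT : ∀ x ∈ J, ContMDiffAt 𝓘(ℝ, ℝ) 𝓘(ℝ, E') ∞ (fun x ↦ β (T x)) x := fun x hx ↦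
    ContMDiffAt.comp (g := β) (f := T) x (hβs x hx) (hTs x hx).contMDiffAt
  have hβ0 : β (T 0) = p := by
    have h1 := hβ (T 0) (hwpos 0 h0J)
    refine h.level.isEmbedding.injective (h1.trans ?_)
    have h2 : σ * u (ι p) = 1 := by rw [h.apply_incl, h.sign_sq]
    rw [hT0, hγ0, levelProj, h2, Real.log_one, neg_zero, h.flow.zero]
  refine ⟨J, fun x ↦ β (T x), hJ, hJc, h0J, hbJ, fun x hx ↦ ⟨hβT x hx, fun z ↦ ?_⟩, hβ0, ?_⟩
  -- Here `l = 2 w' / w`. Since `T' = 1 / Q`, the condition `T'' = l T'²` reads `w' / w = -Q' / 2`,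
  -- which is `add_mul_deriv_quadratic_eq_zero`.
  · refine geodesicDefect_reparam (c := fun s ↦ extChartAt 𝓘(ℝ, E') (β (T x)) (β s))
      (contDiffAt_extChartAt_comp hle ((hβs x hx).of_le hle)
        (mem_extChartAt_source (I := 𝓘(ℝ, E')) (β (T x)))) ((hTs x hx).of_le hle)
      (h.geodesicDefect_proj hγ.contMDiffAt (hgeo _) (hwpos x hx) (hβev x hx) z) ?_
    have hne := (hJpos x hx).ne'
    have hwne := (hwpos x hx).ne'
    have e1 : deriv T =ᶠ[nhds x] fun x ↦ (1 - 2 * a * x + ε * q * x ^ 2)⁻¹ := by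
      filter_upwards [hJ.mem_nhds hx] with y hy using (hT y hy).deriv
    have e2 : deriv (deriv T) x =
        -(-2 * a + 2 * (ε * q) * x) / (1 - 2 * a * x + ε * q * x ^ 2) ^ 2 := by
      rw [e1.deriv_eq]
      exact ((hasDerivAt_quadratic a (ε * q) x).inv hne).deriv
    have e3 : deriv (fun s ↦ Real.log (σ * u (γ s))) (T x) = w' (T x) / w (T x) :=
      ((hw (T x)).log hwne).deriv
    have e4 := add_mul_deriv_quadratic_eq_zero hw hw' hw0 hw'0 hJ hJc h0J hJpos hT0 hT hx
    have e5 : w' (T x) / w (T x) = -(-2 * a + 2 * (ε * q) * x) / 2 := by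
      rw [div_eq_iff hwne]
      linear_combination e4
    rw [e2, e1.self_of_nhds, e3, e5]
    field_simp
  -- Differentiate `γ ∘ T = splitMap θ ι (S, β ∘ T)` at `0`. As `T'(0) = 1` and the derivative of
  -- `splitMap` is injective, the component along `N` is `ξ`.
  · have hT' : HasDerivAt T 1 0 := by
      refine (hT 0 h0J).congr_deriv ?_
      norm_num
    let S : ℝ → ℝ := fun x ↦ Real.log (w (T x))
    have hS : MDifferentiableAt 𝓘(ℝ, ℝ) 𝓘(ℝ, ℝ) S 0 :=
      ((((hw (T 0)).comp 0 (hT 0 h0J)).log (hwpos 0 h0J).ne').differentiableAt).mdifferentiableAt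
    have hβd : MDifferentiableAt 𝓘(ℝ, ℝ) 𝓘(ℝ, E') (fun x ↦ β (T x)) 0 :=
      (hβT 0 h0J).mdifferentiableAt (by simp)
    have hev : (fun x ↦ γ (T x)) =ᶠ[nhds 0] fun x ↦ splitMap θ ι (S x, β (T x)) := by
      filter_upwards [hJ.mem_nhds h0J] with x hx
      exact (h.splitMap_of_incl_eq (hwpos x hx) (hβ _ (hwpos x hx))).symm
    have hS0 : S 0 = 0 := by simp only [S, hT0, hw0, Real.log_one]
    have h1 : velocity (fun x ↦ γ (T x)) 0 = (velocity γ 0 : E) := by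
      unfold velocity
      rw [mder_comp_apply (h := γ) (f := T) ((hγ2 _).mdifferentiableAt (by simp))
        hT'.differentiableAt.mdifferentiableAt, mder_eq_fderiv, hT0, hT'.hasFDerivAt.fderiv]
      congr 1
      simp
    have h2 : velocity (fun x ↦ splitMap θ ι (S x, β (T x))) 0 =
        mder (𝓘(ℝ, ℝ).prod 𝓘(ℝ, E')) 𝓘(ℝ, E) (splitMap θ ι) ((0 : ℝ), p)
          (mder 𝓘(ℝ, ℝ) 𝓘(ℝ, ℝ) S 0 1, velocity (fun x ↦ β (T x)) 0) := by
      have h3 := mder_comp_apply (h := splitMap θ ι) (f := fun x ↦ (S x, β (T x)))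
        (h.mdifferentiableAt_splitMap _) (hS.prodMk hβd) 1
      rw [mder_prodMk hS hβd, hS0, hβ0] at h3
      exact h3
    rw [← velocity_congr hev, h1, hγv, ← h.mder_splitMap_zero_apply] at h2
    exact (congrArg Prod.snd ((h.mder_splitMap_bijective _).1 h2)).symm

theorem isGeodesicallyComplete_inducedForm [T2Space N]
    (h : LevelSplitting (E' := E') ε σ g u Z θ ι) (hM : IsGeodesicallyComplete 𝓘(ℝ, E) g) :
    IsGeodesicallyComplete 𝓘(ℝ, E') (inducedForm g ι) := by
  rintro ⟨p, ξ⟩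
  obtain ⟨γ, h1, rfl, rfl⟩ := exists_global_geodesic h.isSemiRiemannian_inducedForm p ξ
    (h.exists_geodesic_on hM p ξ)
  exact ⟨γ, h1, rfl⟩

end LevelSplitting

end LevelComplete

end

/-! ### Assembly of the theorem. -/

theorem mainTheorem2
    {E : Type uE} [NormedAddCommGroup E] [NormedSpace ℝ E] [FiniteDimensional ℝ E]
    {M : Type uM} [TopologicalSpace M] [T2Space M] [SecondCountableTopology M]
    [ChartedSpace E M] [IsManifold 𝓘(ℝ, E) ∞ M]
    (ε : ℝ) (hε : ε = 1 ∨ ε = -1)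
    (g : FormField 𝓘(ℝ, E) M) (hg : IsSemiRiemannian 𝓘(ℝ, E) g)
    (hcomplete : IsGeodesicallyComplete 𝓘(ℝ, E) g)
    (V : ∀ x : Cone M, TangentSpace (coneModel 𝓘(ℝ, E)) x)
    (hV : IsParallelField (coneModel 𝓘(ℝ, E)) (coneMetric 𝓘(ℝ, E) ε g) V)
    (hnull : ∀ x, V x ≠ 0 ∧ coneMetric 𝓘(ℝ, E) ε g x (V x) (V x) = 0) :
    -- the cone is the disjoint union of its three pieces
    (conePiece 𝓘(ℝ, E) ε g V (-1) ∪ coneZero 𝓘(ℝ, E) ε g V ∪ conePiece 𝓘(ℝ, E) ε g V 1 = univ ∧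
      Disjoint (conePiece 𝓘(ℝ, E) ε g V (-1)) (coneZero 𝓘(ℝ, E) ε g V) ∧
      Disjoint (conePiece 𝓘(ℝ, E) ε g V (-1)) (conePiece 𝓘(ℝ, E) ε g V 1) ∧
      Disjoint (coneZero 𝓘(ℝ, E) ε g V) (conePiece 𝓘(ℝ, E) ε g V 1)) ∧
    -- `ĝ(V, ∂_r)` is (the lift of) a smooth function `u` on `M`
    ∃ u : M → ℝ, ContMDiff 𝓘(ℝ, E) 𝓘(ℝ, ℝ) ∞ u ∧
      (∀ (r : halfLine 1) (p : M), radialComponent 𝓘(ℝ, E) ε g V (r, p) = u p) ∧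
      -- `Ĉ₀ = ℝ_{>0} × M₀` with `M₀ = {u = 0}`
      coneZero 𝓘(ℝ, E) ε g V = univ ×ˢ {p : M | u p = 0} ∧
      ∀ σ : ℝ, σ = 1 ∨ σ = -1 →
        -- the complete semi-Riemannian manifold `(N, gN)`, of dimension `dim M - 1`
        ∃ (N : Type uM) (_ : TopologicalSpace N)
          (_ : ChartedSpace (EuclideanSpace ℝ (Fin (Module.finrank ℝ E - 1))) N)
          (_ : IsManifold (𝓡 (Module.finrank ℝ E - 1)) ∞ N)
          (gN : FormField (𝓡 (Module.finrank ℝ E - 1)) N),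
          T2Space N ∧ SecondCountableTopology N ∧
          IsSemiRiemannian (𝓡 (Module.finrank ℝ E - 1)) gN ∧
          IsGeodesicallyComplete (𝓡 (Module.finrank ℝ E - 1)) gN ∧
          -- the coordinates `(s, p)` on the open set `Mσ = {σ u > 0}`,
          -- in which `g = -ε ds² + e^{2s} gN`
          ∃ (Mσ : Opens M) (Φ : (ℝ × N) ≃ₘ^∞⟮𝓘(ℝ, ℝ).prod (𝓡 (Module.finrank ℝ E - 1)),
              𝓘(ℝ, E)⟯ Mσ),
            (Mσ : Set M) = {p : M | 0 < σ * u p} ∧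
            IsIsometry _ _ (expWarpedMetric (𝓡 (Module.finrank ℝ E - 1)) ε gN)
              (restrictForm 𝓘(ℝ, E) g Mσ) Φ ∧
            -- the isometry of the open set `Ĉσ` onto `ℝ_+ × ℝ_ε × N`
            ∃ (Cσ : Opens (Cone M)) (Ψ : Cσ ≃ₘ^∞⟮coneModel 𝓘(ℝ, E),
                waveModel (𝓡 (Module.finrank ℝ E - 1))⟯ (WaveSpace ε N)),
              (Cσ : Set (Cone M)) = conePiece 𝓘(ℝ, E) ε g V σ ∧
              IsIsometry _ _ (restrictForm (coneModel 𝓘(ℝ, E)) (coneMetric 𝓘(ℝ, E) ε g) Cσ)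
                (waveMetric (𝓡 (Module.finrank ℝ E - 1)) ε gN) Ψ ∧
              ∀ (r : halfLine 1) (s : ℝ) (p : N),
                ∃ h : (r, (Φ (s, p) : M)) ∈ Cσ,
                  ((Ψ ⟨(r, (Φ (s, p) : M)), h⟩).1 : ℝ) = r * Real.exp s ∧
                  ((Ψ ⟨(r, (Φ (s, p) : M)), h⟩).2.1 : ℝ) = ε / 2 * r * Real.exp (-s) ∧
                  (Ψ ⟨(r, (Φ (s, p) : M)), h⟩).2.2 = p := by
  obtain ⟨u, Z, hu, hrad⟩ := exists_isConformalGradient hε hg hV fun x ↦ (hnull x).2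
  have hrad' : ∀ x, radialComponent 𝓘(ℝ, E) ε g V x = u x.2 := fun x ↦ hrad x.1 x.2
  have hεε : ε * ε = 1 := by rcases hε with rfl | rfl <;> norm_num
  refine ⟨⟨?_, ?_, ?_, ?_⟩, u, hu.contMDiff, hrad, ?_, fun σ hσ ↦ ?_⟩
  · refine eq_univ_of_forall fun x ↦ ?_
    simp only [conePiece, coneZero, mem_union, mem_ofPred_eq]
    rcases lt_trichotomy (radialComponent 𝓘(ℝ, E) ε g V x) 0 with h | h | h
    · exact Or.inl (Or.inl (by linarith))
    · exact Or.inl (Or.inr h)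
    · exact Or.inr (by linarith)
  · refine Set.disjoint_left.2 fun x h1 h2 ↦ ?_
    simp only [conePiece, coneZero, mem_ofPred_eq] at h1 h2
    linarith
  · refine Set.disjoint_left.2 fun x h1 h2 ↦ ?_
    simp only [conePiece, mem_ofPred_eq] at h1 h2
    linarith
  · refine Set.disjoint_left.2 fun x h1 h2 ↦ ?_
    simp only [conePiece, coneZero, mem_ofPred_eq] at h1 h2
    linarith
  · ext x
    simp [coneZero, hrad']
  · have hσσ : σ * σ = 1 := by rcases hσ with rfl | rfl <;> norm_num
    obtain ⟨θ, hθ⟩ := exists_isGeodesicFlow hcomplete (unitField ε u Z)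
    -- The truncated `dim M - 1` is harmless: at a point of the level set the differential is
    -- nonzero, so `dim M ≥ 1` unless the level set is empty.
    obtain ⟨hcs, hman, hlevel⟩ := exists_isRegularLevel (E := E)
      (E' := EuclideanSpace ℝ (Fin (Module.finrank ℝ E - 1))) (f := fun q ↦ σ * u q)
      (contMDiff_const.mul hu.contMDiff)
      (fun p hp ↦ hu.mder_ne_zero hεε (by rw [hp]; exact one_ne_zero)) (by simp)
    have h : LevelSplitting ε σ g u Z θ (LevelSet.incl (f := fun q ↦ σ * u q)) :=
      ⟨hg, hu, hθ, hlevel, hε, hσσ, by simp⟩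
    have hT2 : T2Space (LevelSet fun q ↦ σ * u q) := hlevel.isEmbedding.t2Space
    have hSC : SecondCountableTopology (LevelSet fun q ↦ σ * u q) :=
      hlevel.isEmbedding.secondCountableTopology
    refine ⟨LevelSet fun q ↦ σ * u q, inferInstance, hcs, hman, inducedForm g LevelSet.incl, hT2, hSC,
      h.isSemiRiemannian_inducedForm, h.isGeodesicallyComplete_inducedForm hcomplete,
      h.domain, h.splitDiffeo, rfl, h.isIsometry_splitDiffeo, ?_⟩
    let C : Opens (Cone M) := ⟨{x | x.2 ∈ h.domain}, h.domain.2.preimage continuous_snd⟩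
    obtain ⟨Ψ, h1, h2⟩ := exists_waveDiffeo hε h.isIsometry_splitDiffeo (C := C) fun x ↦ Iff.rfl
    refine ⟨C, Ψ, ?_, h1, h2⟩
    ext x
    change 0 < σ * u x.2 ↔ 0 < σ * radialComponent 𝓘(ℝ, E) ε g V x
    rw [hrad']
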